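/- Let $K$ be a field, $X$ an infinite, totally disconnected, compact metrizable space, $T:X\to X$ a homeomorphism, and $\mu$ an ergodic $T$-invariant Borel probability measure on $X$ that is full, i.e. $\mu(U)>0$ for every nonempty open $U$. Let $C_K(X)$ be the algebra of locally constant functions $X\to K$, and let $\mathcal A=C_K(X)\rtimes_T\mathbb Z$ be the algebraic crossed product, i.e. the algebra of finite sums $\sum_i f_it^i$ with $tf=(f\circ T^{-1})t$. Fix $y\in X$, a decreasing sequence of clopen sets $E_n$ $(n\ge 1)$ with $\bigcap_nE_n=\{y\}$, and finite partitions $\mathcal P_n$ of $X\setminus E_n$ into nonempty clopen sets such that $\mathcal P_{n+1}\cup\{E_{n+1}\}$ is finer than $\mathcal P_n\cup\{E_n\}$ and $\bigcup_n(\mathcal P_n\cup\{E_n\})$ generates the topology of $X$. Let $\mathbb V_n$ be the set of all nonempty sets $W=E_n\cap T^{-1}(Z_1)\cap\dots\cap T^{-k+1}(Z_{k-1})\cap T^{-k}(E_n)$ with $k\ge1$ and $Z_1,\dots,Z_{k-1}\in\mathcal P_n$, and put $|W|=k$. Let $\mathcal A_n\subseteq\mathcal A$ be the unital subalgebra generated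 by the elements $\chi_Zt$ and $t^{-1}\chi_Z$ for $Z\in\mathcal P_n$, and $\mathcal A_\infty=\bigcup_n\mathcal A_n$. Let $\mathfrak R_n=\prod_{W\in\mathbb V_n}M_{|W|}(K)$. Put $h_W=\sum_{l=0}^{|W|-1}\chi_{T^l(W)}$ and $e_{ij}(W)=(\chi_{X\setminus E_n}t)^i\chi_W(t^{-1}\chi_{X\setminus E_n})^j$ for $0\le i,j<|W|$. Let $\pi_n:\mathcal A_n\to\mathfrak R_n$, $\pi_n(a)=(h_Wa)_W$, where $h_W\mathcal A_n$ is identified with $M_{|W|}(K)$ through the matrix units $e_{ij}(W)$. Let $j_n:\mathfrak R_n\to\mathfrak R_{n+1}$ be the block diagonal embedding that sends the matrix unit $e_{ij}(W)$ to $\big(\sum_{j'}e_{i+j',j+j'}(W')\big)_{W'\in\mathbb V_{n+1}}$, where $j'$ ranges over the integers $0\le j'<|W'|$ with $W'\subseteq T^{-j'}(W)$. Let $\mathfrak R_\infty=\varinjlim(\mathfrak R_n,j_n)$, and let $\pi_\infty:\mathcal A_\infty\to\mathfrak R_\infty$ be the map induced by the maps $\pi_n$. For a unital ring $R$, let $\mathbb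 P(R)$ be the convex set of Sylvester matrix rank functions on $R$, and call $\mathrm{rk}\in\mathbb P(R)$ faithful if $x\in R$ and $\mathrm{rk}(x)=0$ imply $x=0$. (i) There is a Sylvester matrix rank function $\mathrm{rk}_{\mathfrak R_\infty}$ on $\mathfrak R_\infty$ whose value at the image in $\mathfrak R_\infty$ of any $x=(x_W)_W\in\mathfrak R_n$, for any $n$, is $$\sum_{W\in\mathbb V_n}|W|\,\mu(W)\cdot\frac{\mathrm{Rank}(x_W)}{|W|}.$$ It is faithful, and it is the unique Sylvester matrix rank function on $\mathfrak R_\infty$ such that $\mathrm{rk}_{\mathfrak R_\infty}(\pi_\infty(\chi_U))=\mu(U)$ for every clopen $U\subseteq X$. (ii) Let $\mathfrak R_{\mathrm{rk}}$ be the completion of $\mathfrak R_\infty$ with respect to the metric $d(x,y)=\mathrm{rk}_{\mathfrak R_\infty}(x-y)$, and let $\mathrm{rk}_{\mathfrak R_{\mathrm{rk}}}$ be the extension by continuity of $\mathrm{rk}_{\mathfrak R_\infty}$ to matrices over $\mathfrak R_{\mathrm{rk}}$. There is an injective ring homomorphism $\Phi:\mathcal A\to\mathfrak R_{\mathrm{rk}}$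 that extends $\pi_\infty:\mathcal A_\infty\to\mathfrak R_\infty\subseteq\mathfrak R_{\mathrm{rk}}$, such that $\mathrm{rk}_{\mathcal A}:=\mathrm{rk}_{\mathfrak R_{\mathrm{rk}}}\circ\Phi$ is a faithful Sylvester matrix rank function on $\mathcal A$, and it is the unique Sylvester matrix rank function on $\mathcal A$ such that $\mathrm{rk}_{\mathcal A}(\chi_U)=\mu(U)$ for every clopen $U\subseteq X$. Moreover, $\mathrm{rk}_{\mathfrak R_\infty}$ is an extreme point of $\mathbb P(\mathfrak R_\infty)$ and $\mathrm{rk}_{\mathcal A}$ is an extreme point of $\mathbb P(\mathcal A)$. -/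

import Mathlib

open MeasureTheory Filter Topology TopologicalSpace

namespace RankCP

noncomputable section

/-! ### Sylvester matrix rank functions -/

section Sylvester

/-- Real-valued functions on the set of all (rectangular, finite) matrices over `R`. It is a real
vector space under pointwise operations. -/
abbrev MatFun (R : Type*) : Type _ := (m n : ℕ) → Matrix (Fin m) (Fin n) R → ℝ

/-- The block matrix `(A B; C D)`, with rows and columns indexed by `Fin`. -/
def block {R : Type*} {m₁ m₂ n₁ n₂ : ℕ} (A : Matrix (Fin m₁) (Fin n₁) R)
    (B : Matrix (Fin m₁) (Fin n₂) R) (C : Matrix (Fin m₂) (Fin n₁) R)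
    (D : Matrix (Fin m₂) (Fin n₂) R) : Matrix (Fin (m₁ + m₂)) (Fin (n₁ + n₂)) R :=
  Matrix.reindex finSumFinEquiv finSumFinEquiv (Matrix.fromBlocks A B C D)

/-- Sylvester matrix rank functions on a unital ring. -/
structure IsSylvesterRank {R : Type*} [Ring R] (rk : MatFun R) : Prop where
  nonneg : ∀ m n (M : Matrix (Fin m) (Fin n) R), 0 ≤ rk m n M
  zero : ∀ m n, rk m n 0 = 0
  one : rk 1 1 1 = 1
  mul_le_left : ∀ l m n (M₁ : Matrix (Fin l) (Fin m) R) (M₂ : Matrix (Fin m) (Fin n) R),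
    rk l n (M₁ * M₂) ≤ rk l m M₁
  mul_le_right : ∀ l m n (M₁ : Matrix (Fin l) (Fin m) R) (M₂ : Matrix (Fin m) (Fin n) R),
    rk l n (M₁ * M₂) ≤ rk m n M₂
  diag : ∀ m₁ n₁ m₂ n₂ (M₁ : Matrix (Fin m₁) (Fin n₁) R) (M₂ : Matrix (Fin m₂) (Fin n₂) R),
    rk _ _ (block M₁ 0 0 M₂) = rk _ _ M₁ + rk _ _ M₂
  triangular : ∀ m₁ n₁ m₂ n₂ (M₁ : Matrix (Fin m₁) (Fin n₁) R) (M₂ : Matrix (Fin m₂) (Fin n₂) R)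
    (M₃ : Matrix (Fin m₁) (Fin n₂) R), rk _ _ M₁ + rk _ _ M₂ ≤ rk _ _ (block M₁ M₃ 0 M₂)

/-- The convex set `ℙ(R)` of all Sylvester matrix rank functions on `R`. -/
def SylvesterSpace (R : Type*) [Ring R] : Set (MatFun R) := {rk | IsSylvesterRank rk}

/-- The value of a matrix function at an element of the ring, seen as a `1 × 1` matrix. -/
def elt {R : Type*} (rk : MatFun R) (x : R) : ℝ := rk 1 1 (Matrix.of fun _ _ => x)

/-- `rk` is faithful if its kernel `{x ∈ R | rk x = 0}` is `{0}`. -/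
def IsFaithful {R : Type*} [Ring R] (rk : MatFun R) : Prop := {x : R | elt rk x = 0} = {0}

/-- The matrix function induced on `A` by a ring homomorphism `A → B` and a matrix function
on `B`. -/
def pullback {A B : Type*} [Ring A] [Ring B] (Φ : A →+* B) (rk : MatFun B) : MatFun A :=
  fun m n M => rk m n (M.map Φ)

variable {R : Type*} [Ring R] {rk : MatFun R}

theorem elt_nonneg (h : IsSylvesterRank rk) (x : R) : 0 ≤ elt rk x := h.nonneg _ _ _

theorem elt_zero (h : IsSylvesterRank rk) : elt rk (0 : R) = 0 := h.zero 1 1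

theorem elt_mul_le_left (h : IsSylvesterRank rk) (x y : R) : elt rk (x * y) ≤ elt rk x := by
  have := h.mul_le_left 1 1 1 (Matrix.of fun _ _ => x) (Matrix.of fun _ _ => y)
  have e : (Matrix.of fun _ _ => x * y : Matrix (Fin 1) (Fin 1) R) =
      (Matrix.of fun _ _ => x : Matrix (Fin 1) (Fin 1) R) * Matrix.of fun _ _ => y := by
    ext i j
    simp [Matrix.mul_apply]
  unfold elt
  rwa [e]

theorem elt_mul_le_right (h : IsSylvesterRank rk) (x y : R) : elt rk (x * y) ≤ elt rk y := by
  have := h.mul_le_right 1 1 1 (Matrix.of fun _ _ => x) (Matrix.of fun _ _ => y)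
  have e : (Matrix.of fun _ _ => x * y : Matrix (Fin 1) (Fin 1) R) =
      (Matrix.of fun _ _ => x : Matrix (Fin 1) (Fin 1) R) * Matrix.of fun _ _ => y := by
    ext i j
    simp [Matrix.mul_apply]
  unfold elt
  rwa [e]

theorem elt_neg_le (h : IsSylvesterRank rk) (x : R) : elt rk (-x) ≤ elt rk x := by
  simpa using elt_mul_le_right h (-1) x

theorem elt_add_le (h : IsSylvesterRank rk) (x y : R) :
    elt rk (x + y) ≤ elt rk x + elt rk y := by
  let X : Matrix (Fin 1) (Fin 1) R := Matrix.of fun _ _ => x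
  let Y : Matrix (Fin 1) (Fin 1) R := Matrix.of fun _ _ => y
  let u : Matrix (Fin 1) (Fin (1 + 1)) R := Matrix.of fun _ _ => 1
  let v : Matrix (Fin (1 + 1)) (Fin 1) R := Matrix.of fun _ _ => 1
  let D : Matrix (Fin (1 + 1)) (Fin (1 + 1)) R := block X 0 0 Y
  have h1 : rk _ _ D = rk _ _ X + rk _ _ Y := h.diag 1 1 1 1 X Y
  have h2 : rk _ _ (u * D) ≤ rk _ _ D := h.mul_le_right _ _ _ u D
  have h3 : rk _ _ (u * D * v) ≤ rk _ _ (u * D) := h.mul_le_left _ _ _ (u * D) v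
  have h4 : (Matrix.of fun _ _ => x + y : Matrix (Fin 1) (Fin 1) R) = u * D * v := by
    have e0 : (finSumFinEquiv.symm (0 : Fin (1 + 1)) : Fin 1 ⊕ Fin 1) = Sum.inl 0 := rfl
    have e1 : (finSumFinEquiv.symm (1 : Fin (1 + 1)) : Fin 1 ⊕ Fin 1) = Sum.inr 0 := rfl
    ext i j
    simp [Matrix.mul_apply, block, u, v, D, X, Y, e0, e1]
  unfold elt
  rw [h4]
  exact h3.trans (h2.trans h1.le)

end Sylvester

/-! ### The completion with respect to a Sylvester matrix rank function -/

section Completion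

variable {R : Type*} [Ring R] {rk : MatFun R}

/-- The ring of sequences in `R` that are Cauchy for the pseudo-metric `d(x, y) = rk (x - y)`. -/
def cauchySeqs (h : IsSylvesterRank rk) : Subring (ℕ → R) where
  carrier := {s | ∀ ε > 0, ∃ k, ∀ p ≥ k, ∀ q ≥ k, elt rk (s p - s q) < ε}
  mul_mem' := by
    intro s t hs ht ε hε
    obtain ⟨k₁, h₁⟩ := hs (ε / 2) (by positivity)
    obtain ⟨k₂, h₂⟩ := ht (ε / 2) (by positivity)
    refine ⟨max k₁ k₂, fun p hp q hq => ?_⟩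
    have e : (s * t) p - (s * t) q = (s p - s q) * t q + s p * (t p - t q) := by
      simp only [Pi.mul_apply]; noncomm_ring
    rw [e]
    have a1 := elt_add_le h ((s p - s q) * t q) (s p * (t p - t q))
    have a2 := elt_mul_le_left h (s p - s q) (t q)
    have a3 := elt_mul_le_right h (s p) (t p - t q)
    have a4 := h₁ p (le_trans (le_max_left _ _) hp) q (le_trans (le_max_left _ _) hq)
    have a5 := h₂ p (le_trans (le_max_right _ _) hp) q (le_trans (le_max_right _ _) hq)
    linarith
  one_mem' := fun ε hε => ⟨0, fun p _ q _ => by simpa [elt_zero h] using hε⟩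
  zero_mem' := fun ε hε => ⟨0, fun p _ q _ => by simpa [elt_zero h] using hε⟩
  add_mem' := by
    intro s t hs ht ε hε
    obtain ⟨k₁, h₁⟩ := hs (ε / 2) (by positivity)
    obtain ⟨k₂, h₂⟩ := ht (ε / 2) (by positivity)
    refine ⟨max k₁ k₂, fun p hp q hq => ?_⟩
    have e : (s + t) p - (s + t) q = (s p - s q) + (t p - t q) := by
      simp only [Pi.add_apply]; abel
    rw [e]
    have a1 := elt_add_le h (s p - s q) (t p - t q)
    have a4 := h₁ p (le_trans (le_max_left _ _) hp) q (le_trans (le_max_left _ _) hq)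
    have a5 := h₂ p (le_trans (le_max_right _ _) hp) q (le_trans (le_max_right _ _) hq)
    linarith
  neg_mem' := by
    intro s hs ε hε
    obtain ⟨k, hk⟩ := hs ε hε
    refine ⟨k, fun p hp q hq => ?_⟩
    have e : (-s) p - (-s) q = -(s p - s q) := by simp only [Pi.neg_apply]; abel
    rw [e]
    exact (elt_neg_le h _).trans_lt (hk p hp q hq)

/-- The ideal of sequences that converge to zero in rank. -/
def nullSeqs (h : IsSylvesterRank rk) : Ideal (cauchySeqs h) where
  carrier := {s | Tendsto (fun k => elt rk (s.1 k)) atTop (𝓝 0)}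
  zero_mem' := by simp [elt_zero h]
  add_mem' := by
    intro s t hs ht
    refine squeeze_zero (fun _ => elt_nonneg h _) (fun k => elt_add_le h (s.1 k) (t.1 k)) ?_
    simpa using Tendsto.add hs ht
  smul_mem' := by
    intro s t ht
    exact squeeze_zero (fun _ => elt_nonneg h _) (fun k => elt_mul_le_right h (s.1 k) (t.1 k)) ht

instance (h : IsSylvesterRank rk) : (nullSeqs h).IsTwoSided where
  mul_mem_of_left := by
    intro s t hs
    exact squeeze_zero (fun _ => elt_nonneg h _) (fun k => elt_mul_le_left h (s.1 k) (t.1 k)) hs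

/-- The rank completion of `R`: Cauchy sequences modulo null sequences. -/
def RankCompletion (h : IsSylvesterRank rk) : Type _ := cauchySeqs h ⧸ nullSeqs h

instance (h : IsSylvesterRank rk) : Ring (RankCompletion h) :=
  inferInstanceAs (Ring (cauchySeqs h ⧸ nullSeqs h))

/-- The canonical map of `R` into its rank completion, through constant sequences. -/
def toCompletion (h : IsSylvesterRank rk) : R →+* RankCompletion h :=
  (Ideal.Quotient.mk (nullSeqs h)).comp
    ((Pi.constRingHom ℕ R).codRestrict (cauchySeqs h)
      fun x ε hε => ⟨0, fun p _ q _ => by simpa [elt_zero h] using hε⟩)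

/-- A Cauchy sequence in `R` that represents a given element of the completion. -/
def repSeq (h : IsSylvesterRank rk) (x : RankCompletion h) : ℕ → R :=
  (Quotient.out (s := Submodule.quotientRel (nullSeqs h)) x).1

/-- The extension of the rank function to matrices over the completion by continuity:
the limit of the ranks of the matrices of `k`-th terms of representing Cauchy sequences. -/
def completionRank (h : IsSylvesterRank rk) : MatFun (RankCompletion h) :=
  fun m n M => limUnder atTop fun k : ℕ =>
    rk m n (Matrix.of fun i j => repSeq h (M i j) k)

end Completion

/-! ### The crossed product `C_K(X) ⋊_T ℤ` -/

section CrossedProduct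

variable (K : Type*) [Field K] {X : Type*} [TopologicalSpace X] (T : X ≃ₜ X)

/-- `C_K(X)`, the algebra of locally constant functions, remembering the homeomorphism `T`. -/
def CK {X : Type*} [TopologicalSpace X] (_T : X ≃ₜ X) : Type _ := LocallyConstant X K

instance : CommRing (CK K T) := inferInstanceAs (CommRing (LocallyConstant X K))
instance : Algebra K (CK K T) := inferInstanceAs (Algebra K (LocallyConstant X K))

/-- The identity map from the locally constant functions to `CK K T`. -/
def toCK : LocallyConstant X K ≃ₐ[K] CK K T :=
  (AlgEquiv.refl : LocallyConstant X K ≃ₐ[K] LocallyConstant X K)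

/-- The action of `ℤ` on `C_K(X)`: `(α_n b)(x) = b (T^{-n} x)`. -/
instance : MulSemiringAction (Multiplicative ℤ) (CK K T) where
  smul n b := LocallyConstant.comapRingHom ⟨_, (T ^ (-n.toAdd)).continuous⟩ b
  one_smul _ := rfl
  mul_smul n m b := by
    refine LocallyConstant.ext fun x => ?_
    change b.1 ((T ^ (-(n.toAdd + m.toAdd))) x) = b.1 ((T ^ (-m.toAdd)) ((T ^ (-n.toAdd)) x))
    rw [← Homeomorph.mul_apply, ← zpow_add, neg_add_rev]
  smul_zero n := map_zero (LocallyConstant.comapRingHom _)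
  smul_add n := map_add (LocallyConstant.comapRingHom _)
  smul_one n := map_one (LocallyConstant.comapRingHom _)
  smul_mul n := map_mul (LocallyConstant.comapRingHom _)

instance : SMulCommClass (Multiplicative ℤ) K (CK K T) where
  smul_comm _ _ _ := rfl

/-- The algebraic crossed product `𝒜 = C_K(X) ⋊_T ℤ`: finite formal sums `∑ f_i t^i`, where the
element `f t^i` is `SkewMonoidAlgebra.single (Multiplicative.ofAdd i) f`, with `t f = α(f) t`. -/
abbrev CrossedProduct : Type _ := SkewMonoidAlgebra (CK K T) (Multiplicative ℤ)

/-- The inclusion `C_K(X) ⊆ 𝒜`. -/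
def incl (f : LocallyConstant X K) : CrossedProduct K T :=
  SkewMonoidAlgebra.single (Multiplicative.ofAdd 0) (toCK K T f)

/-- The power `t^i` in `𝒜`, for `i : ℤ`. -/
def tpow (i : ℤ) : CrossedProduct K T :=
  SkewMonoidAlgebra.single (Multiplicative.ofAdd i) (1 : CK K T)

/-- The characteristic function `χ_U` of a clopen set, in `𝒜`. -/
def chi {U : Set X} (hU : IsClopen U) : CrossedProduct K T :=
  incl K T (LocallyConstant.charFn K hU)

end CrossedProduct

/-! ### The approximating data -/

/-- A decreasing sequence of clopen sets `E n` with intersection `{y}`, and partitions `P n` of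
`X \ E n` into nonempty clopen sets, such that `P (n+1) ∪ {E (n+1)}` is finer than `P n ∪ {E n}`
and these sets together generate the topology of `X`. -/
structure ApproxSystem (X : Type*) [inst : TopologicalSpace X] where
  y : X
  E : ℕ → Set X
  P : ℕ → Set (Set X)
  isClopen_E : ∀ n, IsClopen (E n)
  antitone_E : Antitone E
  iInter_E : ⋂ n, E n = {y}
  finite_P : ∀ n, (P n).Finite
  nonempty_P : ∀ n, ∀ Z ∈ P n, Z.Nonempty
  isClopen_P : ∀ n, ∀ Z ∈ P n, IsClopen Z
  disjoint_P : ∀ n, (P n).PairwiseDisjoint id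
  sUnion_P : ∀ n, ⋃₀ P n = (E n)ᶜ
  finer : ∀ n, ∀ Z' ∈ insert (E (n + 1)) (P (n + 1)), ∃ Z ∈ insert (E n) (P n), Z' ⊆ Z
  generates : inst = generateFrom (⋃ n, insert (E n) (P n))

section Tower

variable {X : Type*} [TopologicalSpace X] (T : X ≃ₜ X) (S : ApproxSystem X)

namespace ApproxSystem

/-- For a word `(Z_1, …, Z_{k-1})` in `P n`, the set
`W = E_n ∩ T⁻¹(Z_1) ∩ ⋯ ∩ T^{-k+1}(Z_{k-1}) ∩ T^{-k}(E_n)`. -/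
def cyl (n : ℕ) (w : List (S.P n)) : Set X :=
  S.E n ∩ (⋂ i : Fin w.length, (T^[i + 1]) ⁻¹' (w.get i).1) ∩ (T^[w.length + 1]) ⁻¹' S.E n

/-- The set `𝕍_n` of all nonempty sets `W` of the form `cyl`. Each such `W` is
recorded through its word, which it determines (see `cyl_injective`). -/
def V (n : ℕ) : Type _ := {w : List (S.P n) // (S.cyl T n w).Nonempty}

variable {S T}

/-- The subset `W` of `X`. -/
def V.set {n : ℕ} (W : S.V T n) : Set X := S.cyl T n W.1

/-- The length `|W| = k`. -/
def V.len {n : ℕ} (W : S.V T n) : ℕ := W.1.length + 1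

theorem V.mem_iff {n : ℕ} (W : S.V T n) (x : X) : x ∈ W.set ↔
    x ∈ S.E n ∧ (∀ i (h : i < W.1.length), T^[i + 1] x ∈ (W.1[i]).1) ∧ T^[W.len] x ∈ S.E n := by
  simp only [V.set, cyl, V.len, Set.mem_inter_iff, Set.mem_iInter, Set.mem_preimage, and_assoc,
    List.get_eq_getElem]
  constructor
  · rintro ⟨a, b, c⟩
    exact ⟨a, fun i h => b ⟨i, h⟩, c⟩
  · rintro ⟨a, b, c⟩
    exact ⟨a, fun i => b i.1 i.2, c⟩

theorem isClopen_cyl {n : ℕ} (w : List (S.P n)) : IsClopen (S.cyl T n w) := by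
  have hc : ∀ i, Continuous (T^[i]) := fun i => T.continuous.iterate i
  refine ((S.isClopen_E n).inter (isClopen_iInter_of_finite fun i => ?_)).inter
    ((S.isClopen_E n).preimage (hc _))
  exact (S.isClopen_P n _ (w.get i).2).preimage (hc _)

theorem V.isClopen {n : ℕ} (W : S.V T n) : IsClopen W.set := isClopen_cyl _

/-- The translates `T^l(W)` are clopen. -/
theorem V.isClopen_image {n : ℕ} (W : S.V T n) (l : ℕ) : IsClopen ((T ^ l) '' W.set) :=
  ⟨(T ^ l).isClosed_image.2 W.isClopen.1, (T ^ l).isOpen_image.2 W.isClopen.2⟩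

theorem notMem_E {n : ℕ} {Z : Set X} (hZ : Z ∈ S.P n) {x : X} (hx : x ∈ Z) : x ∉ S.E n := by
  have : x ∈ (S.E n)ᶜ := S.sUnion_P n ▸ ⟨Z, hZ, hx⟩
  exact this

theorem V.len_eq {n : ℕ} {W W' : S.V T n} {x : X} (h : x ∈ W.set) (h' : x ∈ W'.set) :
    W.len ≤ W'.len := by
  by_contra hlt
  rw [V.mem_iff] at h h'
  have hlt' : W'.1.length < W.1.length := by simp only [V.len] at hlt; omega
  exact notMem_E (W.1[W'.1.length]).2 (h.2.1 _ hlt') h'.2.2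

theorem V.eq_of_mem {n : ℕ} {W W' : S.V T n} {x : X} (h : x ∈ W.set) (h' : x ∈ W'.set) :
    W = W' := by
  have hl : W.1.length = W'.1.length := by
    have := V.len_eq h h'
    have := V.len_eq h' h
    simp only [V.len] at *
    omega
  rw [V.mem_iff] at h h'
  refine Subtype.ext (List.ext_getElem hl fun i h₁ h₂ => Subtype.ext ?_)
  by_contra hne
  exact Set.disjoint_left.1 (S.disjoint_P n (W.1[i]).2 (W'.1[i]).2 hne)
    (h.2.1 i h₁) (h'.2.1 i h₂)

/-- A set `W ∈ 𝕍_n` determines its word; distinct members of `𝕍_n` are disjoint. -/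
theorem cyl_injective (n : ℕ) : Function.Injective (V.set : S.V T n → Set X) := by
  intro W W' h
  obtain ⟨x, hx⟩ := W.2
  exact V.eq_of_mem (x := x) hx (h ▸ hx : x ∈ W'.set)

variable (S T)

/-- The pairs `(W, j')` of a `W ∈ 𝕍_n` and a `j' ∈ J(W, W')`, that is, `0 ≤ j' < |W'|` and
`W' ⊆ T^{-j'}(W)`. These are the arrows that end at `W' ∈ 𝕍_{n+1}`. -/
def Arrow {n : ℕ} (W' : S.V T (n + 1)) : Type _ :=
  {b : S.V T n × Fin W'.len // W'.set ⊆ (T^[b.2]) ⁻¹' b.1.set}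

variable {S T}

theorem V.mem_E_or {n : ℕ} (W : S.V T n) {m : ℕ} (hm : m ≤ W.len) :
    ∃ Z ∈ insert (S.E n) (S.P n), ∀ x' ∈ W.set, T^[m] x' ∈ Z := by
  rcases Nat.eq_zero_or_pos m with rfl | h0
  · exact ⟨S.E n, Set.mem_insert _ _, fun x' hx' => ((V.mem_iff W x').1 hx').1⟩
  rcases hm.lt_or_eq with h | rfl
  · obtain ⟨i, rfl⟩ : ∃ i, m = i + 1 := ⟨m - 1, by omega⟩
    have hi : i < W.1.length := by simp only [V.len] at h; omega
    exact ⟨(W.1[i]).1, Set.mem_insert_of_mem _ (W.1[i]).2,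
      fun x' hx' => ((V.mem_iff W x').1 hx').2.1 i hi⟩
  · exact ⟨S.E n, Set.mem_insert _ _, fun x' hx' => ((V.mem_iff W x').1 hx').2.2⟩

theorem V.coarse {n : ℕ} (W : S.V T (n + 1)) {m : ℕ} (hm : m ≤ W.len) :
    ∃ Z ∈ insert (S.E n) (S.P n), ∀ x' ∈ W.set, T^[m] x' ∈ Z := by
  obtain ⟨Z', hZ', h⟩ := W.mem_E_or hm
  obtain ⟨Z, hZ, hs⟩ := S.finer n Z' hZ'
  exact ⟨Z, hZ, fun x' hx' => hs (h x' hx')⟩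

theorem atom_unique {n : ℕ} {Z Z' : Set X} (hZ : Z ∈ insert (S.E n) (S.P n))
    (hZ' : Z' ∈ insert (S.E n) (S.P n)) {x : X} (hx : x ∈ Z) (hx' : x ∈ Z') : Z = Z' := by
  rcases hZ with rfl | hZ <;> rcases hZ' with rfl | hZ'
  · rfl
  · exact absurd hx (notMem_E hZ' hx')
  · exact absurd hx' (notMem_E hZ hx)
  · by_contra hne
    exact Set.disjoint_left.1 (S.disjoint_P n hZ hZ' hne) hx hx'

theorem V.last_mem {n : ℕ} (W : S.V T (n + 1)) {x : X} (hx : x ∈ W.set) : T^[W.len] x ∈ S.E n :=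
  S.antitone_E (Nat.le_succ n) ((V.mem_iff W x).1 hx).2.2

theorem V.notMem_of_lt {n : ℕ} (W : S.V T n) {x : X} (hx : x ∈ W.set) {i : ℕ} (h0 : 0 < i)
    (hi : i < W.len) : T^[i] x ∉ S.E n := by
  obtain ⟨i, rfl⟩ : ∃ k, i = k + 1 := ⟨i - 1, by omega⟩
  have hi' : i < W.1.length := by simp only [V.len] at hi; omega
  exact notMem_E (W.1[i]).2 (((V.mem_iff W x).1 hx).2.1 i hi')

theorem Arrow.lt {n : ℕ} {W' : S.V T (n + 1)} (b : S.Arrow T W') (i : Fin b.1.1.len) :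
    b.1.2.1 + i.1 < W'.len := by
  by_contra hlt
  obtain ⟨x, hx⟩ := W'.2
  have hb := b.2 hx
  have hj := b.1.2.2
  have := V.notMem_of_lt b.1.1 hb (i := W'.len - b.1.2.1) (by omega) (by have := i.2; omega)
  rw [← Function.iterate_add_apply, show W'.len - b.1.2.1 + b.1.2.1 = W'.len by omega] at this
  exact this (W'.last_mem hx)

/-- The place `j' + i` in the tower over `W'` of the `i`-th level of the block `(W, j')`. -/
def place {n : ℕ} (W' : S.V T (n + 1)) (p : Σ b : S.Arrow T W', Fin b.1.1.len) : Fin W'.len :=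
  ⟨p.1.1.2.1 + p.2.1, Arrow.lt p.1 p.2⟩

theorem place_injective {n : ℕ} (W' : S.V T (n + 1)) : Function.Injective (place W') := by
  obtain ⟨x, hx⟩ := W'.2
  have key : ∀ (b c : S.Arrow T W') (i : Fin b.1.1.len) (j : Fin c.1.1.len),
      b.1.2.1 + i.1 = c.1.2.1 + j.1 → ¬ b.1.2.1 < c.1.2.1 := by
    intro b c i j h hlt
    have hb := b.2 hx
    have hc := ((V.mem_iff _ _).1 (c.2 hx)).1
    have := V.notMem_of_lt b.1.1 hb (i := c.1.2.1 - b.1.2.1) (by omega) (by have := i.2; omega)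
    rw [← Function.iterate_add_apply, show c.1.2.1 - b.1.2.1 + b.1.2.1 = c.1.2.1 by omega] at this
    exact this hc
  rintro ⟨b, i⟩ ⟨c, j⟩ h
  have h : b.1.2.1 + i.1 = c.1.2.1 + j.1 := congrArg Fin.val h
  have h1 := key b c i j h
  have h2 := key c b j i h.symm
  have h3 : b.1.2 = c.1.2 := Fin.ext (by omega)
  have h4 : b.1.1 = c.1.1 := V.eq_of_mem (x := T^[b.1.2.1] x) (b.2 hx) (h3 ▸ c.2 hx)
  obtain rfl : b = c := Subtype.ext (Prod.ext h4 h3)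
  obtain rfl : i = j := Fin.ext (by omega)
  rfl

theorem place_surjective {n : ℕ} (W' : S.V T (n + 1)) : Function.Surjective (place W') := by
  classical
  intro l
  obtain ⟨x, hx⟩ := W'.2
  have hx : x ∈ W'.set := hx
  have h0 : T^[0] x ∈ S.E n := S.antitone_E (Nat.le_succ n) ((V.mem_iff W' x).1 hx).1
  let j := Nat.findGreatest (fun m => T^[m] x ∈ S.E n) l.1
  have hjl : j ≤ l.1 := Nat.findGreatest_le _
  have hj : T^[j] x ∈ S.E n :=
    Nat.findGreatest_spec (P := fun m => T^[m] x ∈ S.E n) (Nat.zero_le _) h0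
  have hjmax : ∀ m, j < m → m ≤ l.1 → T^[m] x ∉ S.E n := fun m h1 h2 =>
    Nat.findGreatest_is_greatest h1 h2
  have hl := l.2
  have hex : ∃ k, T^[j + (k + 1)] x ∈ S.E n :=
    ⟨W'.len - j - 1, by
      rw [show j + (W'.len - j - 1 + 1) = W'.len by omega]; exact W'.last_mem hx⟩
  let k := Nat.find hex
  have hk : T^[j + (k + 1)] x ∈ S.E n := Nat.find_spec hex
  have hkmin : ∀ m < k, T^[j + (m + 1)] x ∉ S.E n := fun m hm => Nat.find_min hex hm
  have hkle : k ≤ W'.len - j - 1 := Nat.find_min' hex (by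
      rw [show j + (W'.len - j - 1 + 1) = W'.len by omega]; exact W'.last_mem hx)
  have hlt : l.1 < j + (k + 1) := by
    by_contra hge
    exact hjmax _ (by omega) (not_lt.1 hge) hk
  have hZ : ∀ m : Fin k, ∃ Z : S.P n, ∀ x' ∈ W'.set, T^[j + (m.1 + 1)] x' ∈ Z.1 := by
    intro m
    have hm := m.2
    obtain ⟨Z, hZ, h⟩ := W'.coarse (m := j + (m.1 + 1)) (by omega)
    rcases hZ with rfl | hZ
    · exact absurd (h x hx) (hkmin _ m.2)
    · exact ⟨⟨Z, hZ⟩, h⟩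
  choose Z hZ using hZ
  have hE : ∀ m, m ≤ W'.len → T^[m] x ∈ S.E n → ∀ x' ∈ W'.set, T^[m] x' ∈ S.E n := by
    intro m hm hmx x' hx'
    obtain ⟨Z, hZ, h⟩ := W'.coarse hm
    rw [atom_unique (Set.mem_insert (S.E n) (S.P n)) hZ hmx (h x hx)]
    exact h x' hx'
  have hsub : ∀ x' ∈ W'.set, T^[j] x' ∈ S.cyl T n (List.ofFn Z) := by
    intro x' hx'
    refine ⟨⟨hE j (by omega) hj x' hx', Set.mem_iInter.2 fun i => ?_⟩, ?_⟩
    · have := hZ ⟨i.1, by simpa using i.2⟩ x' hx'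
      rw [Set.mem_preimage, ← Function.iterate_add_apply, add_comm]
      simpa using this
    · rw [Set.mem_preimage, ← Function.iterate_add_apply, add_comm, List.length_ofFn]
      exact hE _ (by omega) hk x' hx'
  let W : S.V T n := ⟨List.ofFn Z, ⟨_, hsub x hx⟩⟩
  have hW : W.len = k + 1 := by simp [W, V.len]
  refine ⟨⟨⟨(W, ⟨j, by omega⟩), hsub⟩, ⟨l.1 - j, ?_⟩⟩, ?_⟩
  · change l.1 - j < W.len
    omega
  · exact Fin.ext (by simp only [place]; omega)

/-- The levels of the tower over `W'` are partitioned into the levels of the blocks `(W, j')`. -/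
def placeEquiv {n : ℕ} (W' : S.V T (n + 1)) :
    (Σ b : S.Arrow T W', Fin b.1.1.len) ≃ Fin W'.len :=
  Equiv.ofBijective (place W') ⟨place_injective W', place_surjective W'⟩

instance {n : ℕ} (W' : S.V T (n + 1)) : Finite (S.Arrow T W') :=
  Finite.of_injective (fun b => placeEquiv W' ⟨b, ⟨0, Nat.succ_pos _⟩⟩) fun _ _ h =>
    congrArg Sigma.fst ((placeEquiv W').injective h)

end ApproxSystem

end Tower

/-! ### The regular rings `ℜ_n` and `ℜ_∞` -/

section RegularRings

variable (K : Type*) [Field K] {X : Type*} [TopologicalSpace X] (T : X ≃ₜ X) (S : ApproxSystem X)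

/-- `ℜ_n = ∏_{W ∈ 𝕍_n} M_{|W|}(K)`. -/
abbrev Rn (n : ℕ) : Type _ := (W : S.V T n) → Matrix (Fin W.len) (Fin W.len) K

open Classical in
/-- The block diagonal map `j_n : ℜ_n → ℜ_{n+1}`, which sends the matrix unit `e_{ij}(W)` to
`(∑_{j' ∈ J(W, W')} e_{i+j', j+j'}(W'))_{W'}`. -/
def jn (n : ℕ) : Rn K T S n →+* Rn K T S (n + 1) :=
  RingHom.pi fun W' =>
    letI := Fintype.ofFinite (S.Arrow T W')
    ((Matrix.reindexRingEquiv K (ApproxSystem.placeEquiv W')).toRingHom.comp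
      (Matrix.blockDiagonal'RingHom (fun b : S.Arrow T W' => Fin b.1.1.len) K)).comp
      (RingHom.pi fun b : S.Arrow T W' => Pi.evalRingHom _ b.1.1)

/-- The composite `ℜ_n → ℜ_m` of the maps `j`, for `n ≤ m`. -/
def jle {n m : ℕ} (h : n ≤ m) : Rn K T S n →+* Rn K T S m :=
  Nat.leRec (motive := fun m _ => Rn K T S n →+* Rn K T S m) (RingHom.id _)
    (fun k _ f => (jn K T S k).comp f) h

theorem jle_self {n : ℕ} : jle K T S (le_refl n) = RingHom.id _ := Nat.leRec_self _ _

theorem jle_succ {n m : ℕ} (h : n ≤ m) :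
    jle K T S (h.trans (Nat.le_succ m)) = (jn K T S m).comp (jle K T S h) :=
  Nat.leRec_succ _ _ h

instance : DirectedSystem (Rn K T S) (fun _ _ h => ⇑(jle K T S h)) where
  map_self n x := by rw [jle_self]; rfl
  map_map k m n hnm hmk x := by
    induction k, hmk using Nat.le_induction with
    | base => rw [jle_self]; rfl
    | succ k hmk ih =>
      rw [jle_succ K T S hmk, jle_succ K T S (hnm.trans hmk), RingHom.comp_apply, ih]
      rfl

/-- `ℜ_∞ = lim (ℜ_n, j_n)`. -/
abbrev RInf : Type _ := DirectLimit (Rn K T S) (fun _ _ h => jle K T S h)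

/-- The canonical map `ℜ_n → ℜ_∞`. -/
def toRInf (n : ℕ) : Rn K T S n →+* RInf K T S :=
  DirectLimit.Ring.of (Rn K T S) (fun _ _ h => jle K T S h) n

/-- The rank function `rk_{ℜ_n}(x) = ∑_{W ∈ 𝕍_n} α_W rk_{|W|}(x_W)` on `ℜ_n`, where
`α_W = |W| μ(W)` and `rk_{|W|}` is the usual rank divided by `|W|`. -/
def rkRn {K : Type*} [Field K] {T : X ≃ₜ X} {S : ApproxSystem X} [MeasurableSpace X]
    (μ : Measure X) (n : ℕ) (x : Rn K T S n) : ℝ :=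
  ∑' W : S.V T n, (W.len * μ.real W.set) * ((x W).rank / W.len)

end RegularRings

/-! ### The approximating algebras `𝒜_n`, and their embeddings into `ℜ_n` and `ℜ_∞` -/

section Embedding

variable (K : Type*) [Field K] {X : Type*} [TopologicalSpace X] (T : X ≃ₜ X) (S : ApproxSystem X)

/-- `𝒜_n`, the unital subalgebra of `𝒜` generated by the elements `χ_Z t` and their
adjoints `(χ_Z t)^* = t⁻¹ χ_Z`, for `Z ∈ P n`. -/
def An (n : ℕ) : Subalgebra K (CrossedProduct K T) :=
  Algebra.adjoin K
    (Set.range (fun Z : S.P n => chi K T (S.isClopen_P n Z.1 Z.2) * tpow K T 1) ∪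
      Set.range (fun Z : S.P n => tpow K T (-1) * chi K T (S.isClopen_P n Z.1 Z.2)))

variable {S T}

/-- The matrix unit `e_{ij}(W) = (χ_{X∖E_n} t)^i χ_W (t⁻¹ χ_{X∖E_n})^j` in `𝒜_n`. -/
def eW {n : ℕ} (W : S.V T n) (i j : Fin W.len) : CrossedProduct K T :=
  (chi K T (S.isClopen_E n).compl * tpow K T 1) ^ (i : ℕ) * chi K T W.isClopen *
    (tpow K T (-1) * chi K T (S.isClopen_E n).compl) ^ (j : ℕ)

/-- The central projection `h_W = ∑_{l < |W|} χ_{T^l(W)}` of `𝒜_n`. -/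
def hW {n : ℕ} (W : S.V T n) : CrossedProduct K T :=
  ∑ l : Fin W.len, chi K T (W.isClopen_image l)

variable (S T)

open Classical in
/-- `π_n(a) = (h_W a)_W` for `a ∈ 𝒜_n`, where `h_W 𝒜_n` is identified with `M_{|W|}(K)` through
the matrix units `e_{ij}(W)`: the component at `W` is the matrix `c` with
`h_W a = ∑ c_{ij} e_{ij}(W)`. (The value zero when there is no such matrix is never used.) -/
def piN (n : ℕ) (a : CrossedProduct K T) : Rn K T S n := fun W =>
  if h : ∃ c : Matrix (Fin W.len) (Fin W.len) K, hW K W * a = ∑ i, ∑ j, c i j • eW K W i j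
  then h.choose else 0

/-- `𝒜_∞ = ⋃_n 𝒜_n`. -/
def AInf : Set (CrossedProduct K T) := ⋃ n, (An K T S n : Set (CrossedProduct K T))

open Classical in
/-- The map `π_∞ : 𝒜_∞ → ℜ_∞` induced by the maps `π_n`. (The value zero outside `𝒜_∞` is never
used.) -/
def piInf (a : CrossedProduct K T) : RInf K T S :=
  if h : ∃ n, a ∈ An K T S n then toRInf K T S (Nat.find h) (piN K T S (Nat.find h) a) else 0

end Embedding

end

end RankCP

open RankCP

/-! Put weight `μ(W)` on the ordinary rank of each factor of `ℜ_n`. The levels `T^l(W)`, `0 ≤ l <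
|W|`, are pairwise disjoint. By ergodicity almost every orbit visits `E_n` in both directions, so
the levels cover `X` up to a null set. This gives `∑ |W| μ(W) = 1` (`tsum_len_mul_measure`), which
normalises the rank function. Almost every point of `W` lies in exactly one translate `T^{j'}(W')`
that `j_n` places over `W` (`tsum_arrow_measure`). Hence the weighted ranks are compatible with
`j_n` and pass to the limit `ℜ_∞`. Faithfulness there follows from `μ(W) > 0`, and `χ_U` acts on a
fine enough tower as a 0-1 diagonal matrix, which gives it rank `μ(U)`.

Uniqueness rests on one algebraic fact. A matrix over a finite product of matrix algebras is
equivalent, by multiplication on both sides, to a diagonal matrix of minimal idempotents. A rank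
function on the image of such a product is therefore determined by its values on minimal idempotents
(`rank_map_eq_sum`). Here these are the functions `χ_W`, whose rank is prescribed. Ranks of matrices
are Lipschitz in the entries, so agreement on such images propagates to everything they approximate
in rank (`eq_of_approx`). In `ℜ_∞` it is enough to discard all but finitely many towers. In `𝒜` an
element is multiplied by the characteristic function of the levels far from both ends of finitely
many towers (`exists_mul_mem_srange`). The discarded part has small measure because `μ(E_n) → μ({y})
= 0`. The last equality holds since an atom of an ergodic measure that is full would force `X` to be
a finite orbit. The same approximation proves that a rank function on `𝒜` with these values is
faithful (`isFaithful_of_elt_chi`).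

To embed `𝒜`, note that `χ_{X∖E_n} t` and `t⁻¹ χ_{X∖E_n}` are rank-Cauchy sequences in `𝒜_∞`. They
are inverse to each other up to idempotents of rank `μ(E_n)`, so they define a unit of the
completion that implements `T` (`shiftUnit`). The universal property of the crossed product yields
`Φ`, which is injective because the pulled back rank is faithful.

For extremality, write the rank function as `a N₁ + b N₂`. On clopen sets `N₁` is a content
dominated by `a⁻¹ μ`, hence it extends to a measure that is absolutely continuous with respect to
`μ`. Conjugation by the partial isometries `χ_{X∖E_n} t` shows that this measure is invariant away
from `E_n`, and then invariant in the limit. By ergodicity it equals `μ`, so `N₁` is the given rank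
function by uniqueness. -/

namespace RankCP

noncomputable section

/-! ### Generalities on Sylvester matrix rank functions -/

section General

variable {R : Type*} [Ring R] {rk : MatFun R}

/-- The rank of a matrix indexed by arbitrary finite types. -/
def grk (rk : MatFun R) {ι κ : Type*} [Fintype ι] [Fintype κ] (M : Matrix ι κ R) : ℝ :=
  rk (Fintype.card ι) (Fintype.card κ)
    (M.submatrix (Fintype.equivFin ι).symm (Fintype.equivFin κ).symm)

/-- Selecting rows and columns is multiplication by 0-1 matrices on either side. The maps may repeat
indices, so reindexing along bijections is the special case in which the inequality can be reversed.
-/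
theorem rank_submatrix_le_rank (h : IsSylvesterRank rk) {m n p q : ℕ} (M : Matrix (Fin m) (Fin n) R)
    (f : Fin p → Fin m) (g : Fin q → Fin n) : rk p q (M.submatrix f g) ≤ rk m n M := by
  have e : M.submatrix f g = (1 : Matrix (Fin m) (Fin m) R).submatrix f id * M *
      (1 : Matrix (Fin n) (Fin n) R).submatrix id g := by
    ext i j
    simp [Matrix.mul_apply, Matrix.one_apply]
  rw [e]
  exact (h.mul_le_left _ _ _ _ _).trans (h.mul_le_right _ _ _ _ _)

theorem grk_submatrix_le_fin (h : IsSylvesterRank rk) {ι κ : Type*} [Fintype ι] [Fintype κ]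
    {m n : ℕ} (M : Matrix (Fin m) (Fin n) R) (e : ι → Fin m) (f : κ → Fin n) :
    grk rk (M.submatrix e f) ≤ rk m n M := by
  unfold grk
  rw [Matrix.submatrix_submatrix]
  exact rank_submatrix_le_rank h _ _ _

theorem grk_eq (h : IsSylvesterRank rk) {ι κ : Type*} [Fintype ι] [Fintype κ] {m n : ℕ}
    (M : Matrix ι κ R) (e : ι ≃ Fin m) (f : κ ≃ Fin n) :
    grk rk M = rk m n (M.submatrix e.symm f.symm) := by
  apply le_antisymm
  · have := grk_submatrix_le_fin h (M.submatrix e.symm f.symm) e f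
    simpa using this
  · unfold grk
    have := rank_submatrix_le_rank h
      (M.submatrix (Fintype.equivFin ι).symm (Fintype.equivFin κ).symm)
      (Fintype.equivFin ι ∘ e.symm) (Fintype.equivFin κ ∘ f.symm)
    simpa [Matrix.submatrix_submatrix, Function.comp_def] using this

theorem grk_fin (h : IsSylvesterRank rk) {m n : ℕ} (M : Matrix (Fin m) (Fin n) R) :
    grk rk M = rk m n M := by
  simpa using grk_eq h M (Equiv.refl _) (Equiv.refl _)

theorem grk_mul_le_left (h : IsSylvesterRank rk) {ι κ l : Type*} [Fintype ι] [Fintype κ]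
    [Fintype l] (M : Matrix ι κ R) (N : Matrix κ l R) : grk rk (M * N) ≤ grk rk M := by
  unfold grk
  rw [← Matrix.submatrix_mul_equiv M N _ (Fintype.equivFin κ).symm]
  exact h.mul_le_left _ _ _ _ _

theorem grk_mul_le_right (h : IsSylvesterRank rk) {ι κ l : Type*} [Fintype ι] [Fintype κ]
    [Fintype l] (M : Matrix ι κ R) (N : Matrix κ l R) : grk rk (M * N) ≤ grk rk N := by
  unfold grk
  rw [← Matrix.submatrix_mul_equiv M N _ (Fintype.equivFin κ).symm]
  exact h.mul_le_right _ _ _ _ _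

theorem grk_fromBlocks_diag (h : IsSylvesterRank rk) {ι κ ι' κ' : Type*} [Fintype ι] [Fintype κ]
    [Fintype ι'] [Fintype κ'] (M : Matrix ι κ R) (N : Matrix ι' κ' R) :
    grk rk (Matrix.fromBlocks M 0 0 N) = grk rk M + grk rk N := by
  rw [grk_eq h (Matrix.fromBlocks M 0 0 N)
    ((Equiv.sumCongr (Fintype.equivFin ι) (Fintype.equivFin ι')).trans finSumFinEquiv)
    ((Equiv.sumCongr (Fintype.equivFin κ) (Fintype.equivFin κ')).trans finSumFinEquiv)]
  unfold grk
  rw [← h.diag]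
  refine congrArg _ ?_
  ext i j
  obtain ⟨i, rfl⟩ := finSumFinEquiv.surjective i
  obtain ⟨j, rfl⟩ := finSumFinEquiv.surjective j
  rcases i with i | i <;> rcases j with j | j <;> simp [block]

/-- `M + N` is `diag(M, N)` multiplied by the row `(1 1)` on the left and the corresponding column
on the right. -/
theorem rank_add_le (h : IsSylvesterRank rk) {m n : ℕ} (M N : Matrix (Fin m) (Fin n) R) :
    rk m n (M + N) ≤ rk m n M + rk m n N := by
  have e : M + N = Matrix.fromCols (1 : Matrix (Fin m) (Fin m) R) (1 : Matrix (Fin m) (Fin m) R) * Matrix.fromBlocks M 0 0 N *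
      Matrix.fromRows (1 : Matrix (Fin n) (Fin n) R) (1 : Matrix (Fin n) (Fin n) R) := by
    rw [Matrix.fromCols_mul_fromBlocks, Matrix.fromCols_mul_fromRows]
    simp
  rw [← grk_fin h, ← grk_fin h M, ← grk_fin h N, ← grk_fromBlocks_diag h, e]
  exact (grk_mul_le_left h _ _).trans (grk_mul_le_right h _ _)

theorem rank_neg (h : IsSylvesterRank rk) {m n : ℕ} (M : Matrix (Fin m) (Fin n) R) :
    rk m n (-M) = rk m n M := by
  have key : ∀ M : Matrix (Fin m) (Fin n) R, rk m n (-M) ≤ rk m n M := fun M => by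
    simpa using h.mul_le_right _ _ _ (-1 : Matrix (Fin m) (Fin m) R) M
  exact le_antisymm (key M) (by simpa using key (-M))

theorem rank_sum_le (h : IsSylvesterRank rk) {m n : ℕ} {α : Type*} (s : Finset α)
    (M : α → Matrix (Fin m) (Fin n) R) : rk m n (∑ i ∈ s, M i) ≤ ∑ i ∈ s, rk m n (M i) := by
  classical
  induction s using Finset.induction_on with
  | empty => simp [h.zero]
  | insert a s ha ih =>
    rw [Finset.sum_insert ha, Finset.sum_insert ha]
    exact (rank_add_le h _ _).trans (by linarith)

theorem rank_single_le (h : IsSylvesterRank rk) {m n : ℕ} (i : Fin m) (j : Fin n) (x : R) :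
    rk m n (Matrix.single i j x) ≤ elt rk x := by
  have e : Matrix.single i j x = Matrix.single i (0 : Fin 1) (1 : R) *
      (Matrix.of fun _ _ => x : Matrix (Fin 1) (Fin 1) R) * Matrix.single (0 : Fin 1) j (1 : R) := by
    have : (Matrix.of fun _ _ => x : Matrix (Fin 1) (Fin 1) R) = Matrix.single 0 0 x := by
      ext a b
      obtain rfl := Subsingleton.elim 0 a
      obtain rfl := Subsingleton.elim 0 b
      simp
    rw [this]
    simp
  rw [e]
  exact (h.mul_le_left _ _ _ _ _).trans (h.mul_le_right _ _ _ _ _)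

theorem rank_le_sum_elt (h : IsSylvesterRank rk) {m n : ℕ} (M : Matrix (Fin m) (Fin n) R) :
    rk m n M ≤ ∑ i, ∑ j, elt rk (M i j) := by
  conv_lhs => rw [Matrix.matrix_eq_sum_single M]
  exact (rank_sum_le h _ _).trans (Finset.sum_le_sum fun i _ => (rank_sum_le h _ _).trans
    (Finset.sum_le_sum fun j _ => rank_single_le h i j _))

/-- The Lipschitz property behind both the extension of ranks to the completion and the
approximation principle `eq_of_approx`. -/
theorem abs_rank_sub_le (h : IsSylvesterRank rk) {m n : ℕ} (M N : Matrix (Fin m) (Fin n) R) :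
    |rk m n M - rk m n N| ≤ ∑ i, ∑ j, elt rk (M i j - N i j) := by
  have h1 := rank_le_sum_elt h (M - N)
  have h2 := rank_add_le h (M - N) N
  have h3 := rank_add_le h (-(M - N)) M
  rw [rank_neg h] at h3
  simp only [sub_add_cancel, neg_sub, Matrix.sub_apply] at h1 h2 h3
  rw [abs_le]
  constructor <;> linarith

theorem elt_neg (h : IsSylvesterRank rk) (x : R) : elt rk (-x) = elt rk x :=
  le_antisymm (elt_neg_le h x) (by simpa using elt_neg_le h (-x))

theorem elt_one (h : IsSylvesterRank rk) : elt rk (1 : R) = 1 := by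
  rw [← h.one]
  unfold elt
  congr 1
  ext i j
  obtain rfl := Subsingleton.elim i j
  simp

theorem elt_sub_le (h : IsSylvesterRank rk) (x y : R) : elt rk (x - y) ≤ elt rk x + elt rk y := by
  rw [sub_eq_add_neg, ← elt_neg h y]
  exact elt_add_le h _ _

theorem rank_diagonal (h : IsSylvesterRank rk) {n : ℕ} (d : Fin n → R) :
    rk n n (Matrix.diagonal d) = ∑ i, elt rk (d i) := by
  induction n with
  | zero => simpa [Subsingleton.elim (Matrix.diagonal d) 0] using h.zero 0 0
  | succ n ih =>
    have e : Matrix.diagonal d = block (Matrix.diagonal fun i : Fin n => d i.castSucc) 0 0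
        (Matrix.of fun _ _ => d (Fin.last n) : Matrix (Fin 1) (Fin 1) R) := by
      ext i j
      obtain ⟨i, rfl⟩ := finSumFinEquiv.surjective i
      obtain ⟨j, rfl⟩ := finSumFinEquiv.surjective j
      rcases i with i | i <;> rcases j with j | j
      · simp [block, Matrix.diagonal_apply]
        rfl
      · have := i.2
        simp [block, Matrix.diagonal_apply, Fin.ext_iff]
        omega
      · have := j.2
        simp [block, Matrix.diagonal_apply, Fin.ext_iff]
        omega
      · obtain rfl := Subsingleton.elim i j
        obtain rfl := Subsingleton.elim 0 i
        simp [block]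
        rfl
    rw [e, h.diag, ih, Fin.sum_univ_castSucc]
    rfl

theorem grk_diagonal (h : IsSylvesterRank rk) {ι : Type*} [Fintype ι] [DecidableEq ι] (d : ι → R) :
    grk rk (Matrix.diagonal d) = ∑ i, elt rk (d i) := by
  unfold grk
  rw [Matrix.submatrix_diagonal_equiv, rank_diagonal h]
  exact Equiv.sum_comp (Fintype.equivFin ι).symm fun i => elt rk (d i)

/-- Additivity on orthogonal idempotents. -/
theorem elt_add_of_orthogonal (h : IsSylvesterRank rk) {e f : R} (he : e * e = e) (hf : f * f = f)
    (hef : e * f = 0) (hfe : f * e = 0) : elt rk (e + f) = elt rk e + elt rk f := by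
  refine le_antisymm (elt_add_le h e f) ?_
  let u : Matrix (Fin 2) (Fin 1) R := Matrix.of fun i _ => ![e, f] i
  let v : Matrix (Fin 1) (Fin 2) R := Matrix.of fun _ i => ![e, f] i
  -- Orthogonality kills the off-diagonal entries of `u (e + f) v`, so `diag(e, f)` factors through
  -- `e + f`. This is the inequality opposite to subadditivity.
  have e1 : Matrix.diagonal ![e, f] = u * (Matrix.of fun _ _ => e + f : Matrix (Fin 1) (Fin 1) R) * v := by
    ext i j
    fin_cases i <;> fin_cases j <;> simp [u, v, Matrix.mul_apply, mul_add, *]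
  have := rank_diagonal h ![e, f]
  rw [e1] at this
  simp only [Fin.sum_univ_two, Matrix.cons_val_zero, Matrix.cons_val_one] at this
  rw [← this]
  exact (h.mul_le_left _ _ _ _ _).trans (h.mul_le_right _ _ _ _ _)

theorem elt_one_sub (h : IsSylvesterRank rk) {e : R} (he : e * e = e) :
    elt rk (1 - e) = 1 - elt rk e := by
  have := elt_add_of_orthogonal h (e := 1 - e) (f := e)
    (by simp only [sub_mul, mul_sub, he]; simp) he (by simp [sub_mul, he]) (by simp [mul_sub, he])
  rw [sub_add_cancel, elt_one h] at this
  linarith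

theorem elt_sum_of_orthogonal (h : IsSylvesterRank rk) {α : Type*} (s : Finset α) (e : α → R)
    (he : ∀ i ∈ s, e i * e i = e i) (hef : ∀ i ∈ s, ∀ j ∈ s, i ≠ j → e i * e j = 0) :
    elt rk (∑ i ∈ s, e i) = ∑ i ∈ s, elt rk (e i) := by
  classical
  induction s using Finset.induction_on with
  | empty => simp [elt_zero h]
  | insert a s ha ih =>
    have hne : ∀ i ∈ s, a ≠ i := fun i hi h => ha (h ▸ hi)
    have hi' : ∀ i ∈ s, e i * e i = e i := fun i hi => he i (Finset.mem_insert_of_mem hi)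
    have hij' : ∀ i ∈ s, ∀ j ∈ s, i ≠ j → e i * e j = 0 := fun i hi j hj =>
      hef i (Finset.mem_insert_of_mem hi) j (Finset.mem_insert_of_mem hj)
    rw [Finset.sum_insert ha, Finset.sum_insert ha, ← ih hi' hij']
    refine elt_add_of_orthogonal h (he a (Finset.mem_insert_self _ _)) ?_ ?_ ?_
    · rw [Finset.sum_mul_sum]
      refine Finset.sum_congr rfl fun i hi => ?_
      rw [Finset.sum_eq_single_of_mem i hi fun j hj hji => hij' i hi j hj hji.symm, hi' i hi]
    · rw [Finset.mul_sum]
      exact Finset.sum_eq_zero fun i hi =>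
        hef a (Finset.mem_insert_self _ _) i (Finset.mem_insert_of_mem hi) (hne i hi)
    · rw [Finset.sum_mul]
      exact Finset.sum_eq_zero fun i hi =>
        hef i (Finset.mem_insert_of_mem hi) a (Finset.mem_insert_self _ _) (hne i hi).symm

theorem block_map {A B : Type*} [Ring A] [Ring B] (f : A →+* B) {m₁ m₂ n₁ n₂ : ℕ}
    (M₁ : Matrix (Fin m₁) (Fin n₁) A) (M₂ : Matrix (Fin m₁) (Fin n₂) A)
    (M₃ : Matrix (Fin m₂) (Fin n₁) A) (M₄ : Matrix (Fin m₂) (Fin n₂) A) :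
    (block M₁ M₂ M₃ M₄).map f = block (M₁.map f) (M₂.map f) (M₃.map f) (M₄.map f) := by
  unfold block
  rw [← Matrix.fromBlocks_map]
  rfl

theorem block_map_zero {A B : Type*} [Ring A] [Ring B] (f : A →+* B) {m₁ m₂ n₁ n₂ : ℕ}
    (M₁ : Matrix (Fin m₁) (Fin n₁) A) (M₂ : Matrix (Fin m₁) (Fin n₂) A)
    (M₄ : Matrix (Fin m₂) (Fin n₂) A) :
    (block M₁ M₂ 0 M₄).map f = block (M₁.map f) (M₂.map f) 0 (M₄.map f) := by
  rw [block_map, Matrix.map_zero _ (map_zero f)]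

theorem block_map_diag {A B : Type*} [Ring A] [Ring B] (f : A →+* B) {m₁ m₂ n₁ n₂ : ℕ}
    (M₁ : Matrix (Fin m₁) (Fin n₁) A) (M₄ : Matrix (Fin m₂) (Fin n₂) A) :
    (block M₁ 0 0 M₄).map f = block (M₁.map f) 0 0 (M₄.map f) := by
  rw [block_map_zero, Matrix.map_zero _ (map_zero f)]

theorem IsSylvesterRank.pullback {A B : Type*} [Ring A] [Ring B] (f : A →+* B) {rk : MatFun B}
    (h : IsSylvesterRank rk) : IsSylvesterRank (pullback f rk) where
  nonneg _ _ _ := h.nonneg _ _ _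
  zero m n := by
    simp only [RankCP.pullback, Matrix.map_zero _ (map_zero f)]
    exact h.zero _ _
  one := by
    simp only [RankCP.pullback, Matrix.map_one _ (map_zero f) (map_one f)]
    exact h.one
  mul_le_left l m n M₁ M₂ := by
    simp only [RankCP.pullback, Matrix.map_mul]
    exact h.mul_le_left _ _ _ _ _
  mul_le_right l m n M₁ M₂ := by
    simp only [RankCP.pullback, Matrix.map_mul]
    exact h.mul_le_right _ _ _ _ _
  diag m₁ n₁ m₂ n₂ M₁ M₂ := by
    simp only [RankCP.pullback, block_map_diag]
    exact h.diag _ _ _ _ _ _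
  triangular m₁ n₁ m₂ n₂ M₁ M₂ M₃ := by
    simp only [RankCP.pullback, block_map_zero]
    exact h.triangular _ _ _ _ _ _ _

theorem elt_pullback {A B : Type*} [Ring A] [Ring B] (f : A →+* B) (rk : MatFun B) (x : A) :
    elt (pullback f rk) x = elt rk (f x) := rfl

end General

/-! ### The extension of a rank function to the completion -/

section CompletionRank

variable {R : Type*} [Ring R] {rk : MatFun R}

/-- The class of a Cauchy sequence in the completion. -/
def ofCauchy (h : IsSylvesterRank rk) : cauchySeqs h →+* RankCompletion h :=
  Ideal.Quotient.mk (nullSeqs h)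

theorem ofCauchy_eq_iff (h : IsSylvesterRank rk) (s t : cauchySeqs h) :
    ofCauchy h s = ofCauchy h t ↔ Tendsto (fun k => elt rk (s.1 k - t.1 k)) atTop (𝓝 0) :=
  Ideal.Quotient.mk_eq_mk_iff_sub_mem s t

/-- The `k`-th term of a Cauchy sequence. -/
def cauchyTerm (h : IsSylvesterRank rk) (k : ℕ) : cauchySeqs h →+* R :=
  (Pi.evalRingHom (fun _ => R) k).comp (cauchySeqs h).subtype

/-- The representing sequence, as an element of the ring of Cauchy sequences. -/
def repCauchy (h : IsSylvesterRank rk) (x : RankCompletion h) : cauchySeqs h :=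
  Quotient.out (s := Submodule.quotientRel (nullSeqs h)) x

theorem ofCauchy_repCauchy (h : IsSylvesterRank rk) (x : RankCompletion h) :
    ofCauchy h (repCauchy h x) = x :=
  Quotient.out_eq (s := Submodule.quotientRel (nullSeqs h)) x

theorem cauchySeq_rank (h : IsSylvesterRank rk) {m n : ℕ}
    (S : Matrix (Fin m) (Fin n) (cauchySeqs h)) :
    CauchySeq fun k => rk m n (S.map (cauchyTerm h k)) := by
  rw [Metric.cauchySeq_iff]
  intro ε hε
  -- The budget is shared among `m * n` entries; the `+ 1` keeps the quotient meaningful when the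
  -- matrix is empty.
  have hpos : (0 : ℝ) < ε / (m * n + 1) := by positivity
  choose K hK using fun (p : Fin m × Fin n) => (S p.1 p.2).2 _ hpos
  refine ⟨Finset.univ.sup K, fun p hp q hq => ?_⟩
  rw [Real.dist_eq]
  refine (abs_rank_sub_le h _ _).trans_lt ?_
  have hle : ∀ i j, elt rk (S.map (cauchyTerm h p) i j - S.map (cauchyTerm h q) i j) ≤
      ε / (m * n + 1) := fun i j =>
    (hK (i, j) p (le_trans (Finset.le_sup (f := K) (Finset.mem_univ (i, j))) hp) q
      (le_trans (Finset.le_sup (f := K) (Finset.mem_univ (i, j))) hq)).le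
  calc _ ≤ ∑ i : Fin m, ∑ j : Fin n, ε / (m * n + 1) :=
        Finset.sum_le_sum fun i _ => Finset.sum_le_sum fun j _ => hle i j
    _ = m * n * (ε / (m * n + 1)) := by simp [mul_assoc]
    _ < ε := by
      rw [mul_div_assoc', div_lt_iff₀ (by positivity)]
      nlinarith

/-- `completionRank` uses chosen representatives; by the Lipschitz bound any others give the same
limit. Sums, products and blocks can then be formed termwise, and each rank axiom passes to the
limit. -/
theorem tendsto_completionRank (h : IsSylvesterRank rk) {m n : ℕ}
    (S : Matrix (Fin m) (Fin n) (cauchySeqs h)) :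
    Tendsto (fun k => rk m n (S.map (cauchyTerm h k))) atTop
      (𝓝 (completionRank h m n (S.map (ofCauchy h)))) := by
  let S' : Matrix (Fin m) (Fin n) (cauchySeqs h) := (S.map (ofCauchy h)).map (repCauchy h)
  have h1 : Tendsto (fun k => rk m n (S'.map (cauchyTerm h k))) atTop
      (𝓝 (completionRank h m n (S.map (ofCauchy h)))) :=
    (cauchySeq_rank h S').tendsto_limUnder
  have h2 : Tendsto (fun k => rk m n (S.map (cauchyTerm h k)) - rk m n (S'.map (cauchyTerm h k)))
      atTop (𝓝 0) := by
    refine squeeze_zero_norm (fun k => abs_rank_sub_le h _ _) ?_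
    have : ∀ i j, Tendsto (fun k => elt rk (S.map (cauchyTerm h k) i j -
        S'.map (cauchyTerm h k) i j)) atTop (𝓝 0) := fun i j =>
      (ofCauchy_eq_iff h (S i j) (S' i j)).1 (ofCauchy_repCauchy h _).symm
    simpa using tendsto_finsetSum Finset.univ fun i _ =>
      tendsto_finsetSum Finset.univ fun j _ => this i j
  simpa using h2.add h1

theorem exists_map_ofCauchy (h : IsSylvesterRank rk) {m n : ℕ}
    (M : Matrix (Fin m) (Fin n) (RankCompletion h)) : 
    ∃ S : Matrix (Fin m) (Fin n) (cauchySeqs h), S.map (ofCauchy h) = M :=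
  ⟨M.map (repCauchy h), by ext i j; exact ofCauchy_repCauchy h _⟩

theorem completionRank_toCompletion (h : IsSylvesterRank rk) {m n : ℕ}
    (M : Matrix (Fin m) (Fin n) R) :
    completionRank h m n (M.map (toCompletion h)) = rk m n M := by
  let c : R →+* cauchySeqs h := (Pi.constRingHom ℕ R).codRestrict (cauchySeqs h)
      fun x ε hε => ⟨0, fun p _ q _ => by simpa [elt_zero h] using hε⟩
  exact tendsto_nhds_unique (tendsto_completionRank h (M.map c)) tendsto_const_nhds

theorem elt_completionRank_toCompletion (h : IsSylvesterRank rk) (x : R) :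
    elt (completionRank h) (toCompletion h x) = elt rk x :=
  completionRank_toCompletion h (Matrix.of fun _ _ => x)

theorem isSylvesterRank_completionRank (h : IsSylvesterRank rk) :
    IsSylvesterRank (completionRank h) where
  nonneg m n M := by
    obtain ⟨S, rfl⟩ := exists_map_ofCauchy h M
    exact ge_of_tendsto' (tendsto_completionRank h S) fun _ => h.nonneg _ _ _
  zero m n := by
    have := completionRank_toCompletion h (0 : Matrix (Fin m) (Fin n) R)
    rwa [Matrix.map_zero _ (map_zero _), h.zero] at this
  one := by
    have := completionRank_toCompletion h (1 : Matrix (Fin 1) (Fin 1) R)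
    rwa [Matrix.map_one _ (map_zero _) (map_one _), h.one] at this
  mul_le_left l m n M N := by
    obtain ⟨S, rfl⟩ := exists_map_ofCauchy h M
    obtain ⟨S', rfl⟩ := exists_map_ofCauchy h N
    rw [← Matrix.map_mul]
    refine le_of_tendsto_of_tendsto' (tendsto_completionRank h _) (tendsto_completionRank h _)
      fun k => ?_
    rw [Matrix.map_mul]
    exact h.mul_le_left _ _ _ _ _
  mul_le_right l m n M N := by
    obtain ⟨S, rfl⟩ := exists_map_ofCauchy h M
    obtain ⟨S', rfl⟩ := exists_map_ofCauchy h N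
    rw [← Matrix.map_mul]
    refine le_of_tendsto_of_tendsto' (tendsto_completionRank h _) (tendsto_completionRank h _)
      fun k => ?_
    rw [Matrix.map_mul]
    exact h.mul_le_right _ _ _ _ _
  diag m₁ n₁ m₂ n₂ M N := by
    obtain ⟨S, rfl⟩ := exists_map_ofCauchy h M
    obtain ⟨S', rfl⟩ := exists_map_ofCauchy h N
    rw [← block_map_diag]
    refine tendsto_nhds_unique (tendsto_completionRank h _) ?_
    simp only [block_map_diag, h.diag]
    exact (tendsto_completionRank h S).add (tendsto_completionRank h S')
  triangular m₁ n₁ m₂ n₂ M N L := by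
    obtain ⟨S, rfl⟩ := exists_map_ofCauchy h M
    obtain ⟨S', rfl⟩ := exists_map_ofCauchy h N
    obtain ⟨S'', rfl⟩ := exists_map_ofCauchy h L
    rw [← block_map_zero]
    refine le_of_tendsto_of_tendsto' ((tendsto_completionRank h S).add
      (tendsto_completionRank h S')) (tendsto_completionRank h _) fun k => ?_
    rw [block_map_zero]
    exact h.triangular _ _ _ _ _ _ _

end CompletionRank

/-! ### Ranks of matrices over a field -/

section FieldRank

variable {K : Type*} [Field K]

/-- Factor the linear map through its range: the inclusion has a left inverse and the corestriction
a right inverse. Such factorizations can be assembled blockwise, which is how the ranks of block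
matrices are computed below. -/
theorem exists_rank_factorization {ι κ : Type*} [Fintype ι] [Fintype κ] [DecidableEq ι]
    [DecidableEq κ] (M : Matrix ι κ K) :
    ∃ (r : ℕ) (A : Matrix ι (Fin r) K) (B : Matrix (Fin r) κ K) (A' : Matrix (Fin r) ι K)
      (B' : Matrix κ (Fin r) K), M.rank = r ∧ A * B = M ∧ A' * A = 1 ∧ B * B' = 1 := by
  let f := Matrix.toLin' M
  have hr : Module.finrank K (LinearMap.range f) = M.rank := rfl
  let φ : LinearMap.range f ≃ₗ[K] (Fin M.rank → K) :=
    LinearEquiv.ofFinrankEq _ _ (by rw [hr]; simp)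
  let a : (Fin M.rank → K) →ₗ[K] (ι → K) := (LinearMap.range f).subtype ∘ₗ φ.symm.toLinearMap
  let b : (κ → K) →ₗ[K] (Fin M.rank → K) := φ.toLinearMap ∘ₗ f.rangeRestrict
  have hab : a ∘ₗ b = f := by
    ext x
    simp [a, b]
  obtain ⟨a', ha'⟩ := a.exists_leftInverse_of_injective (LinearMap.ker_eq_bot.2
    ((Submodule.subtype_injective _).comp φ.symm.injective))
  obtain ⟨b', hb'⟩ := b.exists_rightInverse_of_surjective (LinearMap.range_eq_top.2
    (φ.surjective.comp f.surjective_rangeRestrict))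
  refine ⟨M.rank, LinearMap.toMatrix' a, LinearMap.toMatrix' b, LinearMap.toMatrix' a',
    LinearMap.toMatrix' b', rfl, ?_, ?_, ?_⟩
  · rw [← LinearMap.toMatrix'_comp, hab, LinearMap.toMatrix'_toLin']
  · rw [← LinearMap.toMatrix'_comp, ha', LinearMap.toMatrix'_id]
  · rw [← LinearMap.toMatrix'_comp, hb', LinearMap.toMatrix'_id]

theorem card_le_rank {ι κ l : Type*} [Fintype ι] [Fintype κ] [Fintype l] [DecidableEq l]
    {M : Matrix ι κ K} {A' : Matrix l ι K} {B' : Matrix κ l K} (h : IsUnit (A' * M * B')) :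
    Fintype.card l ≤ M.rank := by
  rw [← Matrix.rank_of_isUnit _ h]
  exact (Matrix.rank_mul_le_left _ _).trans (Matrix.rank_mul_le_right _ _)

theorem rank_eq_card {ι κ l : Type*} [Fintype ι] [Fintype κ] [Fintype l] [DecidableEq l]
    {M : Matrix ι κ K} {A : Matrix ι l K} {B : Matrix l κ K} {A' : Matrix l ι K}
    {B' : Matrix κ l K} (hM : A * B = M) (hA : A' * A = 1) (hB : B * B' = 1) :
    M.rank = Fintype.card l := by
  refine le_antisymm ?_ (card_le_rank (A' := A') (B' := B') ?_)
  · rw [← hM]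
    exact (Matrix.rank_mul_le_left _ _).trans (Matrix.rank_le_card_width _)
  · rw [← hM, ← Matrix.mul_assoc, hA, Matrix.one_mul, hB]
    exact isUnit_one

theorem rank_blockDiagonal' {o : Type*} [Fintype o] [DecidableEq o] {m' n' : o → Type*}
    [∀ i, Fintype (m' i)] [∀ i, Fintype (n' i)]
    (M : (i : o) → Matrix (m' i) (n' i) K) :
    (Matrix.blockDiagonal' M).rank = ∑ i, (M i).rank := by
  classical
  choose r A B A' B' hr h1 h2 h3 using fun i => exists_rank_factorization (M i)
  have e : Matrix.blockDiagonal' (fun i => (1 : Matrix (Fin (r i)) (Fin (r i)) K)) = 1 :=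
    Matrix.blockDiagonal'_one
  rw [rank_eq_card (A := Matrix.blockDiagonal' A) (B := Matrix.blockDiagonal' B)
    (A' := Matrix.blockDiagonal' A') (B' := Matrix.blockDiagonal' B')]
  · simp [hr]
  · rw [← Matrix.blockDiagonal'_mul]; simp_rw [h1]
  · rw [← Matrix.blockDiagonal'_mul]; simp_rw [h2]; exact e
  · rw [← Matrix.blockDiagonal'_mul]; simp_rw [h3]; exact e

theorem rank_fromBlocks_diag {ι κ ι' κ' : Type*} [Fintype ι] [Fintype κ] [Fintype ι'] [Fintype κ']
    (M : Matrix ι κ K) (N : Matrix ι' κ' K) :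
    (Matrix.fromBlocks M 0 0 N).rank = M.rank + N.rank := by
  classical
  obtain ⟨r, A, B, A', B', hr, h1, h2, h3⟩ := exists_rank_factorization M
  obtain ⟨s, C, D, C', D', hs, g1, g2, g3⟩ := exists_rank_factorization N
  rw [rank_eq_card (A := Matrix.fromBlocks A 0 0 C) (B := Matrix.fromBlocks B 0 0 D)
    (A' := Matrix.fromBlocks A' 0 0 C') (B' := Matrix.fromBlocks B' 0 0 D')]
  · simp [hr, hs]
  · simp [Matrix.fromBlocks_multiply, *]
  · simp [Matrix.fromBlocks_multiply, *]
  · simp [Matrix.fromBlocks_multiply, *]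

/-- The one-sided inverses of the diagonal blocks compress the matrix to a block upper triangular
one with identity diagonal blocks, which is invertible of size `M.rank + N.rank`. -/
theorem rank_fromBlocks_triangular {ι κ ι' κ' : Type*} [Fintype ι] [Fintype κ] [Fintype ι']
    [Fintype κ'] (M : Matrix ι κ K) (L : Matrix ι κ' K) (N : Matrix ι' κ' K) :
    M.rank + N.rank ≤ (Matrix.fromBlocks M L 0 N).rank := by
  classical
  obtain ⟨r, A, B, A', B', hr, h1, h2, h3⟩ := exists_rank_factorization M
  obtain ⟨s, C, D, C', D', hs, g1, g2, g3⟩ := exists_rank_factorization N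
  have e1 : A' * M * B' = 1 := by
    rw [← h1, ← Matrix.mul_assoc, h2, Matrix.one_mul, h3]
  have e2 : C' * N * D' = 1 := by
    rw [← g1, ← Matrix.mul_assoc, g2, Matrix.one_mul, g3]
  have := card_le_rank (M := Matrix.fromBlocks M L 0 N) (A' := Matrix.fromBlocks A' 0 0 C')
    (B' := Matrix.fromBlocks B' 0 0 D') (by
      rw [Matrix.isUnit_iff_isUnit_det]
      simp [Matrix.fromBlocks_multiply, e1, e2])
  simpa [hr, hs] using this

end FieldRank

/-! ### Weighted ranks on products of matrix algebras -/

section Weighted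

variable {K : Type*} [Field K] {F : Type*} {d : F → ℕ}

/-- A matrix over `∏ W, M_{d W}(K)` has a component at `W`, seen as a matrix over `K`. -/
def flat {ι κ : Type*} (W : F)
    (M : Matrix ι κ ((W : F) → Matrix (Fin (d W)) (Fin (d W)) K)) :
    Matrix (ι × Fin (d W)) (κ × Fin (d W)) K :=
  Matrix.of fun a b => M a.1 b.1 W a.2 b.2

theorem flat_mul {ι κ l : Type*} [Fintype κ] (W : F)
    (M : Matrix ι κ ((W : F) → Matrix (Fin (d W)) (Fin (d W)) K))
    (N : Matrix κ l ((W : F) → Matrix (Fin (d W)) (Fin (d W)) K)) :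
    flat W (M * N) = flat W M * flat W N := by
  ext a b
  simp [flat, Matrix.mul_apply, Fintype.sum_prod_type, Matrix.sum_apply]

theorem flat_block (W : F) {m₁ m₂ n₁ n₂ : ℕ}
    (M₁ : Matrix (Fin m₁) (Fin n₁) ((W : F) → Matrix (Fin (d W)) (Fin (d W)) K))
    (M₂ : Matrix (Fin m₁) (Fin n₂) ((W : F) → Matrix (Fin (d W)) (Fin (d W)) K))
    (M₃ : Matrix (Fin m₂) (Fin n₁) ((W : F) → Matrix (Fin (d W)) (Fin (d W)) K))
    (M₄ : Matrix (Fin m₂) (Fin n₂) ((W : F) → Matrix (Fin (d W)) (Fin (d W)) K)) :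
    (flat W (block M₁ M₂ M₃ M₄)).rank =
      (Matrix.fromBlocks (flat W M₁) (flat W M₂) (flat W M₃) (flat W M₄)).rank := by
  rw [← Matrix.rank_submatrix _
    ((finSumFinEquiv.symm.prodCongr (Equiv.refl (Fin (d W)))).trans (Equiv.sumProdDistrib _ _ _))
    ((finSumFinEquiv.symm.prodCongr (Equiv.refl (Fin (d W)))).trans (Equiv.sumProdDistrib _ _ _))]
  congr 1
  ext ⟨a, i⟩ ⟨b, j⟩
  obtain ⟨a, rfl⟩ := finSumFinEquiv.surjective a
  obtain ⟨b, rfl⟩ := finSumFinEquiv.surjective b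
  rcases a with a | a <;> rcases b with b | b <;> simp [block, flat]

/-- The weighted sum of the ranks of the components of a matrix. -/
def weightedRank (K : Type*) [Field K] {F : Type*} (d : F → ℕ) (w : F → ℝ) :
    MatFun ((W : F) → Matrix (Fin (d W)) (Fin (d W)) K) :=
  fun _ _ M => ∑' W, w W * (flat W M).rank

theorem flat_zero {ι κ : Type*} (W : F) :
    flat W (0 : Matrix ι κ ((W : F) → Matrix (Fin (d W)) (Fin (d W)) K)) = 0 := rfl

/-- The component at `W` has `m * d W` rows, which bounds its rank. Since `F` may be infinite,
summability is what allows the axioms to be checked factor by factor. -/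
theorem summable_weightedRank {w : F → ℝ} (hw : ∀ W, 0 ≤ w W) (hs : Summable fun W => w W * d W)
    {m n : ℕ} (M : Matrix (Fin m) (Fin n) ((W : F) → Matrix (Fin (d W)) (Fin (d W)) K)) :
    Summable fun W => w W * (flat W M).rank := by
  refine Summable.of_nonneg_of_le (fun W => mul_nonneg (hw W) (Nat.cast_nonneg _)) (fun W => ?_)
    (hs.mul_left (m : ℝ))
  have h : ((flat W M).rank : ℝ) ≤ m * d W := by
    exact_mod_cast (flat W M).rank_le_card_height.trans (by simp)
  calc w W * (flat W M).rank ≤ w W * (m * d W) := mul_le_mul_of_nonneg_left h (hw W)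
    _ = m * (w W * d W) := by ring

theorem isSylvesterRank_weightedRank {w : F → ℝ} (hw : ∀ W, 0 ≤ w W)
    (hs : HasSum (fun W => w W * d W) 1) : IsSylvesterRank (weightedRank K d w) where
  nonneg m n M := tsum_nonneg fun W => mul_nonneg (hw W) (Nat.cast_nonneg _)
  zero m n := by simp [weightedRank, flat_zero]
  one := by
    rw [← hs.tsum_eq]
    refine tsum_congr fun W => ?_
    have : flat W (1 : Matrix (Fin 1) (Fin 1) ((W : F) → Matrix (Fin (d W)) (Fin (d W)) K)) =
        1 := by
      ext ⟨a, i⟩ ⟨b, j⟩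
      obtain rfl := Subsingleton.elim a b
      simp [flat, Matrix.one_apply]
    rw [this, Matrix.rank_one]
    simp
  mul_le_left l m n M N := by
    refine Summable.tsum_le_tsum (fun W => mul_le_mul_of_nonneg_left ?_ (hw W))
      (summable_weightedRank hw hs.summable (M * N)) (summable_weightedRank hw hs.summable M)
    rw [flat_mul]
    exact Nat.cast_le.2 (Matrix.rank_mul_le_left _ _)
  mul_le_right l m n M N := by
    refine Summable.tsum_le_tsum (fun W => mul_le_mul_of_nonneg_left ?_ (hw W))
      (summable_weightedRank hw hs.summable (M * N)) (summable_weightedRank hw hs.summable N)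
    rw [flat_mul]
    exact Nat.cast_le.2 (Matrix.rank_mul_le_right _ _)
  diag m₁ n₁ m₂ n₂ M N := by
    refine Eq.trans (tsum_congr fun W => ?_) ((summable_weightedRank hw hs.summable M).tsum_add
      (summable_weightedRank hw hs.summable N))
    rw [flat_block, flat_zero, flat_zero, rank_fromBlocks_diag]
    push_cast
    ring
  triangular m₁ n₁ m₂ n₂ M N L := by
    refine le_of_eq_of_le ((summable_weightedRank hw hs.summable M).tsum_add
      (summable_weightedRank hw hs.summable N)).symm (Summable.tsum_le_tsum (fun W => ?_)
        ((summable_weightedRank hw hs.summable M).add (summable_weightedRank hw hs.summable N))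
        (summable_weightedRank hw hs.summable (block M L 0 N)))
    rw [flat_block, flat_zero, ← mul_add, ← Nat.cast_add]
    exact mul_le_mul_of_nonneg_left (Nat.cast_le.2 (rank_fromBlocks_triangular _ _ _)) (hw W)

theorem elt_weightedRank (w : F → ℝ) (x : (W : F) → Matrix (Fin (d W)) (Fin (d W)) K) :
    elt (weightedRank K d w) x = ∑' W, w W * (x W).rank := by
  refine tsum_congr fun W => ?_
  congr 2
  rw [← Matrix.rank_submatrix (x W) (Equiv.uniqueProd (Fin (d W)) (Fin 1))
    (Equiv.uniqueProd (Fin (d W)) (Fin 1))]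
  rfl

end Weighted

/-! ### Rank functions on images of products of matrix algebras -/

section Agreement

variable {K : Type*} [Field K] {F : Type*} [Fintype F] [DecidableEq F] {d : F → ℕ}

/-- The matrix unit `e_{zz}` in the factor `W`. -/
def unitAt (K : Type*) [Field K] (z : ∀ W, Fin (d W)) (W : F) :
    (W : F) → Matrix (Fin (d W)) (Fin (d W)) K :=
  Pi.single W (Matrix.single (z W) (z W) 1)

theorem pi_single_sum {F : Type*} [DecidableEq F] {α : F → Type*} [∀ W, AddCommMonoid (α W)] {β : Type*} (s : Finset β) (W : F)
    (f : β → α W) : Pi.single W (∑ i ∈ s, f i) = ∑ i ∈ s, (Pi.single W (f i) : ∀ W, α W) :=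
  map_sum (AddMonoidHom.single α W) f s

/-- Over each factor `W` take a rank factorization of the flattened matrix. Its `s`-th column is
stored in column `z W` of matrices supported in the factor `W`, and its rows are stored dually. The
middle term then becomes `r W` copies of the minimal idempotent `e_{zz}(W)`, and the one-sided
inverses recover `D` from `M`. -/
theorem exists_factorization (z : ∀ W, Fin (d W)) {p q : ℕ}
    (M : Matrix (Fin p) (Fin q) ((W : F) → Matrix (Fin (d W)) (Fin (d W)) K)) :
    ∃ (r : F → ℕ)
      (X : Matrix (Fin p) (Σ W, Fin (r W)) ((W : F) → Matrix (Fin (d W)) (Fin (d W)) K))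
      (Y : Matrix (Σ W, Fin (r W)) (Fin q) ((W : F) → Matrix (Fin (d W)) (Fin (d W)) K))
      (X' : Matrix (Σ W, Fin (r W)) (Fin p) ((W : F) → Matrix (Fin (d W)) (Fin (d W)) K))
      (Y' : Matrix (Fin q) (Σ W, Fin (r W)) ((W : F) → Matrix (Fin (d W)) (Fin (d W)) K))
      (D : Matrix (Σ W, Fin (r W)) (Σ W, Fin (r W)) ((W : F) → Matrix (Fin (d W)) (Fin (d W)) K)),
      (∀ W, (flat W M).rank = r W) ∧ D = Matrix.diagonal (fun s => unitAt K z s.1) ∧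
      X * D * Y = M ∧ X' * M * Y' = D := by
  classical
  choose r A B A' B' hr h1 h2 h3 using fun W => exists_rank_factorization (flat W M)
  let D : Matrix (Σ W, Fin (r W)) (Σ W, Fin (r W))
    ((W : F) → Matrix (Fin (d W)) (Fin (d W)) K) := Matrix.diagonal fun s => unitAt K z s.1
  let X : Matrix (Fin p) (Σ W, Fin (r W)) ((W : F) → Matrix (Fin (d W)) (Fin (d W)) K) :=
    Matrix.of fun a s => Pi.single s.1
      (Matrix.of fun i j => if j = z s.1 then A s.1 (a, i) s.2 else 0)
  let Y : Matrix (Σ W, Fin (r W)) (Fin q) ((W : F) → Matrix (Fin (d W)) (Fin (d W)) K) :=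
    Matrix.of fun s b => Pi.single s.1
      (Matrix.of fun i j => if i = z s.1 then B s.1 s.2 (b, j) else 0)
  let X' : Matrix (Σ W, Fin (r W)) (Fin p) ((W : F) → Matrix (Fin (d W)) (Fin (d W)) K) :=
    Matrix.of fun s a => Pi.single s.1
      (Matrix.of fun i j => if i = z s.1 then A' s.1 s.2 (a, j) else 0)
  let Y' : Matrix (Fin q) (Σ W, Fin (r W)) ((W : F) → Matrix (Fin (d W)) (Fin (d W)) K) :=
    Matrix.of fun b s => Pi.single s.1
      (Matrix.of fun i j => if j = z s.1 then B' s.1 (b, i) s.2 else 0)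
  have hXD : X * D = X := by
    ext1 a s
    rw [Matrix.mul_diagonal]
    simp only [X, unitAt, Matrix.of_apply, ← Pi.single_mul]
    congr 1
    ext i j
    simp [Matrix.mul_apply, Matrix.single_apply, ite_and, eq_comm]
  have hXY : X * Y = M := by
    ext1 a b
    rw [Matrix.mul_apply, Fintype.sum_sigma]
    conv_rhs => rw [← Finset.univ_sum_single (M a b)]
    refine Finset.sum_congr rfl fun W _ => ?_
    simp only [X, Y, Matrix.of_apply, ← Pi.single_mul]
    rw [← pi_single_sum]
    congr 1
    ext i j
    have := congrFun (congrFun (h1 W) (a, i)) (b, j)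
    simp only [flat, Matrix.of_apply] at this
    rw [← this]
    simp [Matrix.sum_apply, Matrix.mul_apply]
  have hX : X' * X = D := by
    ext1 ⟨W, s⟩ ⟨W', s'⟩
    by_cases hW : W = W'
    · subst hW
      have h := congrFun (congrFun (h2 W) s) s'
      rw [Matrix.mul_apply]
      simp only [X, X', Matrix.of_apply, ← Pi.single_mul]
      rw [← pi_single_sum]
      have : D ⟨W, s⟩ ⟨W, s'⟩ = Pi.single W (Matrix.single (z W) (z W)
          ((1 : Matrix _ _ K) s s')) := by
        simp only [D, Matrix.diagonal_apply, Matrix.one_apply, unitAt]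
        split_ifs <;> simp_all
      rw [this, ← h]
      congr 1
      ext i j
      simp only [Matrix.sum_apply, Matrix.mul_apply, Matrix.of_apply, Matrix.single_apply,
        Fintype.sum_prod_type]
      by_cases hi : i = z W <;> by_cases hj : j = z W <;> simp [hi, hj, eq_comm (a := z W)]
    · rw [Matrix.mul_apply]
      have : D ⟨W, s⟩ ⟨W', s'⟩ = 0 := Matrix.diagonal_apply_ne _ (by simp [hW])
      rw [this]
      refine Finset.sum_eq_zero fun a _ => ?_
      ext1 V
      simp only [X, X', Matrix.of_apply, Pi.mul_apply, Pi.zero_apply]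
      by_cases hV : V = W
      · rw [Pi.single_eq_of_ne (i := W') (by rintro rfl; exact hW hV.symm), mul_zero]
      · rw [Pi.single_eq_of_ne hV, zero_mul]
  have hY : Y * Y' = D := by
    ext1 ⟨W, s⟩ ⟨W', s'⟩
    by_cases hW : W = W'
    · subst hW
      have h := congrFun (congrFun (h3 W) s) s'
      rw [Matrix.mul_apply]
      simp only [Y, Y', Matrix.of_apply, ← Pi.single_mul]
      rw [← pi_single_sum]
      have : D ⟨W, s⟩ ⟨W, s'⟩ = Pi.single W (Matrix.single (z W) (z W)
          ((1 : Matrix _ _ K) s s')) := by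
        simp only [D, Matrix.diagonal_apply, Matrix.one_apply, unitAt]
        split_ifs <;> simp_all
      rw [this, ← h]
      congr 1
      ext i j
      simp only [Matrix.sum_apply, Matrix.mul_apply, Matrix.of_apply, Matrix.single_apply,
        Fintype.sum_prod_type]
      by_cases hi : i = z W <;> by_cases hj : j = z W <;> simp [hi, hj, eq_comm (a := z W)]
    · rw [Matrix.mul_apply]
      have : D ⟨W, s⟩ ⟨W', s'⟩ = 0 := Matrix.diagonal_apply_ne _ (by simp [hW])
      rw [this]
      refine Finset.sum_eq_zero fun a _ => ?_
      ext1 V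
      simp only [Y, Y', Matrix.of_apply, Pi.mul_apply, Pi.zero_apply]
      by_cases hV : V = W
      · rw [Pi.single_eq_of_ne (i := W') (by rintro rfl; exact hW hV.symm), mul_zero]
      · rw [Pi.single_eq_of_ne hV, zero_mul]
  refine ⟨r, X, Y, X', Y', D, hr, rfl, ?_, ?_⟩
  · rw [hXD, hXY]
  · rw [← hXY, ← Matrix.mul_assoc, hX, Matrix.mul_assoc, hY]
    ext1 s s'
    simp only [D, Matrix.diagonal_mul_diagonal, Matrix.diagonal_apply]
    simp [unitAt, ← Pi.single_mul]

/-- `M` and the diagonal matrix `D` of minimal idempotents are multiples of each other on both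
sides, so their images have equal rank. `G` need not be unital, which admits the corners given by
finitely many towers. -/
theorem rank_map_eq_sum {R : Type*} [Ring R] {N : MatFun R} (h : IsSylvesterRank N)
    (z : ∀ W, Fin (d W)) (G : ((W : F) → Matrix (Fin (d W)) (Fin (d W)) K) →ₙ+* R) {p q : ℕ}
    (M : Matrix (Fin p) (Fin q) ((W : F) → Matrix (Fin (d W)) (Fin (d W)) K)) :
    N p q (M.map G) = ∑ W, (flat W M).rank * elt N (G (unitAt K z W)) := by
  classical
  obtain ⟨r, X, Y, X', Y', D, hr, hD, h1, h2⟩ := exists_factorization z M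
  have e : grk N (D.map G) =
      ∑ W, (flat W M).rank * elt N (G (unitAt K z W)) := by
    rw [hD, Matrix.diagonal_map (map_zero G), grk_diagonal h, Fintype.sum_sigma]
    simp [hr]
  rw [← e, ← grk_fin h]
  apply le_antisymm
  · conv_lhs => rw [← h1]
    rw [Matrix.map_mul, Matrix.map_mul]
    exact (grk_mul_le_left h _ _).trans (grk_mul_le_right h _ _)
  · rw [← h2, Matrix.map_mul, Matrix.map_mul]
    exact (grk_mul_le_left h _ _).trans (grk_mul_le_right h _ _)

end Agreement

/-- Two rank functions agree if every finite set of elements can be approximated in the image of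
a product of matrix algebras on whose minimal idempotents they agree. -/
theorem eq_of_approx {K : Type*} [Field K] {R : Type*} [Ring R] {N₁ N₂ : MatFun R}
    (h₁ : IsSylvesterRank N₁) (h₂ : IsSylvesterRank N₂)
    (H : ∀ (s : Finset R) (ε : ℝ), 0 < ε → ∃ (F : Type*) (_ : Fintype F) (_ : DecidableEq F)
      (d : F → ℕ) (z : ∀ W, Fin (d W))
      (G : ((W : F) → Matrix (Fin (d W)) (Fin (d W)) K) →ₙ+* R),
      (∀ W, elt N₁ (G (unitAt K z W)) = elt N₂ (G (unitAt K z W))) ∧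
      ∀ x ∈ s, ∃ y, elt N₁ (x - G y) ≤ ε ∧ elt N₂ (x - G y) ≤ ε) : N₁ = N₂ := by
  classical
  funext p q M
  refine eq_of_abs_sub_le_all fun ε hε => ?_
  -- Summed over the `p * q` entries, the error is at most `ε / 2` for each of the two rank
  -- functions.
  have hpos : (0 : ℝ) < ε / (2 * (p * q + 1)) := by positivity
  obtain ⟨F, _, _, d, z, G, hG, hs⟩ := H (Finset.univ.image fun i : Fin p × Fin q => M i.1 i.2) _
    hpos
  choose y hy₁ hy₂ using fun (i : Fin p) (j : Fin q) =>
    hs (M i j) (Finset.mem_image.2 ⟨(i, j), Finset.mem_univ _, rfl⟩)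
  have e : N₁ p q ((Matrix.of y).map G) = N₂ p q ((Matrix.of y).map G) := by
    rw [rank_map_eq_sum h₁ z, rank_map_eq_sum h₂ z]
    simp_rw [hG]
  have key : ∀ N : MatFun R, IsSylvesterRank N →
      (∀ i j, elt N (M i j - G (y i j)) ≤ ε / (2 * (p * q + 1))) →
      |N p q M - N p q ((Matrix.of y).map G)| ≤ ε / 2 := by
    intro N hN hy
    refine (abs_rank_sub_le hN _ _).trans ?_
    calc _ ≤ ∑ i : Fin p, ∑ j : Fin q, ε / (2 * (p * q + 1)) :=
          Finset.sum_le_sum fun i _ => Finset.sum_le_sum fun j _ => hy i j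
      _ = p * q * (ε / (2 * (p * q + 1))) := by simp [mul_assoc]
      _ ≤ ε / 2 := by
        rw [mul_div_assoc', div_le_div_iff₀ (by positivity) (by positivity)]
        nlinarith
  have k1 := key N₁ h₁ hy₁
  have k2 := key N₂ h₂ hy₂
  rw [abs_le] at *
  constructor <;> linarith

/-! ### The atoms of the partitions -/

section Atoms

variable {X : Type*} [TopologicalSpace X] (S : ApproxSystem X)

namespace ApproxSystem

/-- The atoms of the `n`-th partition of `X`. -/
def atoms (n : ℕ) : Set (Set X) := insert (S.E n) (S.P n)

theorem isClopen_atom {n : ℕ} {Z : Set X} (hZ : Z ∈ S.atoms n) : IsClopen Z := by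
  rcases hZ with rfl | hZ
  · exact S.isClopen_E n
  · exact S.isClopen_P n Z hZ

theorem exists_atom (n : ℕ) (x : X) : ∃ Z ∈ S.atoms n, x ∈ Z := by
  by_cases hx : x ∈ S.E n
  · exact ⟨_, Set.mem_insert _ _, hx⟩
  · have : x ∈ ⋃₀ S.P n := S.sUnion_P n ▸ hx
    obtain ⟨Z, hZ, h⟩ := this
    exact ⟨Z, Set.mem_insert_of_mem _ hZ, h⟩

theorem y_mem (n : ℕ) : S.y ∈ S.E n := by
  have : S.y ∈ ⋂ n, S.E n := by rw [S.iInter_E]; rfl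
  exact Set.mem_iInter.1 this n

theorem exists_atom_superset {n m : ℕ} (h : n ≤ m) {Z' : Set X} (hZ' : Z' ∈ S.atoms m) :
    ∃ Z ∈ S.atoms n, Z' ⊆ Z := by
  induction m, h using Nat.le_induction generalizing Z' with
  | base => exact ⟨Z', hZ', subset_rfl⟩
  | succ m hm ih =>
    obtain ⟨Z, hZ, hs⟩ := S.finer m Z' hZ'
    obtain ⟨Y, hY, hs'⟩ := ih hZ
    exact ⟨Y, hY, hs.trans hs'⟩

theorem atom_subset_of_mem {n m : ℕ} (h : n ≤ m) {Z Z' : Set X} (hZ : Z ∈ S.atoms n)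
    (hZ' : Z' ∈ S.atoms m) {x : X} (hx : x ∈ Z) (hx' : x ∈ Z') : Z' ⊆ Z := by
  obtain ⟨Y, hY, hs⟩ := S.exists_atom_superset h hZ'
  rw [atom_unique hZ hY hx (hs hx')]
  exact hs

/-- The atoms form a basis and not only a subbasis: in an intersection, the two atoms found are
replaced by the atom of the finer of the two partitions. -/
theorem exists_atom_subset {O : Set X} (hO : IsOpen O) {x : X} (hx : x ∈ O) :
    ∃ n, ∃ Z ∈ S.atoms n, x ∈ Z ∧ Z ⊆ O := by
  have hg : GenerateOpen (⋃ n, insert (S.E n) (S.P n)) O :=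
    (congrArg (fun t : TopologicalSpace X => t.IsOpen O) S.generates).mp hO
  clear hO
  induction hg generalizing x with
  | basic Z hZ =>
    obtain ⟨n, hn⟩ := Set.mem_iUnion.1 hZ
    exact ⟨n, Z, hn, hx, subset_rfl⟩
  | univ =>
    obtain ⟨Z, hZ, h⟩ := S.exists_atom 0 x
    exact ⟨0, Z, hZ, h, Set.subset_univ _⟩
  | inter s t _ _ ihs iht =>
    obtain ⟨n, Z, hZ, hxZ, hs⟩ := ihs hx.1
    obtain ⟨m, Y, hY, hxY, ht⟩ := iht hx.2
    obtain ⟨A, hA, hxA⟩ := S.exists_atom (max n m) x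
    exact ⟨_, A, hA, hxA, Set.subset_inter
      ((S.atom_subset_of_mem (le_max_left _ _) hZ hA hxZ hxA).trans hs)
      ((S.atom_subset_of_mem (le_max_right _ _) hY hA hxY hxA).trans ht)⟩
  | sUnion C _ ih =>
    obtain ⟨s, hs, hxs⟩ := hx
    obtain ⟨n, Z, hZ, hxZ, h⟩ := ih s hs hxs
    exact ⟨n, Z, hZ, hxZ, h.trans (Set.subset_sUnion_of_mem hs)⟩

/-- A locally constant function is constant on the atoms of all sufficiently fine partitions. -/
theorem exists_const_on_atoms [CompactSpace X] {α : Type*} (f : LocallyConstant X α) :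
    ∃ n, ∀ m ≥ n, ∀ Z ∈ S.atoms m, ∀ x ∈ Z, ∀ x' ∈ Z, f x = f x' := by
  choose n Z hZ hxZ hs using fun x : X =>
    S.exists_atom_subset (f.isLocallyConstant.isOpen_fiber (f x)) (x := x) rfl
  -- By compactness finitely many atoms inside fibres of `f` cover `X`; from their largest level on,
  -- every atom lies in one of them.
  obtain ⟨t, ht⟩ := isCompact_univ.elim_finite_subcover Z (fun x => (S.isClopen_atom (hZ x)).isOpen)
    fun x _ => Set.mem_iUnion.2 ⟨x, hxZ x⟩
  refine ⟨t.sup n, fun m hm Y hY x hx x' hx' => ?_⟩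
  obtain ⟨z, hz, hxz⟩ := Set.mem_iUnion₂.1 (ht (Set.mem_univ x))
  have h := (S.atom_subset_of_mem ((Finset.le_sup hz).trans hm) (hZ z) hY hxz hx).trans (hs z)
  exact (h hx : f x = f z).trans (h hx' : f x' = f z).symm

end ApproxSystem

end Atoms

/-! ### The towers over the sets `W` -/

section Towers

variable {X : Type*} [TopologicalSpace X] {T : X ≃ₜ X} {S : ApproxSystem X}

theorem pow_apply (l : ℕ) (x : X) : (T ^ l) x = T^[l] x := by
  induction l generalizing x with
  | zero => rfl
  | succ l ih => rw [pow_succ, Function.iterate_succ_apply, ← ih]; rfl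

theorem mem_image_pow {l : ℕ} {A : Set X} {x : X} :
    x ∈ (T ^ l) '' A ↔ ∃ w ∈ A, T^[l] w = x := by
  simp only [Set.mem_image, pow_apply]

theorem iterate_injective (l : ℕ) : Function.Injective T^[l] := T.injective.iterate l

namespace ApproxSystem

theorem V.len_pos {n : ℕ} (W : S.V T n) : 0 < W.len := Nat.succ_pos _

theorem V.set_nonempty {n : ℕ} (W : S.V T n) : W.set.Nonempty := W.2

theorem V.subset_E {n : ℕ} (W : S.V T n) : W.set ⊆ S.E n := fun x hx => ((V.mem_iff W x).1 hx).1

/-- If `l < l'`, then `w = T^{l'-l} w'` would lie in `E_n` strictly between two consecutive visits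
of the orbit of `w'` to `E_n`. -/
theorem V.level_eq_aux {n : ℕ} {W W' : S.V T n} {l l' : ℕ} (hl' : l' < W'.len)
    (h : l ≤ l') {w w' : X} (hw : w ∈ W.set) (hw' : w' ∈ W'.set) (he : T^[l] w = T^[l'] w') :
    W = W' ∧ l = l' := by
  have e : w = T^[l' - l] w' := by
    apply iterate_injective (T := T) l
    rw [← Function.iterate_add_apply, he]
    congr 1
    omega
  have hl : l = l' := by
    by_contra hne
    exact V.notMem_of_lt W' hw' (i := l' - l) (by omega) (by omega) (e ▸ W.subset_E hw)
  subst hl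
  simp only [Nat.sub_self, Function.iterate_zero, id_eq] at e
  exact ⟨V.eq_of_mem hw (e ▸ hw'), rfl⟩

theorem V.level_eq {n : ℕ} {W W' : S.V T n} {l l' : ℕ} (hl : l < W.len) (hl' : l' < W'.len)
    {w w' : X} (hw : w ∈ W.set) (hw' : w' ∈ W'.set) (he : T^[l] w = T^[l'] w') :
    W = W' ∧ l = l' := by
  rcases le_total l l' with h | h
  · exact V.level_eq_aux hl' h hw hw' he
  · exact (V.level_eq_aux hl h hw' hw he.symm).imp Eq.symm Eq.symm

/-- A point whose forward and backward orbits visit `E n` lies in one of the towers. -/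
theorem exists_level {n : ℕ} {x : X} (hf : ∃ k, T^[k + 1] x ∈ S.E n)
    (hb : ∃ l, T.symm^[l] x ∈ S.E n) :
    ∃ (W : S.V T n) (l : ℕ), l < W.len ∧ ∃ w ∈ W.set, T^[l] w = x := by
  classical
  -- The base point `w` is the most recent visit to `E_n`, `l` steps back. The next visit is `k + 1`
  -- steps ahead, and the atoms met in between spell the word of `W`.
  let k := Nat.find hf
  let l := Nat.find hb
  have hk : T^[k + 1] x ∈ S.E n := Nat.find_spec hf
  have hl : T.symm^[l] x ∈ S.E n := Nat.find_spec hb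
  let w := T.symm^[l] x
  have hinv : ∀ i z, T^[i] (T.symm^[i] z) = z := fun i z =>
    Function.LeftInverse.iterate T.apply_symm_apply i z
  have hw1 : ∀ i ≤ l, T^[i] w = T.symm^[l - i] x := by
    intro i hi
    have : w = T.symm^[i] (T.symm^[l - i] x) := by
      rw [← Function.iterate_add_apply, Nat.add_sub_of_le hi]
    rw [this, hinv]
  have hw2 : ∀ i, T^[i + l] w = T^[i] x := by
    intro i
    rw [Function.iterate_add_apply, hw1 l le_rfl, Nat.sub_self]
    rfl
  have hnot : ∀ i < l + k, T^[i + 1] w ∉ S.E n := by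
    intro i hi h
    by_cases hil : i + 1 ≤ l
    · rw [hw1 _ hil] at h
      exact Nat.find_min hb (by omega) h
    · have : i + 1 = (i - l + 1) + l := by omega
      rw [this, hw2] at h
      exact Nat.find_min hf (by omega) h
  choose Z hZ hZw using fun i : Fin (l + k) => S.exists_atom n (T^[i.1 + 1] w)
  have hZP : ∀ i, Z i ∈ S.P n := fun i => by
    rcases hZ i with h | h
    · exact absurd (h ▸ hZw i) (hnot i i.2)
    · exact h
  have hmem : w ∈ S.cyl T n (List.ofFn fun i => (⟨Z i, hZP i⟩ : S.P n)) := by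
    refine ⟨⟨hl, Set.mem_iInter.2 fun i => ?_⟩, ?_⟩
    · have := hZw ⟨i.1, by simpa using i.2⟩
      simpa using this
    · rw [Set.mem_preimage, List.length_ofFn, show l + k + 1 = (k + 1) + l by omega, hw2]
      exact hk
  refine ⟨⟨_, ⟨w, hmem⟩⟩, l, ?_, w, hmem, ?_⟩
  · simp only [V.len, List.length_ofFn]
    omega
  · simpa using hw2 0

instance (n : ℕ) : Countable (S.V T n) := by
  have : Finite (S.P n) := (S.finite_P n).to_subtype
  unfold V
  infer_instance

end ApproxSystem

end Towers

/-! ### Measures of towers -/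

section Measures

variable {X : Type*} [TopologicalSpace X] [MeasurableSpace X] [BorelSpace X]
  {T : X ≃ₜ X} {S : ApproxSystem X} {μ : Measure X}

open ApproxSystem

theorem measure_image_pow (hT : MeasurePreserving T μ μ) (l : ℕ) {A : Set X}
    (hA : MeasurableSet A) : μ ((T ^ l) '' A) = μ A := by
  have h1 : (T ^ l) '' A = T.symm^[l] ⁻¹' A := by
    ext x
    have hinv : ∀ z, T^[l] (T.symm^[l] z) = z := fun z =>
      Function.LeftInverse.iterate T.apply_symm_apply l z
    have hinv' : ∀ z, T.symm^[l] (T^[l] z) = z := fun z =>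
      Function.LeftInverse.iterate T.symm_apply_apply l z
    rw [mem_image_pow]
    constructor
    · rintro ⟨w, hw, rfl⟩
      rwa [Set.mem_preimage, hinv']
    · exact fun hx => ⟨_, hx, hinv x⟩
  have hs : MeasurePreserving T.symm μ μ :=
    MeasurePreserving.symm T.toMeasurableEquiv hT
  rw [h1, (hs.iterate l).measure_preimage hA.nullMeasurableSet]

/-- The set `B` of points that never visit `A` at a positive time satisfies `B ⊆ T⁻¹ B`, so it is
null or conull. It misses `T⁻¹ A`, which has measure `μ A ≠ 0`, so it is null. -/
theorem ae_visits_forward [IsProbabilityMeasure μ] (hT : Ergodic T μ) {A : Set X} (hA : MeasurableSet A)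
    (h0 : μ A ≠ 0) : ∀ᵐ x ∂μ, ∃ k, T^[k + 1] x ∈ A := by
  let B : Set X := ⋂ k : ℕ, (T^[k + 1] ⁻¹' A)ᶜ
  have hB : MeasurableSet B := MeasurableSet.iInter fun k =>
    ((T.measurable.iterate _) hA).compl
  have hsub : B ⊆ T ⁻¹' B := fun x hx => Set.mem_iInter.2 fun k =>
    Set.mem_iInter.1 hx (k + 1)
  have hA' : μ (T ⁻¹' A) = μ A := hT.toMeasurePreserving.measure_preimage hA.nullMeasurableSet
  rcases hT.ae_empty_or_univ_of_ae_le_preimage hB.nullMeasurableSet hsub.eventuallyLE with h | h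
  · filter_upwards [h.mem_iff] with x hx
    by_contra hne
    push Not at hne
    exact (hx.1 (Set.mem_iInter.2 hne) : x ∈ (∅ : Set X))
  · exfalso
    have : μ (T ⁻¹' A) = 0 := by
      rw [← nonpos_iff_eq_zero]
      refine (measure_mono (t := Bᶜ) fun x hx hxB => Set.mem_iInter.1 hxB 0 hx).trans ?_
      rw [ae_eq_univ.1 h]
    exact h0 (hA' ▸ this)

theorem ae_visits_backward [IsProbabilityMeasure μ] (hT : Ergodic T μ) {A : Set X} (hA : MeasurableSet A)
    (h0 : μ A ≠ 0) : ∀ᵐ x ∂μ, ∃ k, T.symm^[k] x ∈ A := by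
  have hs : Ergodic T.symm μ := Ergodic.symm (e := T.toMeasurableEquiv) hT
  filter_upwards [ae_visits_forward hs hA h0] with x ⟨k, hk⟩
  exact ⟨_, hk⟩

theorem ApproxSystem.V.measurableSet {n : ℕ} (W : S.V T n) : MeasurableSet W.set :=
  W.isClopen.isOpen.measurableSet

/-- The bases of the towers are disjoint subsets of `E_n`. This controls the measure lost when a
fixed number of levels is cut from both ends of each tower. -/
theorem sum_measure_le [IsProbabilityMeasure μ] (n : ℕ) (F : Finset (S.V T n)) :
    ∑ W ∈ F, μ.real W.set ≤ μ.real (S.E n) := by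
  rw [← measureReal_biUnion_finset _ fun W _ => W.measurableSet]
  · exact measureReal_mono (Set.iUnion₂_subset fun W _ => W.subset_E)
  · intro W _ W' _ hne
    exact Set.disjoint_left.2 fun x hx hx' => hne (V.eq_of_mem hx hx')

theorem measure_E_ne_zero {X : Type*} [TopologicalSpace X] [MeasurableSpace X]
    (S : ApproxSystem X) (μ : Measure X) [μ.IsOpenPosMeasure] (n : ℕ) : μ (S.E n) ≠ 0 :=
  (S.isClopen_E n).isOpen.measure_ne_zero μ ⟨_, S.y_mem n⟩

variable [IsProbabilityMeasure μ] [μ.IsOpenPosMeasure]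

theorem ae_exists_level (hT : Ergodic T μ) (n : ℕ) :
    ∀ᵐ x ∂μ, ∃ (W : S.V T n) (l : ℕ), l < W.len ∧ ∃ w ∈ W.set, T^[l] w = x := by
  have hm := (S.isClopen_E n).isOpen.measurableSet
  filter_upwards [ae_visits_forward hT hm (measure_E_ne_zero S μ n),
    ae_visits_backward hT hm (measure_E_ne_zero S μ n)] with x h1 h2
  exact exists_level h1 h2

/-- A Kac formula: the levels of the towers partition `X` up to a null set, and the `|W|` levels
over `W` all have measure `μ(W)`. -/
theorem tsum_len_mul_measure (hT : Ergodic T μ) (n : ℕ) :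
    ∑' W : S.V T n, W.len * μ W.set = 1 := by
  have h1 : μ (⋃ p : Σ W : S.V T n, Fin W.len, (T ^ p.2.1) '' p.1.set) =
      ∑' p : Σ W : S.V T n, Fin W.len, μ ((T ^ p.2.1) '' p.1.set) := by
    refine measure_iUnion (fun p q hpq => ?_) fun p => (p.1.isClopen_image _).isOpen.measurableSet
    refine Set.disjoint_left.2 fun x hx hx' => hpq ?_
    obtain ⟨w, hw, rfl⟩ := mem_image_pow.1 hx
    obtain ⟨w', hw', he⟩ := mem_image_pow.1 hx'
    obtain ⟨W, l⟩ := p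
    obtain ⟨W', l'⟩ := q
    obtain ⟨e1, e2⟩ := V.level_eq l.2 l'.2 hw hw' he.symm
    obtain rfl : W = W' := e1
    rw [Fin.ext e2]
  have h2 : μ (⋃ p : Σ W : S.V T n, Fin W.len, (T ^ p.2.1) '' p.1.set) = 1 := by
    rw [← prob_compl_eq_zero_iff (MeasurableSet.iUnion fun p =>
      (p.1.isClopen_image _).isOpen.measurableSet)]
    refine (ae_exists_level (S := S) hT n).mono fun x ⟨W, l, hl, w, hw, e⟩ => ?_
    exact Set.mem_iUnion.2 ⟨⟨W, ⟨l, hl⟩⟩, mem_image_pow.2 ⟨w, hw, e⟩⟩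
  rw [h1, ENNReal.tsum_sigma'] at h2
  rw [← h2]
  refine tsum_congr fun W => ?_
  simp [measure_image_pow hT.toMeasurePreserving _ W.measurableSet, tsum_fintype]

theorem hasSum_measure_mul_len (hT : Ergodic T μ) (n : ℕ) :
    HasSum (fun W : S.V T n => μ.real W.set * W.len) 1 := by
  have h := tsum_len_mul_measure (S := S) hT n
  have hne : ∀ W : S.V T n, (W.len * μ W.set) ≠ ⊤ := fun W => by finiteness
  have hs := ENNReal.summable_toReal (h ▸ ENNReal.one_ne_top :
    ∑' W : S.V T n, W.len * μ W.set ≠ ⊤)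
  have e := ENNReal.tsum_toReal_eq hne
  rw [h, ENNReal.toReal_one] at e
  rw [e]
  convert! hs.hasSum using 2 with W
  rw [ENNReal.toReal_mul, mul_comm]
  rfl

/-- Up to a null set, `W` is the disjoint union of the levels `T^{j'}(W')` over the arrows `(W,
j')`, since almost every point lies in exactly one level of a tower of the next stage. -/
theorem tsum_arrow_measure (hT : Ergodic T μ) {n : ℕ} [DecidableEq (S.V T n)] (W : S.V T n) :
    ∑' (W' : S.V T (n + 1)) (b : S.Arrow T W'), (if b.1.1 = W then μ W'.set else 0) =
      μ W.set := by
  let s : (Σ W' : S.V T (n + 1), S.Arrow T W') → Set X := fun p =>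
    if p.2.1.1 = W then (T ^ p.2.1.2.1) '' p.1.set else ∅
  have hs : ∀ p x, x ∈ s p → p.2.1.1 = W ∧ ∃ w ∈ p.1.set, T^[p.2.1.2.1] w = x := by
    intro p x hx
    simp only [s] at hx
    split_ifs at hx with h
    · exact ⟨h, mem_image_pow.1 hx⟩
    · exact hx.elim
  have hm : ∀ p, MeasurableSet (s p) := fun p => by
    simp only [s]
    split_ifs
    · exact (p.1.isClopen_image _).isOpen.measurableSet
    · exact MeasurableSet.empty
  have h1 : μ (⋃ p, s p) = ∑' p, μ (s p) := by
    refine measure_iUnion (fun p q hpq => ?_) hm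
    refine Set.disjoint_left.2 fun x hx hx' => hpq ?_
    obtain ⟨e1, w, hw, rfl⟩ := hs p x hx
    obtain ⟨e2, w', hw', he⟩ := hs q _ hx'
    obtain ⟨W', b⟩ := p
    obtain ⟨W'', c⟩ := q
    obtain ⟨f1, f2⟩ := V.level_eq b.1.2.2 c.1.2.2 hw hw' he.symm
    obtain rfl : W' = W'' := f1
    congr 1
    exact Subtype.ext (Prod.ext (e1.trans e2.symm) (Fin.ext f2))
  have h2 : μ (⋃ p, s p) = μ W.set := by
    refine measure_congr (Filter.EventuallyEq.symm ?_)
    filter_upwards [ae_exists_level (S := S) hT (n + 1)] with x ⟨W', l, hl, w, hw, e⟩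
    refine propext ⟨fun hx => ?_, fun hx => ?_⟩
    · obtain ⟨⟨b, i⟩, hp⟩ := place_surjective W' ⟨l, hl⟩
      have hp' : b.1.2.1 + i.1 = l := congrArg Fin.val hp
      have hb : T^[b.1.2.1] w ∈ b.1.1.set := b.2 hw
      -- A point of `W ⊆ E_n` can only be at the bottom of its block, because the higher levels of a
      -- block avoid `E_n`.
      have hi : i.1 = 0 := by
        by_contra h0
        refine V.notMem_of_lt b.1.1 hb (Nat.pos_of_ne_zero h0) i.2 ?_
        rw [← Function.iterate_add_apply, add_comm, hp', e]
        exact W.subset_E hx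
      rw [hi, add_zero] at hp'
      rw [hp', e] at hb
      have hbW : b.1.1 = W := V.eq_of_mem hb hx
      refine Set.mem_iUnion.2 ⟨⟨W', b⟩, ?_⟩
      simp only [s, if_pos hbW]
      exact mem_image_pow.2 ⟨w, hw, by rw [hp', e]⟩
    · obtain ⟨p, hp⟩ := Set.mem_iUnion.1 hx
      obtain ⟨e1, w, hw, rfl⟩ := hs p x hp
      have := p.2.2 hw
      rw [e1] at this
      exact this
  rw [← h2, h1, ENNReal.tsum_sigma']
  refine tsum_congr fun W' => tsum_congr fun b => ?_
  simp only [s]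
  split_ifs
  · exact (measure_image_pow hT.toMeasurePreserving _ W'.measurableSet).symm
  · exact measure_empty.symm

/-- With `r W` the rank of the component at `W`, this is the compatibility of the weighted ranks
with `j_n`. The sums are interchanged in `ENNReal`, where no summability is needed. -/
theorem tsum_arrow (hT : Ergodic T μ) {n : ℕ} [∀ W' : S.V T (n + 1), Fintype (S.Arrow T W')]
    (r : S.V T n → ℕ) :
    ∑' W' : S.V T (n + 1), μ.real W'.set * ((∑ b : S.Arrow T W', r b.1.1 : ℕ) : ℝ) =
      ∑' W : S.V T n, μ.real W.set * r W := by
  classical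
  have key : ∑' W' : S.V T (n + 1), μ W'.set * ((∑ b : S.Arrow T W', r b.1.1 : ℕ) : ENNReal) =
      ∑' W : S.V T n, μ W.set * r W := by
    have e : ∀ W' : S.V T (n + 1), μ W'.set * ((∑ b : S.Arrow T W', r b.1.1 : ℕ) : ENNReal) =
        ∑' (W : S.V T n), ∑' b : S.Arrow T W', (if b.1.1 = W then μ W'.set else 0) * r W := by
      intro W'
      rw [ENNReal.tsum_comm, tsum_fintype, Nat.cast_sum, Finset.mul_sum]
      refine Finset.sum_congr rfl fun b _ => ?_
      rw [tsum_eq_single b.1.1 fun W hW => by rw [if_neg hW.symm, zero_mul], if_pos rfl]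
    rw [tsum_congr e, ENNReal.tsum_comm]
    refine tsum_congr fun W => ?_
    rw [← tsum_arrow_measure hT W, ← ENNReal.tsum_mul_right]
    exact tsum_congr fun W' => ENNReal.tsum_mul_right
  have h := congrArg ENNReal.toReal key
  rw [ENNReal.tsum_toReal_eq (fun W' => by finiteness),
    ENNReal.tsum_toReal_eq (fun W' => by finiteness)] at h
  simpa only [ENNReal.toReal_mul, ENNReal.toReal_natCast] using! h

/-- An atom would be periodic by Poincaré recurrence. Its finite orbit would have full measure by
ergodicity, and the open null complement of the orbit would be empty by fullness, contradicting that
`X` is infinite. -/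
theorem measure_singleton_eq_zero [T2Space X] [Infinite X] (hT : Ergodic T μ) (y : X) :
    μ {y} = 0 := by
  by_contra h0
  obtain ⟨x, hx, m, hm, hmx⟩ := hT.toMeasurePreserving.exists_mem_iterate_mem
    (measurableSet_singleton y).nullMeasurableSet h0
  obtain rfl := Set.mem_singleton_iff.1 hx
  have hmx : T^[m] x = x := hmx
  let O : Set X := (fun i => T^[i] x) '' Set.Iio m
  have hfin : O.Finite := (Set.finite_Iio m).image _
  have hsub : O ⊆ T ⁻¹' O := by
    rintro _ ⟨i, hi, rfl⟩
    rcases (Nat.succ_le_of_lt hi).lt_or_eq with h | h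
    · exact ⟨i + 1, h, Function.iterate_succ_apply' _ _ _⟩
    · refine ⟨0, Nat.pos_of_ne_zero hm, ?_⟩
      have : T^[i + 1] x = x := by rwa [← Nat.succ_eq_add_one, h]
      rw [Function.iterate_succ_apply'] at this
      exact this.symm
  rcases hT.ae_empty_or_univ_of_ae_le_preimage hfin.measurableSet.nullMeasurableSet
    hsub.eventuallyLE with h | h
  · refine h0 (nonpos_iff_eq_zero.1 ((measure_mono ?_).trans (ae_eq_empty.1 h).le))
    exact Set.singleton_subset_iff.2 ⟨0, Nat.pos_of_ne_zero hm, rfl⟩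
  · have hc : Oᶜ = ∅ := hfin.isClosed.isOpen_compl.eq_empty_of_measure_zero (ae_eq_univ.1 h)
    exact Set.infinite_univ (Set.compl_empty_iff.1 hc ▸ hfin)

theorem tendsto_measure_E [T2Space X] [Infinite X] (hT : Ergodic T μ) :
    Tendsto (fun n => μ.real (S.E n)) atTop (𝓝 0) := by
  have h := tendsto_measure_iInter_atTop (μ := μ) (s := S.E)
    (fun n => (S.isClopen_E n).isOpen.measurableSet.nullMeasurableSet) S.antitone_E
    ⟨0, measure_ne_top _ _⟩
  rw [S.iInter_E, measure_singleton_eq_zero hT] at h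
  exact (ENNReal.tendsto_toReal ENNReal.zero_ne_top).comp h

end Measures

/-! ### Monomials in the crossed product -/

section Monomials

variable {K : Type*} [Field K] {X : Type*} [TopologicalSpace X] {T : X ≃ₜ X}

/-- The monomial `f t^i`. -/
def mono (T : X ≃ₜ X) (f : LocallyConstant X K) (i : ℤ) : CrossedProduct K T :=
  SkewMonoidAlgebra.single (Multiplicative.ofAdd i) (toCK K T f)

/-- The translate `f ∘ T^{-i}`. -/
def shift {Y : Type*} (T : X ≃ₜ X) (i : ℤ) (f : LocallyConstant X Y) : LocallyConstant X Y :=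
  LocallyConstant.comap ⟨_, (T ^ (-i)).continuous⟩ f

theorem shift_apply {Y : Type*} (i : ℤ) (f : LocallyConstant X Y) (x : X) :
    shift T i f x = f ((T ^ (-i)) x) := rfl

theorem mono_mul_mono (f g : LocallyConstant X K) (i j : ℤ) :
    mono T f i * mono T g j = mono T (f * shift T i g) (i + j) := by
  unfold mono
  rw [SkewMonoidAlgebra.single_mul_single]
  rfl

theorem incl_eq_mono (f : LocallyConstant X K) : incl K T f = mono T f 0 := rfl

theorem tpow_eq_mono (i : ℤ) : tpow K T i = mono T 1 i := rfl

theorem chi_eq_mono {U : Set X} (hU : IsClopen U) :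
    chi K T hU = mono T (LocallyConstant.charFn K hU) 0 := rfl

theorem mono_add (f g : LocallyConstant X K) (i : ℤ) :
    mono T (f + g) i = mono T f i + mono T g i := by
  unfold mono
  rw [map_add, SkewMonoidAlgebra.single_add]

theorem mono_zero (i : ℤ) : mono T (0 : LocallyConstant X K) i = 0 := by
  unfold mono
  rw [map_zero, SkewMonoidAlgebra.single_zero]

theorem mono_sub (f g : LocallyConstant X K) (i : ℤ) :
    mono T (f - g) i = mono T f i - mono T g i := by
  rw [eq_sub_iff_add_eq, ← mono_add, sub_add_cancel]

theorem mono_smul (c : K) (f : LocallyConstant X K) (i : ℤ) :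
    mono T (c • f) i = c • mono T f i := by
  unfold mono
  rw [map_smul, SkewMonoidAlgebra.smul_single]

theorem mono_sum {α : Type*} (s : Finset α) (f : α → LocallyConstant X K) (i : ℤ) :
    mono T (∑ a ∈ s, f a) i = ∑ a ∈ s, mono T (f a) i := by
  classical
  induction s using Finset.induction_on with
  | empty => simp [mono_zero]
  | insert a s ha ih => rw [Finset.sum_insert ha, Finset.sum_insert ha, mono_add, ih]

theorem mono_one_zero : mono T (1 : LocallyConstant X K) 0 = 1 := rfl

theorem shift_zero {Y : Type*} (f : LocallyConstant X Y) : shift T 0 f = f := rfl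

theorem mono_zero_mul (f g : LocallyConstant X K) (j : ℤ) :
    mono T f 0 * mono T g j = mono T (f * g) j := by
  rw [mono_mul_mono, shift_zero, zero_add]

/-- The coefficient of `t^i`. -/
def cf (i : ℤ) : CrossedProduct K T →+ LocallyConstant X K where
  toFun a := (toCK K T).symm (a.coeff (Multiplicative.ofAdd i))
  map_zero' := by simp
  map_add' a b := by simp

theorem cf_mono (f : LocallyConstant X K) (i j : ℤ) :
    cf j (mono T f i) = if i = j then f else 0 := by
  classical
  change (toCK K T).symm (SkewMonoidAlgebra.coeff _ _) = _
  unfold mono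
  rw [SkewMonoidAlgebra.coeff_single_apply]
  by_cases h : i = j
  · subst h; simp
  · have : ¬ Multiplicative.ofAdd i = Multiplicative.ofAdd j := h
    simp [h]

theorem cf_smul (c : K) (a : CrossedProduct K T) (i : ℤ) : cf i (c • a) = c • cf i a := by
  change (toCK K T).symm (SkewMonoidAlgebra.coeff _ _) = _
  rw [SkewMonoidAlgebra.coeff_smul]
  exact map_smul (toCK K T).symm _ _

theorem eq_of_cf_eq {a b : CrossedProduct K T} (h : ∀ i, cf i a = cf i b) : a = b :=
  SkewMonoidAlgebra.ext fun i => (toCK K T).symm.injective (h i.toAdd)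

theorem mono_induction {p : CrossedProduct K T → Prop} (a : CrossedProduct K T)
    (h0 : p 0) (hadd : ∀ a b, p a → p b → p (a + b)) (hm : ∀ f i, p (mono T f i)) : p a := by
  induction a using SkewMonoidAlgebra.induction_on with
  | zero => exact h0
  | single g a =>
    have := hm ((toCK K T).symm a) g.toAdd
    unfold mono at this
    rwa [AlgEquiv.apply_symm_apply, ofAdd_toAdd] at this
  | add f g hf hg => exact hadd f g hf hg

theorem zpow_iterate {m : ℤ} {i j : ℕ} (h : m + i = j) (w : X) : (T ^ m) (T^[i] w) = T^[j] w := by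
  rw [← pow_apply, ← pow_apply, ← zpow_natCast, ← zpow_natCast, ← Homeomorph.mul_apply,
    ← zpow_add, h]

theorem charFn_of_mem {U : Set X} (hU : IsClopen U) {x : X} (hx : x ∈ U) :
    LocallyConstant.charFn K hU x = 1 := by
  rw [LocallyConstant.coe_charFn, Set.indicator_of_mem hx]; rfl

theorem charFn_of_notMem {U : Set X} (hU : IsClopen U) {x : X} (hx : x ∉ U) :
    LocallyConstant.charFn K hU x = 0 := by
  rw [LocallyConstant.coe_charFn, Set.indicator_of_notMem hx]

end Monomials

/-! ### The matrix units `e_{ij}(W)` -/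

section MatrixUnits

variable {K : Type*} [Field K] {X : Type*} [TopologicalSpace X] {T : X ≃ₜ X} {S : ApproxSystem X}

open ApproxSystem

/-- The characteristic function of the level `T^l(W)`. -/
def lv (K : Type*) [Field K] {n : ℕ} (W : S.V T n) (l : ℕ) : LocallyConstant X K :=
  LocallyConstant.charFn K (W.isClopen_image l)

theorem lv_apply_iterate {n : ℕ} {W : S.V T n} {w : X} (hw : w ∈ W.set) (l : ℕ) :
    lv K W l (T^[l] w) = 1 := charFn_of_mem _ (mem_image_pow.2 ⟨w, hw, rfl⟩)

theorem lv_apply_of_ne {n : ℕ} {W : S.V T n} {l : ℕ} {x : X} (h : ∀ w ∈ W.set, T^[l] w ≠ x) :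
    lv K W l x = 0 := charFn_of_notMem _ fun hx => by
  obtain ⟨w, hw, e⟩ := mem_image_pow.1 hx
  exact h w hw e

/-- Two locally constant functions that vanish off `T^l(W)` are equal if they agree on it. -/
theorem lv_ext {n : ℕ} {W : S.V T n} {l : ℕ} {f g : LocallyConstant X K}
    (hf : ∀ x, (∀ w ∈ W.set, T^[l] w ≠ x) → f x = 0) (hg : ∀ x, (∀ w ∈ W.set, T^[l] w ≠ x) → g x = 0)
    (h : ∀ w ∈ W.set, f (T^[l] w) = g (T^[l] w)) : f = g := by
  refine LocallyConstant.ext fun x => ?_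
  by_cases hx : ∃ w ∈ W.set, T^[l] w = x
  · obtain ⟨w, hw, rfl⟩ := hx
    exact h w hw
  · push Not at hx
    rw [hf x hx, hg x hx]

theorem lv_mul_eq_smul {n : ℕ} (W : S.V T n) (l : ℕ) {f : LocallyConstant X K} {c : K}
    (h : ∀ w ∈ W.set, f (T^[l] w) = c) : lv K W l * f = c • lv K W l := by
  refine lv_ext (W := W) (l := l) (fun x hx => ?_) (fun x hx => ?_) fun w hw => ?_
  · rw [LocallyConstant.mul_apply, lv_apply_of_ne hx, zero_mul]
  · rw [LocallyConstant.smul_apply, lv_apply_of_ne hx, smul_zero]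
  · rw [LocallyConstant.mul_apply, LocallyConstant.smul_apply, lv_apply_iterate hw, h w hw]
    simp

/-- The levels `1, …, |W| - 1` miss `E_n`, so the cut-offs `χ_{X∖E_n}` act as `1` along the tower.
In this monomial form the matrix unit relations reduce to disjointness of levels. -/
theorem eW_eq {n : ℕ} (W : S.V T n) (i j : Fin W.len) :
    eW K W i j = mono T (lv K W i) ((i : ℤ) - j) := by
  have hE : ∀ w ∈ W.set, ∀ l, l + 1 < W.len →
      LocallyConstant.charFn K (S.isClopen_E n).compl (T^[l + 1] w) = 1 := fun w hw l hl =>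
    charFn_of_mem _ (V.notMem_of_lt W hw (Nat.succ_pos _) hl)
  have h1 : ∀ j, j < W.len → chi K T W.isClopen *
      (tpow K T (-1) * chi K T (S.isClopen_E n).compl) ^ j = mono T (lv K W 0) (-(j : ℤ)) := by
    intro j hj
    induction j with
    | zero =>
      rw [pow_zero, mul_one, chi_eq_mono, Nat.cast_zero, neg_zero]
      congr 1
      refine LocallyConstant.ext fun x => ?_
      by_cases hx : x ∈ W.set
      · rw [charFn_of_mem _ hx]
        exact (lv_apply_iterate hx 0).symm
      · rw [charFn_of_notMem _ hx, lv_apply_of_ne]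
        rintro w hw rfl
        exact hx hw
    | succ j ih =>
      rw [pow_succ, ← mul_assoc, ih (by omega), tpow_eq_mono, chi_eq_mono, mono_mul_mono,
        mono_mul_mono, one_mul]
      congr 1
      · rw [lv_mul_eq_smul W 0 (c := 1), one_smul]
        intro w hw
        rw [shift_apply, shift_apply, ← hE w hw j hj]
        congr 1
        rw [zpow_iterate (j := j) (by simp), zpow_iterate (j := j + 1) (by push_cast; ring)]
      · push_cast; ring
  have h2 : ∀ i, i < W.len → ∀ m : ℤ, (chi K T (S.isClopen_E n).compl * tpow K T 1) ^ i *
      mono T (lv K W 0) m = mono T (lv K W i) (i + m) := by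
    intro i hi m
    induction i with
    | zero => simp
    | succ i ih =>
      rw [pow_succ', mul_assoc, ih (by omega), tpow_eq_mono, chi_eq_mono, mul_assoc,
        mono_mul_mono 1, mono_zero_mul, one_mul]
      congr 1
      · refine lv_ext (W := W) (l := i + 1) (fun x hx => ?_) (fun x hx => lv_apply_of_ne hx) ?_
        · rw [LocallyConstant.mul_apply, shift_apply, lv_apply_of_ne, mul_zero]
          intro w hw he
          apply hx w hw
          rw [Function.iterate_succ_apply', he, zpow_neg, zpow_one]
          exact T.apply_symm_apply x
        · intro w hw
          rw [LocallyConstant.mul_apply, hE w hw i hi, shift_apply,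
            zpow_iterate (j := i) (by push_cast; ring), lv_apply_iterate hw, lv_apply_iterate hw,
            one_mul]
      · push_cast; ring
  unfold eW
  rw [mul_assoc, h1 j j.2, h2 i i.2]
  rfl

theorem hW_eq {n : ℕ} (W : S.V T n) : hW K W = ∑ l : Fin W.len, eW K W l l := by
  unfold hW
  refine Finset.sum_congr rfl fun l _ => ?_
  rw [eW_eq, sub_self]
  rfl

/-- `f t^m` carries level `j` to level `j + m` and multiplies by the constant value of `f` there;
`hi` says that the target level is still in the tower. -/
theorem mono_mul_eW {n : ℕ} (W : S.V T n) {f : LocallyConstant X K} {m : ℤ} {i j k : Fin W.len}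
    (hi : (i : ℤ) = j + m) {c : K} (hf : ∀ w ∈ W.set, f (T^[i] w) = c) :
    mono T f m * eW K W j k = c • eW K W i k := by
  rw [eW_eq, eW_eq, mono_mul_mono, ← mono_smul]
  congr 1
  · have : f * shift T m (lv K W j) = lv K W i * f := by
      refine lv_ext (W := W) (l := i) (fun x hx => ?_) (fun x hx => ?_) fun w hw => ?_
      · rw [LocallyConstant.mul_apply, shift_apply, lv_apply_of_ne, mul_zero]
        intro w hw he
        apply hx w hw
        rw [← zpow_iterate (T := T) (m := m) (i := j) (j := i) (by rw [hi]; ring) w, he,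
          ← Homeomorph.mul_apply, ← zpow_add, add_neg_cancel]
        rfl
      · rw [LocallyConstant.mul_apply, lv_apply_of_ne hx, zero_mul]
      · rw [LocallyConstant.mul_apply, LocallyConstant.mul_apply, shift_apply,
          zpow_iterate (j := j) (by rw [hi]; ring), lv_apply_iterate hw, lv_apply_iterate hw,
          mul_comm]
    rw [this, lv_mul_eq_smul W i hf]
  · omega

theorem eW_mul_mono {n : ℕ} (W : S.V T n) {f : LocallyConstant X K} {m : ℤ} {i j k : Fin W.len}
    (hk : (j : ℤ) = k + m) {c : K} (hf : ∀ w ∈ W.set, f (T^[j] w) = c) :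
    eW K W i j * mono T f m = c • eW K W i k := by
  rw [eW_eq, eW_eq, mono_mul_mono, ← mono_smul]
  congr 1
  · rw [lv_mul_eq_smul W i (c := c)]
    intro w hw
    rw [shift_apply, zpow_iterate (j := j) (by ring), hf w hw]
  · omega

theorem eW_mul_mono_zero {n : ℕ} (W : S.V T n) {f : LocallyConstant X K} {m : ℤ} {i j : Fin W.len}
    (hf : ∀ w ∈ W.set, f (T^[j] w) = 0) : eW K W i j * mono T f m = 0 := by
  rw [eW_eq, mono_mul_mono, lv_mul_eq_smul W i (c := 0), zero_smul, mono_zero]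
  intro w hw
  rw [shift_apply, zpow_iterate (j := j) (by ring), hf w hw]

theorem eW_mul_eW {n : ℕ} (W : S.V T n) (i j k : Fin W.len) :
    eW K W i j * eW K W j k = eW K W i k := by
  conv_lhs => rw [eW_eq W j k]
  rw [eW_mul_mono W (k := k) (by ring) (c := 1) fun w hw => lv_apply_iterate hw _, one_smul]

theorem eW_mul_eW_of_ne {n : ℕ} (W : S.V T n) (i j k l : Fin W.len) (h : j ≠ k) :
    eW K W i j * eW K W k l = 0 := by
  conv_lhs => rw [eW_eq W k l]
  refine eW_mul_mono_zero W fun w hw => lv_apply_of_ne fun w' hw' he => h ?_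
  exact (Fin.ext (V.level_eq k.2 j.2 hw' hw he).2).symm

theorem eW_mul_eW_of_ne' {n : ℕ} {W W' : S.V T n} (i j : Fin W.len) (k l : Fin W'.len)
    (h : W ≠ W') : eW K W i j * eW K W' k l = 0 := by
  conv_lhs => rw [eW_eq W' k l]
  refine eW_mul_mono_zero W fun w hw => lv_apply_of_ne fun w' hw' he => h ?_
  exact (V.level_eq k.2 j.2 hw' hw he).1.symm

/-- The embedding of `M_{|W|}(K)` through the matrix units `e_{ij}(W)`. -/
def iotaW (K : Type*) [Field K] {n : ℕ} (W : S.V T n) :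
    Matrix (Fin W.len) (Fin W.len) K →ₙ+* CrossedProduct K T where
  toFun c := ∑ i, ∑ j, c i j • eW K W i j
  map_zero' := by simp
  map_add' c d := by simp [add_smul, Finset.sum_add_distrib]
  map_mul' c d := by
    have h1 : ∀ i k, ((∑ j, c i j • eW K W i j) * ∑ l, d k l • eW K W k l) =
        ∑ l, (c i k * d k l) • eW K W i l := by
      intro i k
      rw [Finset.sum_mul_sum, Finset.sum_eq_single k]
      · refine Finset.sum_congr rfl fun l _ => ?_
        rw [smul_mul_smul_comm, eW_mul_eW]
      · intro j _ hj
        refine Finset.sum_eq_zero fun l _ => ?_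
        rw [smul_mul_smul_comm, eW_mul_eW_of_ne W _ _ _ _ hj, smul_zero]
      · simp
    rw [Finset.sum_mul_sum]
    refine Finset.sum_congr rfl fun i _ => ?_
    rw [Finset.sum_congr rfl fun k _ => h1 i k, Finset.sum_comm]
    simp only [Matrix.mul_apply, Finset.sum_smul]

theorem iotaW_apply {n : ℕ} (W : S.V T n) (c : Matrix (Fin W.len) (Fin W.len) K) :
    iotaW K W c = ∑ i, ∑ j, c i j • eW K W i j := rfl

theorem iotaW_single {n : ℕ} (W : S.V T n) (i j : Fin W.len) (c : K) :
    iotaW K W (Matrix.single i j c) = c • eW K W i j := by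
  rw [iotaW_apply, Finset.sum_eq_single i, Finset.sum_eq_single j]
  · simp
  · intro k _ hk
    rw [Matrix.single_apply_of_col_ne _ _ hk.symm, zero_smul]
  · simp
  · intro k _ hk
    refine Finset.sum_eq_zero fun l _ => ?_
    rw [Matrix.single_apply_of_row_ne hk.symm, zero_smul]
  · simp

theorem iotaW_one {n : ℕ} (W : S.V T n) : iotaW K W 1 = hW K W := by
  rw [iotaW_apply, hW_eq]
  refine Finset.sum_congr rfl fun i _ => ?_
  rw [Finset.sum_eq_single i]
  · simp
  · intro j _ hj
    rw [Matrix.one_apply_ne hj.symm, zero_smul]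
  · simp

theorem iotaW_smul {n : ℕ} (W : S.V T n) (a : K) (c : Matrix (Fin W.len) (Fin W.len) K) :
    iotaW K W (a • c) = a • iotaW K W c := by
  simp [iotaW_apply, Finset.smul_sum, smul_smul]

theorem iotaW_mul_iotaW_of_ne {n : ℕ} {W W' : S.V T n} (h : W ≠ W')
    (c : Matrix (Fin W.len) (Fin W.len) K) (d : Matrix (Fin W'.len) (Fin W'.len) K) :
    iotaW K W c * iotaW K W' d = 0 := by
  simp only [iotaW_apply, Finset.sum_mul, Finset.mul_sum, smul_mul_smul_comm,
    eW_mul_eW_of_ne' _ _ _ _ h, smul_zero, Finset.sum_const_zero]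

/-- Matrix entries are read off from coefficients: the power of `t` fixes `i - j` and the evaluation
point fixes `i`. Hence `iotaW` is injective and the matrix chosen in `piN` is determined. -/
theorem cf_iotaW {n : ℕ} (W : S.V T n) (c : Matrix (Fin W.len) (Fin W.len) K) (i j : Fin W.len)
    {w : X} (hw : w ∈ W.set) : cf ((i : ℤ) - j) (iotaW K W c) (T^[i] w) = c i j := by
  have h0 : ∀ k : Fin W.len, k ≠ i → lv K W k (T^[i] w) = 0 := fun k hk =>
    lv_apply_of_ne fun w' hw' he => hk (Fin.ext (V.level_eq k.2 i.2 hw' hw he).2)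
  have ev : ∀ (s : Finset (Fin W.len)) (f : Fin W.len → LocallyConstant X K),
      (∑ a ∈ s, f a) (T^[i] w) = ∑ a ∈ s, f a (T^[i] w) := fun s f =>
    map_sum (LocallyConstant.evalRingHom _) _ _
  rw [iotaW_apply, map_sum, ev, Finset.sum_eq_single i]
  · rw [map_sum, ev, Finset.sum_eq_single j]
    · rw [cf_smul, eW_eq, cf_mono, if_pos rfl, LocallyConstant.smul_apply, lv_apply_iterate hw]
      simp
    · intro k _ hk
      rw [cf_smul, eW_eq, cf_mono, if_neg, smul_zero]
      · rfl
      · intro h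
        exact hk (Fin.ext (by omega))
    · simp
  · intro k _ hk
    rw [map_sum, ev]
    refine Finset.sum_eq_zero fun l _ => ?_
    rw [cf_smul, eW_eq, cf_mono, LocallyConstant.smul_apply]
    split_ifs
    · rw [h0 k hk, smul_zero]
    · exact smul_zero _
  · simp

theorem iotaW_injective {n : ℕ} (W : S.V T n) : Function.Injective (iotaW K W) := by
  intro c d h
  obtain ⟨w, hw⟩ := W.set_nonempty
  ext i j
  rw [← cf_iotaW W c i j hw, h, cf_iotaW W d i j hw]

end MatrixUnits

/-! ### The maps `π_n` and `π_∞` -/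

section Representation

variable {K : Type*} [Field K] {X : Type*} [TopologicalSpace X] {T : X ≃ₜ X} {S : ApproxSystem X}

open ApproxSystem

/-- The element `a` acts on the tower over `W` as the matrix `c`. -/
def Rel {n : ℕ} (W : S.V T n) (a : CrossedProduct K T) (c : Matrix (Fin W.len) (Fin W.len) K) :
    Prop := hW K W * a = iotaW K W c

theorem iotaW_mul_hW {n : ℕ} (W : S.V T n) (c : Matrix (Fin W.len) (Fin W.len) K) :
    iotaW K W c * hW K W = iotaW K W c := by
  rw [← iotaW_one, ← map_mul, mul_one]

/-- Since `h_W` is the unit of the image of `iotaW`, it can be inserted between the two factors.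
Multiplicativity thus does not require that `h_W` commute with `a`. -/
theorem Rel.mul {n : ℕ} {W : S.V T n} {a b : CrossedProduct K T}
    {c d : Matrix (Fin W.len) (Fin W.len) K} (h : Rel W a c) (h' : Rel W b d) :
    Rel W (a * b) (c * d) := by
  unfold Rel at *
  rw [← mul_assoc, h, ← iotaW_mul_hW, mul_assoc, h', map_mul]

theorem Rel.add {n : ℕ} {W : S.V T n} {a b : CrossedProduct K T}
    {c d : Matrix (Fin W.len) (Fin W.len) K} (h : Rel W a c) (h' : Rel W b d) :
    Rel W (a + b) (c + d) := by
  unfold Rel at *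
  rw [mul_add, h, h', map_add]

theorem Rel.smul {n : ℕ} {W : S.V T n} {a : CrossedProduct K T}
    {c : Matrix (Fin W.len) (Fin W.len) K} (h : Rel W a c) (k : K) : Rel W (k • a) (k • c) := by
  unfold Rel at *
  rw [mul_smul_comm, h, iotaW_smul]

theorem Rel.one {n : ℕ} (W : S.V T n) : Rel W (1 : CrossedProduct K T) 1 := by
  unfold Rel
  rw [mul_one, iotaW_one]

theorem Rel.unique {n : ℕ} {W : S.V T n} {a : CrossedProduct K T}
    {c d : Matrix (Fin W.len) (Fin W.len) K} (h : Rel W a c) (h' : Rel W a d) : c = d :=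
  iotaW_injective W (h.symm.trans h')

theorem piN_eq {n : ℕ} {W : S.V T n} {a : CrossedProduct K T}
    {c : Matrix (Fin W.len) (Fin W.len) K} (h : Rel W a c) : piN K T S n a W = c := by
  have hex : ∃ c : Matrix (Fin W.len) (Fin W.len) K,
      hW K W * a = ∑ i, ∑ j, c i j • eW K W i j := ⟨c, h⟩
  unfold piN
  rw [dif_pos hex]
  exact Rel.unique (W := W) hex.choose_spec h

/-- The subalgebra of all elements on which `π_n` is well defined. -/
def Dn (K : Type*) [Field K] (T : X ≃ₜ X) (S : ApproxSystem X) (n : ℕ) :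
    Subalgebra K (CrossedProduct K T) where
  carrier := {a | ∀ W : S.V T n, ∃ c, Rel W a c}
  mul_mem' ha hb W := by
    obtain ⟨c, hc⟩ := ha W
    obtain ⟨d, hd⟩ := hb W
    exact ⟨_, hc.mul hd⟩
  add_mem' ha hb W := by
    obtain ⟨c, hc⟩ := ha W
    obtain ⟨d, hd⟩ := hb W
    exact ⟨_, hc.add hd⟩
  algebraMap_mem' k W := ⟨_, by
    rw [Algebra.algebraMap_eq_smul_one]
    exact (Rel.one W).smul k⟩

theorem rel_piN {n : ℕ} {a : CrossedProduct K T} (h : a ∈ Dn K T S n) (W : S.V T n) :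
    Rel W a (piN K T S n a W) := by
  obtain ⟨c, hc⟩ := h W
  rwa [piN_eq hc]

theorem mem_Dn_of_rel {n : ℕ} {a : CrossedProduct K T} {c : Rn K T S n}
    (h : ∀ W, Rel W a (c W)) : a ∈ Dn K T S n := fun W => ⟨_, h W⟩

theorem piN_eq_of_rel {n : ℕ} {a : CrossedProduct K T} {c : Rn K T S n}
    (h : ∀ W, Rel W a (c W)) : piN K T S n a = c := funext fun W => piN_eq (h W)

/-- `π_n` as a ring homomorphism. -/
def piNHom (K : Type*) [Field K] (T : X ≃ₜ X) (S : ApproxSystem X) (n : ℕ) :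
    Dn K T S n →+* Rn K T S n where
  toFun a := piN K T S n a
  map_one' := piN_eq_of_rel fun W => Rel.one W
  map_mul' a b := piN_eq_of_rel fun W => (rel_piN a.2 W).mul (rel_piN b.2 W)
  map_zero' := piN_eq_of_rel fun W => by simp [Rel]
  map_add' a b := piN_eq_of_rel fun W => (rel_piN a.2 W).add (rel_piN b.2 W)

/-- `χ_{T^l(W)} f t^m` is a multiple of `e_{l,l-m}(W)` when `l - m` is a level of the tower.
Condition `hz` makes the coefficient vanish at the remaining `l`. -/
theorem rel_mono {n : ℕ} (W : S.V T n) {f : LocallyConstant X K} {m : ℤ} {F : Fin W.len → K}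
    (hF : ∀ l : Fin W.len, ∀ w ∈ W.set, f (T^[l] w) = F l)
    (hz : ∀ l : Fin W.len, F l ≠ 0 → 0 ≤ (l : ℤ) - m ∧ (l : ℤ) - m < W.len) :
    Rel W (mono T f m) (Matrix.of fun i j => if (i : ℤ) = j + m then F i else 0) := by
  unfold Rel
  rw [hW_eq, iotaW_apply, Finset.sum_mul]
  refine Finset.sum_congr rfl fun l _ => ?_
  by_cases h0 : F l = 0
  · rw [eW_mul_mono_zero W fun w hw => (hF l w hw).trans h0]
    simp [h0]
  · obtain ⟨h1, h2⟩ := hz l h0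
    obtain ⟨j, hj⟩ : ∃ j : Fin W.len, (l : ℤ) = j + m :=
      ⟨⟨((l : ℤ) - m).toNat, by omega⟩, by simp only; omega⟩
    rw [eW_mul_mono W hj (hF l), Finset.sum_eq_single j]
    · simp [hj]
    · intro k _ hk
      have : ¬ ((l : ℤ) = k + m) := fun h => hk (Fin.ext (by omega))
      simp [this]
    · simp

/-- `f` is constant on the atoms of the `n`-th partition. -/
def ConstOn {Y : Type*} (S : ApproxSystem X) (n : ℕ) (f : LocallyConstant X Y) : Prop :=
  ∀ Z ∈ S.atoms n, ∀ x ∈ Z, ∀ x' ∈ Z, f x = f x'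

theorem ConstOn.iterate_eq {Y : Type*} {n : ℕ} {f : LocallyConstant X Y} (hf : ConstOn S n f) (W : S.V T n)
    {l : ℕ} (hl : l ≤ W.len) {w w' : X} (hw : w ∈ W.set) (hw' : w' ∈ W.set) :
    f (T^[l] w) = f (T^[l] w') := by
  obtain ⟨Z, hZ, h⟩ := W.mem_E_or hl
  exact hf Z hZ _ (h w hw) _ (h w' hw')

theorem ConstOn.mono {Y : Type*} {n m : ℕ} (h : n ≤ m) {f : LocallyConstant X Y} (hf : ConstOn S n f) :
    ConstOn S m f := by
  intro Z hZ x hx x' hx'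
  obtain ⟨Z', hZ', hs⟩ := S.exists_atom_superset h hZ
  exact hf Z' hZ' x (hs hx) x' (hs hx')

theorem constOn_charFn {n : ℕ} {Z : Set X} (hZ : Z ∈ S.atoms n) :
    ConstOn S n (LocallyConstant.charFn K (S.isClopen_atom hZ)) := by
  intro Z' hZ' x hx x' hx'
  by_cases h : x ∈ Z
  · obtain rfl := atom_unique hZ hZ' h hx
    rw [charFn_of_mem _ hx, charFn_of_mem _ hx']
  · rw [charFn_of_notMem _ h, charFn_of_notMem]
    intro h'
    obtain rfl := atom_unique hZ hZ' h' hx'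
    exact h hx

theorem constOn_compl_E (n : ℕ) :
    ConstOn S n (LocallyConstant.charFn K (S.isClopen_E n).compl) := by
  intro Z hZ x hx x' hx'
  by_cases h : x ∈ S.E n
  · obtain rfl := atom_unique (Set.mem_insert _ _) hZ h hx
    rw [charFn_of_notMem, charFn_of_notMem] <;> simp_all
  · rw [charFn_of_mem _ h, charFn_of_mem]
    intro h'
    obtain rfl := atom_unique (Set.mem_insert _ _) hZ h' hx'
    exact h hx

/-- For `m = 1` the only problematic level is the base, and it lies in `E_n`, where `f` vanishes. -/
theorem mono_one_mem_Dn {n : ℕ} {f : LocallyConstant X K} (hf : ConstOn S n f)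
    (h0 : ∀ x ∈ S.E n, f x = 0) : mono T f 1 ∈ Dn K T S n := fun W => by
  obtain ⟨w, hw⟩ := W.set_nonempty
  refine ⟨_, rel_mono W (F := fun l => f (T^[l] w)) (fun l w' hw' => ?_) fun l hl => ?_⟩
  · exact hf.iterate_eq W l.2.le hw' hw
  · have := l.2
    have : l.1 ≠ 0 := fun h => hl (by simp only [h]; exact h0 w (W.subset_E hw))
    omega

theorem shift_neg_one_apply {Y : Type*} (f : LocallyConstant X Y) (x : X) :
    shift T (-1) f x = f (T x) := by
  rw [shift_apply, neg_neg, zpow_one]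

/-- For `m = -1` the problematic level is the top one. There the coefficient is the value of `f` on
`T^{|W|}(W) ⊆ E_n`, which is zero. -/
theorem mono_neg_one_mem_Dn {n : ℕ} {f : LocallyConstant X K} (hf : ConstOn S n f)
    (h0 : ∀ x ∈ S.E n, f x = 0) : mono T (shift T (-1) f) (-1) ∈ Dn K T S n := fun W => by
  obtain ⟨w, hw⟩ := W.set_nonempty
  refine ⟨_, rel_mono W (F := fun l => f (T^[l + 1] w)) (fun l w' hw' => ?_) fun l hl => ?_⟩
  · rw [shift_neg_one_apply, ← Function.iterate_succ_apply' T]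
    exact hf.iterate_eq W l.2 hw' hw
  · have := l.2
    have : l.1 + 1 ≠ W.len := fun h => hl (by
      simp only [h]
      exact h0 _ ((V.mem_iff W w).1 hw).2.2)
    omega

theorem chi_mul_tpow {U : Set X} (hU : IsClopen U) :
    chi K T hU * tpow K T 1 = mono T (LocallyConstant.charFn K hU) 1 := by
  rw [chi_eq_mono, tpow_eq_mono, mono_zero_mul, mul_one]

theorem tpow_mul_chi {U : Set X} (hU : IsClopen U) :
    tpow K T (-1) * chi K T hU = mono T (shift T (-1) (LocallyConstant.charFn K hU)) (-1) := by
  rw [chi_eq_mono, tpow_eq_mono, mono_mul_mono, one_mul, add_zero]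

theorem charFn_eq_zero_of_mem_E {n : ℕ} {Z : Set X} (hZ : Z ∈ S.P n) {x : X} (hx : x ∈ S.E n) :
    LocallyConstant.charFn K (S.isClopen_P n Z hZ) x = 0 :=
  charFn_of_notMem _ fun h => notMem_E hZ h hx

theorem An_le_Dn (n : ℕ) : An K T S n ≤ Dn K T S n := by
  refine Algebra.adjoin_le ?_
  rintro _ (⟨Z, rfl⟩ | ⟨Z, rfl⟩)
  · change chi K T (S.isClopen_P n Z.1 Z.2) * tpow K T 1 ∈ Dn K T S n
    rw [chi_mul_tpow]
    exact mono_one_mem_Dn (constOn_charFn (Set.mem_insert_of_mem _ Z.2)) fun x hx =>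
      charFn_eq_zero_of_mem_E Z.2 hx
  · change tpow K T (-1) * chi K T (S.isClopen_P n Z.1 Z.2) ∈ Dn K T S n
    rw [tpow_mul_chi]
    exact mono_neg_one_mem_Dn (constOn_charFn (Set.mem_insert_of_mem _ Z.2)) fun x hx =>
      charFn_eq_zero_of_mem_E Z.2 hx

theorem shift_add (i : ℤ) (f g : LocallyConstant X K) :
    shift T i (f + g) = shift T i f + shift T i g := rfl

theorem shift_smul (i : ℤ) (c : K) (f : LocallyConstant X K) :
    shift T i (c • f) = c • shift T i f := rfl

theorem shift_sum (i : ℤ) {α : Type*} (s : Finset α) (f : α → LocallyConstant X K) :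
    shift T i (∑ a ∈ s, f a) = ∑ a ∈ s, shift T i (f a) := by
  classical
  induction s using Finset.induction_on with
  | empty => rfl
  | insert a s ha ih => rw [Finset.sum_insert ha, Finset.sum_insert ha, shift_add, ih]

/-- A function that is constant on atoms and vanishes on `E n` is a linear combination of
characteristic functions of members of `P n`. -/
theorem ConstOn.eq_sum {n : ℕ} [Fintype (S.P n)] {f : LocallyConstant X K} (hf : ConstOn S n f)
    (h0 : ∀ x ∈ S.E n, f x = 0) : ∃ c : S.P n → K,
      f = ∑ Z : S.P n, c Z • LocallyConstant.charFn K (S.isClopen_P n Z.1 Z.2) := by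
  choose z hz using fun Z : S.P n => S.nonempty_P n Z.1 Z.2
  refine ⟨fun Z => f (z Z), LocallyConstant.ext fun x => ?_⟩
  have ev : ∀ (g : S.P n → LocallyConstant X K), (∑ a, g a) x = ∑ a, g a x := fun g =>
    map_sum (LocallyConstant.evalRingHom x) _ _
  rw [ev]
  obtain ⟨Z, hZ, hx⟩ := S.exists_atom n x
  rcases hZ with rfl | hZ
  · rw [h0 x hx, Finset.sum_eq_zero]
    intro Z _
    rw [LocallyConstant.smul_apply, charFn_eq_zero_of_mem_E Z.2 hx, smul_zero]
  · rw [Finset.sum_eq_single ⟨Z, hZ⟩]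
    · rw [LocallyConstant.smul_apply, charFn_of_mem _ hx, smul_eq_mul, mul_one]
      exact hf Z (Set.mem_insert_of_mem _ hZ) _ hx _ (hz ⟨Z, hZ⟩)
    · intro Z' _ hne
      rw [LocallyConstant.smul_apply, charFn_of_notMem, smul_zero]
      intro hx'
      exact hne (Subtype.ext (atom_unique (Set.mem_insert_of_mem _ Z'.2)
        (Set.mem_insert_of_mem _ hZ) hx' hx))
    · simp

theorem mono_one_mem_An {n : ℕ} {f : LocallyConstant X K} (hf : ConstOn S n f)
    (h0 : ∀ x ∈ S.E n, f x = 0) : mono T f 1 ∈ An K T S n := by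
  have := (S.finite_P n).fintype
  obtain ⟨c, hc⟩ := hf.eq_sum h0
  rw [hc, mono_sum]
  refine Subalgebra.sum_mem _ fun Z _ => ?_
  have hZ : chi K T (S.isClopen_P n Z.1 Z.2) * tpow K T 1 ∈ An K T S n :=
    Algebra.subset_adjoin (Or.inl ⟨Z, rfl⟩)
  rw [mono_smul, ← chi_mul_tpow]
  exact Subalgebra.smul_mem _ hZ _

theorem mono_neg_one_mem_An {n : ℕ} {f : LocallyConstant X K} (hf : ConstOn S n f)
    (h0 : ∀ x ∈ S.E n, f x = 0) : mono T (shift T (-1) f) (-1) ∈ An K T S n := by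
  have := (S.finite_P n).fintype
  obtain ⟨c, hc⟩ := hf.eq_sum h0
  rw [hc, shift_sum, mono_sum]
  refine Subalgebra.sum_mem _ fun Z _ => ?_
  have hZ : tpow K T (-1) * chi K T (S.isClopen_P n Z.1 Z.2) ∈ An K T S n :=
    Algebra.subset_adjoin (Or.inr ⟨Z, rfl⟩)
  rw [shift_smul, mono_smul, ← tpow_mul_chi]
  exact Subalgebra.smul_mem _ hZ _

/-- The generators of `𝒜_n` involve `t`. After subtracting the constant `f(y)`, the function
vanishes on `E_n`, and then `g = (g t)(t⁻¹ χ_{X∖E_n})`. -/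
theorem mono_zero_mem_An {n : ℕ} {f : LocallyConstant X K} (hf : ConstOn S n f) :
    mono T f 0 ∈ An K T S n := by
  let g : LocallyConstant X K := f - f S.y • 1
  have hg : ∀ x, g x = f x - f S.y := fun x => by
    rw [LocallyConstant.sub_apply, LocallyConstant.smul_apply]
    simp
  have hg0 : ∀ x ∈ S.E n, g x = 0 := fun x hx => by
    rw [hg, hf _ (Set.mem_insert _ _) x hx _ (S.y_mem n), sub_self]
  have hgc : ConstOn S n g := fun Z hZ x hx x' hx' => by rw [hg, hg, hf Z hZ x hx x' hx']
  have hm : mono T g 0 = mono T g 1 * mono T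
      (shift T (-1) (LocallyConstant.charFn K (S.isClopen_E n).compl)) (-1) := by
    rw [mono_mul_mono, add_neg_cancel]
    congr 1
    refine LocallyConstant.ext fun x => ?_
    rw [LocallyConstant.mul_apply, shift_apply, shift_neg_one_apply]
    have : T ((T ^ (-1 : ℤ)) x) = x := T.apply_symm_apply x
    rw [this]
    by_cases hx : x ∈ S.E n
    · rw [hg0 x hx, zero_mul]
    · rw [charFn_of_mem _ hx, mul_one]
  have hf : mono T f 0 = mono T g 0 + f S.y • (1 : CrossedProduct K T) := by
    rw [← mono_one_zero, ← mono_smul, ← mono_add, sub_add_cancel]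
  rw [hf]
  refine Subalgebra.add_mem _ ?_ (Subalgebra.smul_mem _ (Subalgebra.one_mem _) _)
  rw [hm]
  refine Subalgebra.mul_mem _ (mono_one_mem_An hgc hg0)
    (mono_neg_one_mem_An (constOn_compl_E n) fun x hx => charFn_of_notMem _ fun h => h hx)

theorem An_mono {n m : ℕ} (h : n ≤ m) : An K T S n ≤ An K T S m := by
  refine Algebra.adjoin_le ?_
  rintro _ (⟨Z, rfl⟩ | ⟨Z, rfl⟩)
  · change chi K T (S.isClopen_P n Z.1 Z.2) * tpow K T 1 ∈ An K T S m
    rw [chi_mul_tpow]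
    exact mono_one_mem_An ((constOn_charFn (Set.mem_insert_of_mem _ Z.2)).mono h) fun x hx =>
      charFn_eq_zero_of_mem_E Z.2 (S.antitone_E h hx)
  · change tpow K T (-1) * chi K T (S.isClopen_P n Z.1 Z.2) ∈ An K T S m
    rw [tpow_mul_chi]
    exact mono_neg_one_mem_An ((constOn_charFn (Set.mem_insert_of_mem _ Z.2)).mono h) fun x hx =>
      charFn_eq_zero_of_mem_E Z.2 (S.antitone_E h hx)

theorem exists_constOn {Y : Type*} [CompactSpace X] (S : ApproxSystem X)
    (f : LocallyConstant X Y) :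
    ∃ n, ∀ m ≥ n, ConstOn S m f :=
  S.exists_const_on_atoms f

theorem incl_mem_AInf [CompactSpace X] (f : LocallyConstant X K) : incl K T f ∈ AInf K T S := by
  obtain ⟨n, hn⟩ := exists_constOn S f
  exact Set.mem_iUnion.2 ⟨n, mono_zero_mem_An (hn n le_rfl)⟩

theorem jn_place (n : ℕ) (c : Rn K T S n) (W' : S.V T (n + 1)) (b : S.Arrow T W')
    (i k : Fin b.1.1.len) :
    jn K T S n c W' (place W' ⟨b, i⟩) (place W' ⟨b, k⟩) = c b.1.1 i k := by
  have h : ∀ p, (placeEquiv W').symm (place W' p) = p := (placeEquiv W').symm_apply_apply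
  simp [jn, h]

theorem jn_place_of_ne (n : ℕ) (c : Rn K T S n) (W' : S.V T (n + 1)) {b b' : S.Arrow T W'}
    (hb : b ≠ b') (i : Fin b.1.1.len) (k : Fin b'.1.1.len) :
    jn K T S n c W' (place W' ⟨b, i⟩) (place W' ⟨b', k⟩) = 0 := by
  have h : ∀ p, (placeEquiv W').symm (place W' p) = p := (placeEquiv W').symm_apply_apply
  classical
  simp only [jn, RingHom.pi_apply]
  simp [h]
  exact Matrix.blockDiagonal'_apply_ne _ _ _ hb

/-- This is `π_{n+1} = j_n ∘ π_n`, checked row by row. The level at place `(b, i)` over `W'` is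
contained in level `i` over `W`, so cutting `e_{ik}(W)` down to it gives the matrix unit of `W'` at
the places `(b, i)` and `(b, k)`. -/
theorem Rel.jn {n : ℕ} {a : CrossedProduct K T} {c : Rn K T S n} (h : ∀ W, Rel W a (c W))
    (W' : S.V T (n + 1)) : Rel W' a (jn K T S n c W') := by
  have := Fintype.ofFinite (S.Arrow T W')
  unfold Rel
  rw [hW_eq, iotaW_apply, Finset.sum_mul]
  refine Finset.sum_congr rfl fun l _ => ?_
  obtain ⟨⟨b, i⟩, rfl⟩ := place_surjective W' l
  have hmem : ∀ (i : Fin b.1.1.len), ∀ w ∈ W'.set, lv K b.1.1 i (T^[place W' ⟨b, i⟩] w) = 1 := by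
    intro i w hw
    have := lv_apply_iterate (K := K) (b.2 hw) i
    have e : i.1 + b.1.2.1 = b.1.2.1 + i.1 := add_comm _ _
    rw [← Function.iterate_add_apply, e] at this
    exact this
  have h1 : ∀ k, eW K W' (place W' ⟨b, i⟩) (place W' ⟨b, i⟩) * eW K b.1.1 i k =
      eW K W' (place W' ⟨b, i⟩) (place W' ⟨b, k⟩) := by
    intro k
    conv_lhs => rw [eW_eq b.1.1 i k]
    rw [eW_mul_mono W' (k := place W' ⟨b, k⟩) _ (hmem i), one_smul]
    simp only [place]
    push_cast
    ring
  have h2 : eW K b.1.1 i i * a = ∑ k, c b.1.1 i k • eW K b.1.1 i k := by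
    have e1 : eW K b.1.1 i i = eW K b.1.1 i i * hW K b.1.1 := by
      rw [hW_eq, Finset.mul_sum, Finset.sum_eq_single i]
      · rw [eW_mul_eW]
      · exact fun j _ hj => eW_mul_eW_of_ne _ _ _ _ _ hj.symm
      · simp
    have e2 : hW K b.1.1 * a = iotaW K b.1.1 (c b.1.1) := h _
    have e3 := iotaW_single b.1.1 i i (1 : K)
    rw [one_smul] at e3
    rw [e1, mul_assoc, e2, ← e3, ← map_mul, iotaW_apply, Finset.sum_eq_single i]
    · simp
    · intro j _ hj
      refine Finset.sum_eq_zero fun k _ => ?_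
      rw [Matrix.mul_apply, Finset.sum_eq_zero, zero_smul]
      intro p _
      rw [Matrix.single_apply_of_row_ne hj.symm, zero_mul]
    · simp
  rw [← h1 i, mul_assoc, h2, Finset.mul_sum, ← Equiv.sum_comp (placeEquiv W'), Fintype.sum_sigma,
    Finset.sum_eq_single b]
  · refine Finset.sum_congr rfl fun k _ => ?_
    rw [mul_smul_comm, h1]
    congr 1
    exact (jn_place n c W' b i k).symm
  · intro b' _ hb'
    refine Finset.sum_eq_zero fun k _ => ?_
    rw [show placeEquiv W' ⟨b', k⟩ = place W' ⟨b', k⟩ from rfl,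
      jn_place_of_ne n c W' hb'.symm, zero_smul]
  · simp

theorem piN_succ {n : ℕ} {a : CrossedProduct K T} (h : a ∈ Dn K T S n) :
    piN K T S (n + 1) a = jn K T S n (piN K T S n a) :=
  piN_eq_of_rel (Rel.jn (rel_piN h))

theorem Dn_mono {n m : ℕ} (h : n ≤ m) : Dn K T S n ≤ Dn K T S m := by
  induction m, h using Nat.le_induction with
  | base => exact le_rfl
  | succ m _ ih => exact fun a ha => mem_Dn_of_rel (Rel.jn (rel_piN (ih ha)))

theorem toRInf_jn (n : ℕ) (x : Rn K T S n) :
    toRInf K T S (n + 1) (jn K T S n x) = toRInf K T S n x := by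
  have h := DirectLimit.Ring.of_f (G := Rn K T S) (f := fun _ _ h => jle K T S h)
    (Nat.le_succ n) x
  rw [jle_succ K T S (le_refl n), jle_self] at h
  exact h

theorem toRInf_piN_of_le {n m : ℕ} (h : n ≤ m) {a : CrossedProduct K T} (ha : a ∈ Dn K T S n) :
    toRInf K T S m (piN K T S m a) = toRInf K T S n (piN K T S n a) := by
  induction m, h using Nat.le_induction with
  | base => rfl
  | succ m hm ih => rw [piN_succ (Dn_mono hm ha), toRInf_jn, ih]

/-- At the level used for the computation only membership in `Dn` is needed. This matters for the
matrix units of level `n`: they are shown to lie in `𝒜_∞` without control of the level at which they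
enter. -/
theorem piInf_eq {n : ℕ} {a : CrossedProduct K T} (ha : a ∈ AInf K T S) (hn : a ∈ Dn K T S n) :
    piInf K T S a = toRInf K T S n (piN K T S n a) := by
  classical
  have hex : ∃ n, a ∈ An K T S n := Set.mem_iUnion.1 ha
  unfold piInf
  rw [dif_pos hex]
  have hk : a ∈ Dn K T S (Nat.find hex) := An_le_Dn _ (Nat.find_spec hex)
  rw [← toRInf_piN_of_le (le_max_left (Nat.find hex) n) hk,
    ← toRInf_piN_of_le (le_max_right (Nat.find hex) n) hn]

theorem piInf_eq_of_mem {n : ℕ} {a : CrossedProduct K T} (ha : a ∈ An K T S n) :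
    piInf K T S a = toRInf K T S n (piN K T S n a) :=
  piInf_eq (Set.mem_iUnion.2 ⟨n, ha⟩) (An_le_Dn n ha)

/-- `π_∞` on `𝒜_n`, as a ring homomorphism. -/
def piInfHom (K : Type*) [Field K] (T : X ≃ₜ X) (S : ApproxSystem X) (n : ℕ) :
    An K T S n →+* RInf K T S :=
  ((toRInf K T S n).comp (piNHom K T S n)).comp (Subalgebra.inclusion (An_le_Dn n)).toRingHom

theorem piInfHom_apply {n : ℕ} (a : An K T S n) : piInfHom K T S n a = piInf K T S a :=
  (piInf_eq_of_mem a.2).symm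

theorem exists_mem_An {a b : CrossedProduct K T} (ha : a ∈ AInf K T S) (hb : b ∈ AInf K T S) :
    ∃ n, a ∈ An K T S n ∧ b ∈ An K T S n := by
  obtain ⟨n, hn⟩ := Set.mem_iUnion.1 ha
  obtain ⟨m, hm⟩ := Set.mem_iUnion.1 hb
  exact ⟨max n m, An_mono (le_max_left _ _) hn, An_mono (le_max_right _ _) hm⟩

theorem piInf_mul {a b : CrossedProduct K T} (ha : a ∈ AInf K T S) (hb : b ∈ AInf K T S) :
    piInf K T S (a * b) = piInf K T S a * piInf K T S b := by
  obtain ⟨n, hn, hm⟩ := exists_mem_An ha hb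
  have := map_mul (piInfHom K T S n) ⟨a, hn⟩ ⟨b, hm⟩
  rw [piInfHom_apply, piInfHom_apply, piInfHom_apply] at this
  exact this

theorem piInf_add {a b : CrossedProduct K T} (ha : a ∈ AInf K T S) (hb : b ∈ AInf K T S) :
    piInf K T S (a + b) = piInf K T S a + piInf K T S b := by
  obtain ⟨n, hn, hm⟩ := exists_mem_An ha hb
  have := map_add (piInfHom K T S n) ⟨a, hn⟩ ⟨b, hm⟩
  rw [piInfHom_apply, piInfHom_apply, piInfHom_apply] at this
  exact this

theorem piInf_sub {a b : CrossedProduct K T} (ha : a ∈ AInf K T S) (hb : b ∈ AInf K T S) :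
    piInf K T S (a - b) = piInf K T S a - piInf K T S b := by
  obtain ⟨n, hn, hm⟩ := exists_mem_An ha hb
  have := map_sub (piInfHom K T S n) ⟨a, hn⟩ ⟨b, hm⟩
  rw [piInfHom_apply, piInfHom_apply, piInfHom_apply] at this
  exact this

theorem piInf_zero : piInf K T S 0 = 0 := by
  have := map_zero (piInfHom K T S 0)
  rwa [piInfHom_apply] at this

theorem piInf_one : piInf K T S 1 = 1 := by
  have := map_one (piInfHom K T S 0)
  rwa [piInfHom_apply] at this

theorem mul_mem_AInf {a b : CrossedProduct K T} (ha : a ∈ AInf K T S) (hb : b ∈ AInf K T S) :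
    a * b ∈ AInf K T S := by
  obtain ⟨n, hn, hm⟩ := exists_mem_An ha hb
  exact Set.mem_iUnion.2 ⟨n, Subalgebra.mul_mem _ hn hm⟩

/-- The matrix units lie in `𝒜_∞` and are mapped to matrix units. -/
theorem rel_eW {n : ℕ} [DecidableEq (S.V T n)] (W : S.V T n) (i j : Fin W.len) (c : K)
    (W' : S.V T n) :
    Rel W' (c • eW K W i j) ((Pi.single W (Matrix.single i j c) : Rn K T S n) W') := by
  unfold Rel
  rw [← iotaW_single, ← iotaW_one]
  by_cases h : W' = W
  · subst h
    rw [← map_mul, one_mul, Pi.single_eq_same]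
  · rw [iotaW_mul_iotaW_of_ne h, Pi.single_eq_of_ne h, map_zero]

theorem compl_mono_mem_An (n : ℕ) :
    mono T (LocallyConstant.charFn K (S.isClopen_E n).compl) 1 ∈ An K T S n :=
  mono_one_mem_An (constOn_compl_E n) fun _ hx => charFn_of_notMem _ fun h => h hx

theorem compl_mono_neg_mem_An (n : ℕ) :
    mono T (shift T (-1) (LocallyConstant.charFn K (S.isClopen_E n).compl)) (-1) ∈ An K T S n :=
  mono_neg_one_mem_An (constOn_compl_E n) fun _ hx => charFn_of_notMem _ fun h => h hx

theorem pow_mem_AInf {a : CrossedProduct K T} (ha : a ∈ AInf K T S) (i : ℕ) :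
    a ^ i ∈ AInf K T S := by
  obtain ⟨n, hn⟩ := Set.mem_iUnion.1 ha
  exact Set.mem_iUnion.2 ⟨n, Subalgebra.pow_mem _ hn _⟩

theorem eW_mem_AInf [CompactSpace X] {n : ℕ} (W : S.V T n) (i j : Fin W.len) :
    eW K W i j ∈ AInf K T S := by
  unfold eW
  refine mul_mem_AInf (mul_mem_AInf (pow_mem_AInf ?_ _) (incl_mem_AInf _)) (pow_mem_AInf ?_ _)
  · rw [chi_mul_tpow]
    exact Set.mem_iUnion.2 ⟨n, compl_mono_mem_An n⟩
  · rw [tpow_mul_chi]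
    exact Set.mem_iUnion.2 ⟨n, compl_mono_neg_mem_An n⟩

theorem smul_mem_AInf {a : CrossedProduct K T} (ha : a ∈ AInf K T S) (c : K) :
    c • a ∈ AInf K T S := by
  obtain ⟨n, hn⟩ := Set.mem_iUnion.1 ha
  exact Set.mem_iUnion.2 ⟨n, Subalgebra.smul_mem _ hn _⟩

theorem piInf_smul_eW [CompactSpace X] {n : ℕ} [DecidableEq (S.V T n)] (W : S.V T n)
    (i j : Fin W.len) (c : K) :
    piInf K T S (c • eW K W i j) = toRInf K T S n (Pi.single W (Matrix.single i j c)) := by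
  rw [piInf_eq (smul_mem_AInf (eW_mem_AInf W i j) c) (mem_Dn_of_rel (rel_eW W i j c)),
    piN_eq_of_rel (rel_eW W i j c)]

end Representation

/-! ### The rank function on `ℜ_∞` -/

section LimitRank

variable {K : Type*} [Field K] {X : Type*} [TopologicalSpace X] {T : X ≃ₜ X} {S : ApproxSystem X}

open ApproxSystem

/-- The levels of several copies of the tower over `W'`, sorted by the blocks `(W, j')`. -/
def placeProdEquiv {n : ℕ} (W' : S.V T (n + 1)) (ι : Type*) :
    (Σ b : S.Arrow T W', ι × Fin b.1.1.len) ≃ ι × Fin W'.len where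
  toFun s := (s.2.1, placeEquiv W' ⟨s.1, s.2.2⟩)
  invFun t := ⟨((placeEquiv W').symm t.2).1, (t.1, ((placeEquiv W').symm t.2).2)⟩
  left_inv s := by
    obtain ⟨b, i, k⟩ := s
    have h : ∀ p : Σ b : S.Arrow T W', Fin b.1.1.len, p = ⟨b, k⟩ →
        (⟨p.1, (i, p.2)⟩ : Σ b : S.Arrow T W', ι × Fin b.1.1.len) = ⟨b, i, k⟩ := by
      rintro _ rfl
      rfl
    exact h _ ((placeEquiv W').symm_apply_apply ⟨b, k⟩)
  right_inv t := by simp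

theorem flat_jn {n : ℕ} [∀ W' : S.V T (n + 1), DecidableEq (S.Arrow T W')] {ι κ : Type*}
    (M : Matrix ι κ (Rn K T S n)) (W' : S.V T (n + 1)) :
    (flat W' (M.map (jn K T S n))).submatrix (placeProdEquiv W' ι) (placeProdEquiv W' κ) =
      Matrix.blockDiagonal' fun b : S.Arrow T W' => flat b.1.1 M := by
  ext ⟨b, i, k⟩ ⟨b', j, l⟩
  by_cases h : b = b'
  · subst h
    rw [Matrix.blockDiagonal'_apply_eq]
    exact jn_place n (M i j) W' b k l
  · rw [Matrix.blockDiagonal'_apply_ne _ _ _ h]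
    exact jn_place_of_ne n (M i j) W' h k l

theorem rank_flat_jn {n p q : ℕ} [∀ W' : S.V T (n + 1), Fintype (S.Arrow T W')]
    (M : Matrix (Fin p) (Fin q) (Rn K T S n)) (W' : S.V T (n + 1)) :
    (flat W' (M.map (jn K T S n))).rank = ∑ b : S.Arrow T W', (flat b.1.1 M).rank := by
  classical
  rw [← rank_blockDiagonal', ← flat_jn]
  exact (Matrix.rank_submatrix _ _ _).symm

theorem toRInf_jle {n m : ℕ} (h : n ≤ m) (x : Rn K T S n) :
    toRInf K T S m (jle K T S h x) = toRInf K T S n x :=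
  DirectLimit.Ring.of_f (G := Rn K T S) (f := fun _ _ h => jle K T S h) h x

theorem map_toRInf_jle {n m p q : ℕ} (h : n ≤ m) (M : Matrix (Fin p) (Fin q) (Rn K T S n)) :
    (M.map (jle K T S h)).map (toRInf K T S m) = M.map (toRInf K T S n) := by
  ext i j
  exact toRInf_jle h (M i j)

theorem exists_toRInf (x : RInf K T S) : ∃ n x', toRInf K T S n x' = x := by
  obtain ⟨n, x', h⟩ := DirectLimit.exists_eq_mk _ x
  exact ⟨n, x', h.symm⟩

theorem exists_jle_eq {n m : ℕ} {x : Rn K T S n} {y : Rn K T S m}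
    (h : toRInf K T S n x = toRInf K T S m y) :
    ∃ k, ∃ (hn : n ≤ k) (hm : m ≤ k), jle K T S hn x = jle K T S hm y := by
  obtain ⟨k, hn, hm, e⟩ := Quotient.exact h
  exact ⟨k, hn, hm, e⟩

theorem exists_bound {α : Type*} [Finite α] (f : α → ℕ) : ∃ k, ∀ a, f a ≤ k := by
  obtain ⟨k, hk⟩ := (Set.finite_range f).bddAbove
  exact ⟨k, fun a => hk ⟨a, rfl⟩⟩

theorem exists_common_level {α : Type*} [Finite α] (x : α → RInf K T S) :
    ∃ k, ∀ n ≥ k, ∃ x' : α → Rn K T S n, ∀ a, toRInf K T S n (x' a) = x a := by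
  choose n x' hx using fun a => exists_toRInf (x a)
  obtain ⟨k, hk⟩ := exists_bound n
  exact ⟨k, fun m hm => ⟨fun a => jle K T S ((hk a).trans hm) (x' a), fun a => by
    rw [toRInf_jle, hx]⟩⟩

theorem exists_lift {p q : ℕ} (M : Matrix (Fin p) (Fin q) (RInf K T S)) :
    ∃ k, ∀ n ≥ k, ∃ M' : Matrix (Fin p) (Fin q) (Rn K T S n), M'.map (toRInf K T S n) = M := by
  obtain ⟨k, hk⟩ := exists_common_level fun a : Fin p × Fin q => M a.1 a.2
  refine ⟨k, fun n hn => ?_⟩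
  obtain ⟨x', hx⟩ := hk n hn
  exact ⟨Matrix.of fun i j => x' (i, j), by ext i j; exact hx (i, j)⟩

theorem jle_jle {n m k : ℕ} (h : n ≤ m) (h' : m ≤ k) (x : Rn K T S n) :
    jle K T S h' (jle K T S h x) = jle K T S (h.trans h') x :=
  DirectedSystem.map_map (f := fun _ _ h => ⇑(jle K T S h)) h h' x

theorem exists_map_jle_eq {n m p q : ℕ} {M : Matrix (Fin p) (Fin q) (Rn K T S n)}
    {N : Matrix (Fin p) (Fin q) (Rn K T S m)}
    (h : M.map (toRInf K T S n) = N.map (toRInf K T S m)) :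
    ∃ k, ∃ (hn : n ≤ k) (hm : m ≤ k), M.map (jle K T S hn) = N.map (jle K T S hm) := by
  choose k hn hm e using fun a : Fin p × Fin q => exists_jle_eq (congrFun (congrFun h a.1) a.2)
  obtain ⟨l, hl⟩ := exists_bound k
  refine ⟨max l (max n m), by omega, by omega, ?_⟩
  ext1 i j
  have := congrArg (jle K T S ((hl (i, j)).trans (le_max_left l (max n m)))) (e (i, j))
  rwa [jle_jle, jle_jle] at this

theorem exists_lift₂ {p q p' q' : ℕ} (M : Matrix (Fin p) (Fin q) (RInf K T S))
    (N : Matrix (Fin p') (Fin q') (RInf K T S)) :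
    ∃ n, ∃ (M' : Matrix (Fin p) (Fin q) (Rn K T S n)) (N' : Matrix (Fin p') (Fin q') (Rn K T S n)),
      M'.map (toRInf K T S n) = M ∧ N'.map (toRInf K T S n) = N := by
  obtain ⟨k, hk⟩ := exists_lift M
  obtain ⟨l, hl⟩ := exists_lift N
  obtain ⟨M', h⟩ := hk (max k l) (le_max_left _ _)
  obtain ⟨N', h'⟩ := hl (max k l) (le_max_right _ _)
  exact ⟨_, M', N', h, h'⟩

theorem charFn_compl {U : Set X} (hU : IsClopen U) :
    LocallyConstant.charFn K hU.compl = 1 - LocallyConstant.charFn K hU := by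
  refine LocallyConstant.ext fun x => ?_
  rw [LocallyConstant.sub_apply]
  by_cases h : x ∈ U
  · rw [charFn_of_mem _ h, charFn_of_notMem _ (Set.notMem_compl_iff.2 h)]; simp
  · rw [charFn_of_notMem _ h, charFn_of_mem _ h]; simp

theorem chi_compl {U : Set X} (hU : IsClopen U) : chi K T hU.compl = 1 - chi K T hU := by
  rw [chi_eq_mono, charFn_compl, mono_sub, mono_one_zero, chi_eq_mono]

theorem chi_mem_AInf [CompactSpace X] {U : Set X} (hU : IsClopen U) : chi K T hU ∈ AInf K T S :=
  incl_mem_AInf _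

theorem one_mem_AInf : (1 : CrossedProduct K T) ∈ AInf K T S :=
  Set.mem_iUnion.2 ⟨0, Subalgebra.one_mem _⟩

variable [MeasurableSpace X]

/-- The rank function of matrices over `ℜ_n`. -/
def levelRank (K : Type*) [Field K] (T : X ≃ₜ X) (S : ApproxSystem X) (μ : Measure X) (n : ℕ) :
    MatFun (Rn K T S n) := weightedRank K V.len fun W => μ.real W.set

theorem elt_levelRank (μ : Measure X) (n : ℕ) (x : Rn K T S n) :
    elt (levelRank K T S μ n) x = rkRn μ n x := by
  rw [levelRank, elt_weightedRank]
  refine tsum_congr fun W => ?_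
  have : (W.len : ℝ) ≠ 0 := by exact_mod_cast W.len_pos.ne'
  field_simp

open Classical in
/-- The rank function of matrices over `ℜ_∞`: the rank at a level at which all entries are
defined. -/
def limitRank (K : Type*) [Field K] (T : X ≃ₜ X) (S : ApproxSystem X) (μ : Measure X) :
    MatFun (RInf K T S) := fun p q M =>
  levelRank K T S μ (exists_lift M).choose p q
    ((exists_lift M).choose_spec _ le_rfl).choose

variable [BorelSpace X] {μ : Measure X} [IsProbabilityMeasure μ] [μ.IsOpenPosMeasure]

theorem isSylvesterRank_levelRank (hT : Ergodic T μ) (n : ℕ) :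
    IsSylvesterRank (levelRank K T S μ n) :=
  isSylvesterRank_weightedRank (fun _ => measureReal_nonneg) (hasSum_measure_mul_len hT n)

theorem levelRank_jn (hT : Ergodic T μ) {n p q : ℕ} (M : Matrix (Fin p) (Fin q) (Rn K T S n)) :
    levelRank K T S μ (n + 1) p q (M.map (jn K T S n)) = levelRank K T S μ n p q M := by
  have : ∀ W' : S.V T (n + 1), Fintype (S.Arrow T W') := fun _ => Fintype.ofFinite _
  unfold levelRank weightedRank
  rw [← tsum_arrow hT fun W => (flat W M).rank]
  exact tsum_congr fun W' => by rw [rank_flat_jn]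

theorem levelRank_jle (hT : Ergodic T μ) {n m p q : ℕ} (h : n ≤ m)
    (M : Matrix (Fin p) (Fin q) (Rn K T S n)) :
    levelRank K T S μ m p q (M.map (jle K T S h)) = levelRank K T S μ n p q M := by
  induction m, h using Nat.le_induction with
  | base => rw [jle_self]; congr 1
  | succ m hm ih =>
    rw [jle_succ K T S hm, ← ih, ← levelRank_jn hT (M.map (jle K T S hm))]
    rfl

/-- Independence of the lift chosen in `limitRank`: two lifts become equal at a later level, and `j`
preserves the level ranks. -/
theorem limitRank_map (hT : Ergodic T μ) {n p q : ℕ} (M : Matrix (Fin p) (Fin q) (Rn K T S n)) :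
    limitRank K T S μ p q (M.map (toRInf K T S n)) = levelRank K T S μ n p q M := by
  unfold limitRank
  set N := M.map (toRInf K T S n)
  obtain ⟨k, h₁, h₂, e⟩ := exists_map_jle_eq ((exists_lift N).choose_spec _ le_rfl).choose_spec
  rw [← levelRank_jle hT h₁, e, levelRank_jle hT h₂]

theorem elt_limitRank (hT : Ergodic T μ) {n : ℕ} (x : Rn K T S n) :
    elt (limitRank K T S μ) (toRInf K T S n x) = rkRn μ n x := by
  rw [← elt_levelRank]
  exact limitRank_map hT (Matrix.of fun _ _ => x : Matrix (Fin 1) (Fin 1) (Rn K T S n))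

theorem isSylvesterRank_limitRank (hT : Ergodic T μ) :
    IsSylvesterRank (limitRank K T S μ) where
  nonneg m n M := by
    obtain ⟨k, hk⟩ := exists_lift M
    obtain ⟨M, rfl⟩ := hk k le_rfl
    rw [limitRank_map hT]
    exact (isSylvesterRank_levelRank hT k).nonneg _ _ _
  zero m n := by
    rw [← Matrix.map_zero (toRInf K T S 0) (map_zero _), limitRank_map hT]
    exact (isSylvesterRank_levelRank hT 0).zero _ _
  one := by
    rw [← Matrix.map_one (toRInf K T S 0) (map_zero _) (map_one _), limitRank_map hT]
    exact (isSylvesterRank_levelRank hT 0).one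
  mul_le_left l m n M N := by
    obtain ⟨k, M, N, rfl, rfl⟩ := exists_lift₂ M N
    rw [← Matrix.map_mul, limitRank_map hT, limitRank_map hT]
    exact (isSylvesterRank_levelRank hT k).mul_le_left _ _ _ _ _
  mul_le_right l m n M N := by
    obtain ⟨k, M, N, rfl, rfl⟩ := exists_lift₂ M N
    rw [← Matrix.map_mul, limitRank_map hT, limitRank_map hT]
    exact (isSylvesterRank_levelRank hT k).mul_le_right _ _ _ _ _
  diag m₁ n₁ m₂ n₂ M N := by
    obtain ⟨k, M, N, rfl, rfl⟩ := exists_lift₂ M N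
    rw [← block_map_diag, limitRank_map hT, limitRank_map hT, limitRank_map hT]
    exact (isSylvesterRank_levelRank hT k).diag _ _ _ _ _ _
  triangular m₁ n₁ m₂ n₂ M N L := by
    obtain ⟨k, M, N, rfl, rfl⟩ := exists_lift₂ M N
    obtain ⟨l, hl⟩ := exists_lift L
    obtain ⟨L, rfl⟩ := hl (max k l) (le_max_right _ _)
    have hk := le_max_left k l
    rw [← map_toRInf_jle hk M, ← map_toRInf_jle hk N, ← block_map_zero, limitRank_map hT,
      limitRank_map hT, limitRank_map hT]
    exact (isSylvesterRank_levelRank hT _).triangular _ _ _ _ _ _ _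

theorem measureReal_pos_of_isClopen {X : Type*} [TopologicalSpace X] [MeasurableSpace X]
    (μ : Measure X) [IsProbabilityMeasure μ] [μ.IsOpenPosMeasure] {U : Set X} (hU : IsClopen U)
    (h : U.Nonempty) : 0 < μ.real U :=
  ENNReal.toReal_pos (hU.isOpen.measure_ne_zero μ h) (measure_ne_top μ U)

theorem eq_zero_of_rank_eq_zero {ι κ : Type*} [Fintype ι] [Fintype κ] {M : Matrix ι κ K}
    (h : M.rank = 0) : M = 0 := by
  classical
  obtain ⟨r, A, B, -, -, hr, rfl, -⟩ := exists_rank_factorization M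
  obtain rfl : r = 0 := hr.symm.trans h
  ext i j
  simp [Matrix.mul_apply]

theorem isFaithful_limitRank (hT : Ergodic T μ) : IsFaithful (limitRank K T S μ) := by
  refine Set.eq_singleton_iff_unique_mem.2
    ⟨elt_zero (isSylvesterRank_limitRank hT), fun x hx => ?_⟩
  obtain ⟨n, x, rfl⟩ := exists_toRInf x
  have h0 : elt (limitRank K T S μ) (toRInf K T S n x) = 0 := hx
  rw [elt_limitRank hT, ← elt_levelRank, levelRank, elt_weightedRank] at h0
  have hs : Summable fun W : S.V T n => μ.real W.set * (x W).rank := by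
    refine Summable.of_nonneg_of_le (fun W => by positivity) (fun W => ?_)
      (hasSum_measure_mul_len hT n).summable
    have := (x W).rank_le_card_height
    rw [Fintype.card_fin] at this
    gcongr
  have hz := (hs.hasSum_iff.2 h0)
  rw [hasSum_zero_iff_of_nonneg fun W => by positivity] at hz
  have hx0 : x = 0 := by
    funext W
    have h := congrFun hz W
    have hr : (x W).rank = 0 := by
      rcases mul_eq_zero.1 h with h | h
      · exact absurd h (measureReal_pos_of_isClopen μ W.isClopen W.set_nonempty).ne'
      · exact_mod_cast h
    exact eq_zero_of_rank_eq_zero hr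
  rw [hx0, map_zero]

/-- At a level where `χ_U` is constant on atoms, its image is diagonal with a `1` for each tower
level inside `U`. These levels are disjoint, so the weighted count is at most `μ(U)`. -/
theorem elt_limitRank_chi_le (hT : Ergodic T μ) [CompactSpace X] {U : Set X}
    (hU : IsClopen U) : elt (limitRank K T S μ) (piInf K T S (chi K T hU)) ≤ μ.real U := by
  classical
  obtain ⟨n, hn⟩ := exists_constOn S (LocallyConstant.charFn K hU)
  have hf := hn n le_rfl
  choose w hw using fun W : S.V T n => W.set_nonempty
  have hmem : ∀ (W : S.V T n) (l : Fin W.len), T^[l] (w W) ∈ U → (T ^ l.1) '' W.set ⊆ U := by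
    rintro W l hl _ ⟨w', hw', rfl⟩
    rw [pow_apply]
    by_contra h
    have := hf.iterate_eq W l.2.le (hw W) hw'
    rw [charFn_of_mem _ hl, charFn_of_notMem _ h] at this
    exact one_ne_zero this
  have hrel : ∀ W : S.V T n, Rel W (chi K T hU) (Matrix.diagonal fun l : Fin W.len =>
      LocallyConstant.charFn K hU (T^[l] (w W))) := fun W => by
    have := rel_mono W (f := LocallyConstant.charFn K hU) (m := 0)
      (F := fun l => LocallyConstant.charFn K hU (T^[l] (w W)))
      (fun l w' hw' => hf.iterate_eq W l.2.le hw' (hw W)) fun l _ => by have := l.2; omega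
    rw [chi_eq_mono]
    convert this using 1
    ext i j
    by_cases h : i = j
    · simp [h]
    · have : ¬ (i : ℤ) = j + 0 := fun e => h (Fin.ext (by omega))
      rw [Matrix.diagonal_apply_ne _ h, Matrix.of_apply, if_neg this]
  rw [chi_eq_mono, piInf_eq_of_mem (mono_zero_mem_An hf), ← chi_eq_mono, piN_eq_of_rel hrel, elt_limitRank hT,
    ← elt_levelRank, levelRank, elt_weightedRank]
  refine Real.tsum_le_of_sum_le (fun W => by positivity) fun F => ?_
  have hr : ∀ W : S.V T n, μ.real W.set * (Matrix.diagonal fun l : Fin W.len =>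
      LocallyConstant.charFn K hU (T^[l] (w W))).rank =
      ∑ l ∈ Finset.univ.filter (fun l : Fin W.len => T^[l] (w W) ∈ U),
        μ.real ((T ^ l.1) '' W.set) := by
    intro W
    have hm : ∀ l : ℕ, μ.real ((T ^ l) '' W.set) = μ.real W.set := fun l =>
      congrArg ENNReal.toReal (measure_image_pow hT.toMeasurePreserving l W.measurableSet)
    rw [Matrix.rank_diagonal, Fintype.card_subtype, Finset.sum_congr rfl fun l _ => hm l.1,
      Finset.sum_const, nsmul_eq_mul, mul_comm]
    congr 2
    congr 1
    ext l
    by_cases h : T^[l] (w W) ∈ U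
    · simp [h, charFn_of_mem]
    · simp [h, charFn_of_notMem]
  rw [Finset.sum_congr rfl fun W _ => hr W,
    ← Finset.sum_sigma F _ fun p : Σ W : S.V T n, Fin W.len => μ.real ((T ^ p.2.1) '' p.1.set),
    ← measureReal_biUnion_finset]
  · refine measureReal_mono (Set.iUnion₂_subset fun p hp => ?_)
    simp only [Finset.mem_sigma, Finset.mem_filter] at hp
    exact hmem p.1 p.2 hp.2.2
  · rintro ⟨W, l⟩ _ ⟨W', l'⟩ _ hne
    refine Set.disjoint_left.2 fun x hx hx' => hne ?_
    obtain ⟨v, hv, rfl⟩ := mem_image_pow.1 hx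
    obtain ⟨v', hv', e⟩ := mem_image_pow.1 hx'
    obtain ⟨rfl, h⟩ := V.level_eq l'.2 l.2 hv' hv e
    rw [Fin.ext h]
  · exact fun p _ => (p.1.isClopen_image _).isOpen.measurableSet

/-- The upper bounds for `U` and its complement add up to `1`, while the ranks of `χ_U` and `1 -
χ_U` add up to at least `1`; so both bounds are equalities. -/
theorem elt_limitRank_chi (hT : Ergodic T μ) [CompactSpace X] {U : Set X} (hU : IsClopen U) :
    elt (limitRank K T S μ) (piInf K T S (chi K T hU)) = μ.real U := by
  refine le_antisymm (elt_limitRank_chi_le hT hU) ?_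
  have h1 := elt_limitRank_chi_le (K := K) (S := S) hT hU.compl
  have h2 := isSylvesterRank_limitRank (K := K) (S := S) hT
  rw [chi_compl hU, piInf_sub one_mem_AInf (chi_mem_AInf hU), piInf_one,
    measureReal_compl hU.isOpen.measurableSet, probReal_univ] at h1
  have h3 := elt_add_le h2 (1 - piInf K T S (chi K T hU)) (piInf K T S (chi K T hU))
  rw [sub_add_cancel, elt_one h2] at h3
  linarith

end LimitRank

/-! ### Uniqueness of the rank functions, and faithfulness -/

section Uniqueness

variable {K : Type*} [Field K] {X : Type*} [TopologicalSpace X] {T : X ≃ₜ X} {S : ApproxSystem X}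

open ApproxSystem

/-- The embedding of a finite product of matrix algebras into `𝒜`, through the matrix units
`e_{ij}(W)`. -/
def towerHom (K : Type*) [Field K] {n : ℕ} (F : Finset (S.V T n)) :
    ((W : F) → Matrix (Fin W.1.len) (Fin W.1.len) K) →ₙ+* CrossedProduct K T where
  toFun x := ∑ W : F, iotaW K W.1 (x W)
  map_zero' := by simp
  map_add' x y := by simp [Finset.sum_add_distrib]
  map_mul' x y := by
    rw [Finset.sum_mul]
    refine Finset.sum_congr rfl fun W _ => ?_
    rw [Finset.mul_sum, Finset.sum_eq_single W]
    · exact map_mul _ _ _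
    · exact fun W' _ hne => iotaW_mul_iotaW_of_ne (fun h => hne (Subtype.ext h.symm)) _ _
    · simp

theorem towerHom_apply {n : ℕ} (F : Finset (S.V T n))
    (x : (W : F) → Matrix (Fin W.1.len) (Fin W.1.len) K) :
    towerHom K F x = ∑ W : F, iotaW K W.1 (x W) := rfl

theorem towerHom_single {n : ℕ} (F : Finset (S.V T n)) [DecidableEq F] (W : F)
    (c : Matrix (Fin W.1.len) (Fin W.1.len) K) :
    towerHom K F (Pi.single W c) = iotaW K W.1 c := by
  rw [towerHom_apply, Finset.sum_eq_single W]
  · rw [Pi.single_eq_same]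
  · intro W' _ h
    rw [Pi.single_eq_of_ne h, map_zero]
  · simp

/-- The base of a tower, as an element of `Fin W.len`. -/
def baseLevel {n : ℕ} (W : S.V T n) : Fin W.len := ⟨0, W.len_pos⟩

theorem eW_self {n : ℕ} (W : S.V T n) (l : Fin W.len) :
    eW K W l l = chi K T (W.isClopen_image l) := by
  rw [eW_eq, sub_self]
  rfl

theorem towerHom_unitAt {n : ℕ} (F : Finset (S.V T n)) [DecidableEq F] (W : F) :
    towerHom K F (unitAt K (fun W : F => baseLevel W.1) W) =
      chi K T (W.1.isClopen_image (baseLevel W.1)) := by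
  rw [unitAt, towerHom_single, iotaW_single, one_smul, eW_self]

theorem smul_eW_mem_srange {n : ℕ} {F : Finset (S.V T n)} {W : S.V T n} (hW : W ∈ F)
    (i j : Fin W.len) (c : K) : c • eW K W i j ∈ NonUnitalRingHom.srange (towerHom K F) := by
  classical
  exact ⟨Pi.single ⟨W, hW⟩ (Matrix.single i j c), by rw [towerHom_single, iotaW_single]⟩

/-- The levels of the towers over the members of `F` that are at distance at least `D` from the
top and the bottom. -/
def midLevels {n : ℕ} (F : Finset (S.V T n)) (D : ℕ) : Finset (Σ W : S.V T n, Fin W.len) :=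
  F.sigma fun W => Finset.univ.filter fun j : Fin W.len => D ≤ j.1 ∧ j.1 + D < W.len

theorem card_midLevel (k D : ℕ) :
    k ≤ (Finset.univ.filter fun j : Fin k => D ≤ j.1 ∧ j.1 + D < k).card + 2 * D := by
  rw [← Finset.card_map Fin.valEmbedding]
  have : (Finset.univ.filter fun j : Fin k => D ≤ j.1 ∧ j.1 + D < k).map Fin.valEmbedding =
      Finset.Ico D (k - D) := by
    ext a
    simp only [Finset.mem_map, Finset.mem_filter, Finset.mem_univ, true_and, Finset.mem_Ico,
      Fin.valEmbedding_apply]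
    constructor
    · rintro ⟨j, h, rfl⟩
      omega
    · intro h
      exact ⟨⟨a, by omega⟩, by simp only; omega, rfl⟩
  rw [this, Nat.card_Ico]
  omega

/-- The characteristic function of the union of the levels in `P`. -/
def levelFn (K : Type*) [Field K] {n : ℕ} (P : Finset (Σ W : S.V T n, Fin W.len)) :
    LocallyConstant X K := ∑ p ∈ P, lv K p.1 p.2

theorem mono_levelFn {n : ℕ} (P : Finset (Σ W : S.V T n, Fin W.len)) :
    mono T (levelFn K P) 0 = ∑ p ∈ P, eW K p.1 p.2 p.2 := by
  rw [levelFn, mono_sum]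
  exact Finset.sum_congr rfl fun p _ => by rw [eW_eq, sub_self]

theorem eW_orthogonal {n : ℕ} {p q : Σ W : S.V T n, Fin W.len} (h : p ≠ q) :
    eW K p.1 p.2 p.2 * eW K q.1 q.2 q.2 = 0 := by
  obtain ⟨W, i⟩ := p
  obtain ⟨W', j⟩ := q
  by_cases hW : W = W'
  · subst hW
    exact eW_mul_eW_of_ne W _ _ _ _ fun h' => h (congrArg (Sigma.mk W) h')
  · exact eW_mul_eW_of_ne' _ _ _ _ hW

/-- For `f t^m`, the bound `D = |m|` keeps the shift of a middle level inside its tower, and a large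
`n` makes `f` constant on levels. The product is then a combination of matrix units. -/
theorem exists_mul_mem_srange [CompactSpace X] (a : CrossedProduct K T) :
    ∃ D k, ∀ n ≥ k, ∀ D' ≥ D, ∀ F : Finset (S.V T n),
      a * mono T (levelFn K (midLevels F D')) 0 ∈ NonUnitalRingHom.srange (towerHom K F) := by
  induction a using mono_induction with
  | h0 => exact ⟨0, 0, fun n _ D' _ F => by rw [zero_mul]; exact zero_mem _⟩
  | hadd a b ha hb =>
    obtain ⟨D₁, k₁, h₁⟩ := ha
    obtain ⟨D₂, k₂, h₂⟩ := hb
    refine ⟨max D₁ D₂, max k₁ k₂, fun n hn D' hD F => ?_⟩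
    rw [add_mul]
    exact add_mem (h₁ n (by omega) D' (by omega) F) (h₂ n (by omega) D' (by omega) F)
  | hm f m =>
    obtain ⟨k, hk⟩ := exists_constOn S f
    refine ⟨m.natAbs, k, fun n hn D' hD F => ?_⟩
    rw [mono_levelFn, Finset.mul_sum]
    refine sum_mem fun p hp => ?_
    obtain ⟨W, j⟩ := p
    simp only [midLevels, Finset.mem_sigma, Finset.mem_filter] at hp
    obtain ⟨hW, -, h1, h2⟩ := hp
    obtain ⟨w, hw⟩ := W.set_nonempty
    obtain ⟨i, hi⟩ : ∃ i : Fin W.len, (i : ℤ) = j + m :=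
      ⟨⟨((j : ℤ) + m).toNat, by omega⟩, by simp only; omega⟩
    rw [mono_mul_eW W hi fun w' hw' => (hk n hn).iterate_eq W i.2.le hw' hw]
    exact smul_eW_mem_srange hW _ _ _

theorem elt_one_sub_sum {R α : Type*} [Ring R] {N : MatFun R} (h : IsSylvesterRank N)
    (s : Finset α) (e : α → R) (he : ∀ i ∈ s, e i * e i = e i)
    (hef : ∀ i ∈ s, ∀ j ∈ s, i ≠ j → e i * e j = 0) :
    elt N (1 - ∑ i ∈ s, e i) = 1 - ∑ i ∈ s, elt N (e i) := by
  rw [elt_one_sub h, elt_sum_of_orthogonal h s e he hef]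
  rw [Finset.sum_mul]
  refine Finset.sum_congr rfl fun i hi => ?_
  rw [Finset.mul_sum, Finset.sum_eq_single i]
  · exact he i hi
  · exact fun j hj hne => hef i hi j hj hne.symm
  · exact fun h => absurd hi h

theorem cf_mul_mono_zero (a : CrossedProduct K T) (g : LocallyConstant X K) (i : ℤ) :
    cf i (a * mono T g 0) = cf i a * shift T i g := by
  induction a using mono_induction with
  | h0 => simp
  | hadd a b ha hb => rw [add_mul, map_add, map_add, ha, hb, add_mul]
  | hm f m =>
    rw [mono_mul_mono, cf_mono, cf_mono, add_zero]
    by_cases h : m = i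
    · simp [h]
    · simp [h]

/-- The extension by zero of a family of matrices. -/
def extendZero (K : Type*) [Field K] {n : ℕ} [DecidableEq (S.V T n)] (F : Finset (S.V T n)) :
    ((W : F) → Matrix (Fin W.1.len) (Fin W.1.len) K) →ₙ+* Rn K T S n where
  toFun x W := if h : W ∈ F then x ⟨W, h⟩ else 0
  map_zero' := by ext1 W; by_cases h : W ∈ F <;> simp [h]
  map_add' x y := by ext1 W; by_cases h : W ∈ F <;> simp [h]
  map_mul' x y := by ext1 W; by_cases h : W ∈ F <;> simp [h]

theorem extendZero_of_mem {n : ℕ} [DecidableEq (S.V T n)] {F : Finset (S.V T n)}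
    (x : (W : F) → Matrix (Fin W.1.len) (Fin W.1.len) K) {W : S.V T n} (h : W ∈ F) :
    extendZero K F x W = x ⟨W, h⟩ := dif_pos h

theorem extendZero_of_notMem {n : ℕ} [DecidableEq (S.V T n)] {F : Finset (S.V T n)}
    (x : (W : F) → Matrix (Fin W.1.len) (Fin W.1.len) K) {W : S.V T n} (h : W ∉ F) :
    extendZero K F x W = 0 := dif_neg h

theorem extendZero_unitAt {n : ℕ} [DecidableEq (S.V T n)] (F : Finset (S.V T n)) (W : F) :
    extendZero K F (unitAt K (fun W : F => baseLevel W.1) W) =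
      Pi.single W.1 (Matrix.single (baseLevel W.1) (baseLevel W.1) 1) := by
  funext W'
  by_cases h : W' = W.1
  · obtain rfl := h
    rw [extendZero_of_mem _ W.2, unitAt, Pi.single_eq_same, Pi.single_eq_same]
  · rw [Pi.single_eq_of_ne h]
    by_cases hF : W' ∈ F
    · have : (⟨W', hF⟩ : F) ≠ W := fun e => h (congrArg Subtype.val e)
      rw [extendZero_of_mem _ hF, unitAt, Pi.single_eq_of_ne this]
    · rw [extendZero_of_notMem _ hF]

theorem piInf_chi_level [CompactSpace X] {n : ℕ} [DecidableEq (S.V T n)] (W : S.V T n)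
    (l : Fin W.len) : piInf K T S (chi K T (W.isClopen_image l)) =
      toRInf K T S n (Pi.single W (Matrix.single l l 1)) := by
  rw [← eW_self, ← piInf_smul_eW, one_smul]

variable [MeasurableSpace X] [BorelSpace X] {μ : Measure X}

theorem measureReal_level (hT : Ergodic T μ) {n : ℕ} (W : S.V T n) (l : ℕ) :
    μ.real ((T ^ l) '' W.set) = μ.real W.set :=
  congrArg ENNReal.toReal (measure_image_pow hT.toMeasurePreserving l W.measurableSet)

/-- The value of `1 - χ` for the union of the levels in `P`. -/
theorem elt_one_sub_levelFn (hT : Ergodic T μ) {N : MatFun (CrossedProduct K T)}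
    (h : IsSylvesterRank N) (hN : ∀ (U : Set X) (hU : IsClopen U), elt N (chi K T hU) = μ.real U)
    {n : ℕ} (P : Finset (Σ W : S.V T n, Fin W.len)) :
    elt N (1 - mono T (levelFn K P) 0) = 1 - ∑ p ∈ P, μ.real p.1.set := by
  rw [mono_levelFn, elt_one_sub_sum h _ _ (fun p _ => eW_mul_eW _ _ _ _)
    fun p _ q _ hpq => eW_orthogonal hpq]
  congr 1
  refine Finset.sum_congr rfl fun p _ => ?_
  rw [eW_self, hN, measureReal_level hT]

variable [IsProbabilityMeasure μ] [μ.IsOpenPosMeasure]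

theorem exists_finset_measure (hT : Ergodic T μ) (n : ℕ) {ε : ℝ} (hε : 0 < ε) :
    ∃ F : Finset (S.V T n), 1 - ε < ∑ W ∈ F, μ.real W.set * W.len := by
  have h := (hasSum_measure_mul_len (S := S) hT n).eventually (lt_mem_nhds (sub_lt_self 1 hε))
  exact h.exists

/-- Two losses, each below `ε / 2`: the towers outside `F`, and the at most `2 * D` levels removed
from each tower in `F`. The latter cost at most `2 * D * μ(E_n)`, so `n` must be chosen before `F`.
-/
theorem exists_midLevels (hT : Ergodic T μ) [T2Space X] [Infinite X] (D k : ℕ) {ε : ℝ}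
    (hε : 0 < ε) : ∃ n ≥ k, ∃ F : Finset (S.V T n),
      1 - ∑ p ∈ midLevels F D, μ.real p.1.set < ε := by
  have hlim : Tendsto (fun n => 2 * D * μ.real (S.E n)) atTop (𝓝 0) := by
    simpa using (tendsto_measure_E (S := S) hT).const_mul (2 * D : ℝ)
  obtain ⟨n, hn, hk⟩ := ((hlim.eventually (gt_mem_nhds (half_pos hε))).and
    (eventually_ge_atTop k)).exists
  obtain ⟨F, hF⟩ := exists_finset_measure (S := S) hT n (half_pos hε)
  refine ⟨n, hk, F, ?_⟩
  have h1 : ∑ W ∈ F, μ.real W.set * W.len ≤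
      ∑ p ∈ midLevels F D, μ.real p.1.set + 2 * D * ∑ W ∈ F, μ.real W.set := by
    rw [midLevels, Finset.sum_sigma F _ fun p : Σ W : S.V T n, Fin W.len => μ.real p.1.set,
      Finset.mul_sum, ← Finset.sum_add_distrib]
    refine Finset.sum_le_sum fun W _ => ?_
    dsimp only
    rw [Finset.sum_const, nsmul_eq_mul]
    have : (W.len : ℝ) ≤ (Finset.univ.filter fun j : Fin W.len =>
        D ≤ j.1 ∧ j.1 + D < W.len).card + 2 * D := by exact_mod_cast card_midLevel W.len D
    nlinarith [measureReal_nonneg (μ := μ) (s := W.set)]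
  have h2 : 2 * D * ∑ W ∈ F, μ.real W.set ≤ 2 * D * μ.real (S.E n) := by
    gcongr
    exact sum_measure_le n F
  linarith

theorem exists_towerHom_approx (hT : Ergodic T μ) [CompactSpace X] [T2Space X] [Infinite X]
    (S : ApproxSystem X) (s : Finset (CrossedProduct K T)) {ε : ℝ} (hε : 0 < ε) :
    ∃ n, ∃ (F : Finset (S.V T n)) (P : Finset (Σ W : S.V T n, Fin W.len)),
      1 - ∑ p ∈ P, μ.real p.1.set < ε ∧
      ∀ a ∈ s, ∃ y, a * mono T (levelFn K P) 0 = towerHom K F y := by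
  choose D k h using fun a : CrossedProduct K T => exists_mul_mem_srange (S := S) a
  obtain ⟨n, hn, F, hF⟩ := exists_midLevels (S := S) hT (s.sup D) (s.sup k) hε
  refine ⟨n, F, midLevels F (s.sup D), hF, fun a ha => ?_⟩
  obtain ⟨y, hy⟩ := h a n ((Finset.le_sup ha).trans hn) _ (Finset.le_sup ha) F
  exact ⟨y, hy.symm⟩

/-- If `χ` is the characteristic function of the levels in `P`, then `a χ` lies in the matrix
algebras and the error `a (1 - χ)` has rank at most that of `1 - χ`. That rank depends only on the
prescribed values. -/
theorem eq_of_elt_chi (hT : Ergodic T μ) [CompactSpace X] [T2Space X] [Infinite X]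
    (S : ApproxSystem X) {N₁ N₂ : MatFun (CrossedProduct K T)} (h₁ : IsSylvesterRank N₁)
    (h₂ : IsSylvesterRank N₂)
    (e₁ : ∀ (U : Set X) (hU : IsClopen U), elt N₁ (chi K T hU) = μ.real U)
    (e₂ : ∀ (U : Set X) (hU : IsClopen U), elt N₂ (chi K T hU) = μ.real U) : N₁ = N₂ := by
  classical
  refine eq_of_approx (K := K) h₁ h₂ fun s ε hε => ?_
  obtain ⟨n, F, P, hP, hs⟩ := exists_towerHom_approx hT S s hε
  refine ⟨F, inferInstance, inferInstance, fun W => W.1.len, fun W => baseLevel W.1,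
    towerHom K F, fun W => ?_, fun a ha => ?_⟩
  · rw [towerHom_unitAt, e₁, e₂]
  · obtain ⟨y, hy⟩ := hs a ha
    have hsub : a - towerHom K F y = a * (1 - mono T (levelFn K P) 0) := by
      rw [mul_sub, mul_one, hy]
    refine ⟨y, ?_⟩
    rw [hsub]
    exact ⟨(elt_mul_le_right h₁ _ _).trans ((elt_one_sub_levelFn hT h₁ e₁ P).trans_lt hP).le,
      (elt_mul_le_right h₂ _ _).trans ((elt_one_sub_levelFn hT h₂ e₂ P).trans_lt hP).le⟩

theorem isFaithful_of_elt_chi (hT : Ergodic T μ) [CompactSpace X] [T2Space X] [Infinite X]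
    (S : ApproxSystem X) {N : MatFun (CrossedProduct K T)} (h : IsSylvesterRank N)
    (e : ∀ (U : Set X) (hU : IsClopen U), elt N (chi K T hU) = μ.real U) : IsFaithful N := by
  classical
  refine Set.eq_singleton_iff_unique_mem.2 ⟨elt_zero h, fun a (ha : elt N a = 0) => ?_⟩
  refine eq_of_cf_eq fun m => LocallyConstant.ext fun x => ?_
  rw [map_zero]
  by_contra hx
  -- `V` is the support of the `m`-th coefficient of `a`, moved back by `T^m`. The coefficient of `a
  -- χ` at `T^m z` is `cf m a (T^m z) * χ z`, so `a χ = 0` forces `χ` to vanish on `V`. Taking `χ`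
  -- to miss measure less than `μ(V)` gives a contradiction.
  let V : Set X := {z | shift T (-m) (cf m a) z ≠ 0}
  have hV : IsClopen V :=
    (shift T (-m) (cf m a)).isLocallyConstant.isClopen_fiber 0 |>.compl
  have hVne : V.Nonempty := ⟨(T ^ (-m)) x, by
    change cf m a ((T ^ (- -m)) ((T ^ (-m)) x)) ≠ 0
    rw [← Homeomorph.mul_apply, ← zpow_add, neg_neg, add_neg_cancel, zpow_zero]
    exact hx⟩
  have hpos := measureReal_pos_of_isClopen μ hV hVne
  obtain ⟨n, F, P, hP, hs⟩ := exists_towerHom_approx hT S {a} hpos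
  obtain ⟨y, hy⟩ := hs a (Finset.mem_singleton_self a)
  have hy0 : elt N (towerHom K F y) = 0 :=
    le_antisymm (by rw [← hy, ← ha]; exact elt_mul_le_left h _ _) (elt_nonneg h _)
  -- The rank of the image of `y` is the sum of the ranks of its components with weights `μ(W) > 0`.
  have hyz : y = 0 := by
    have h1 := rank_map_eq_sum h (fun W : F => baseLevel W.1) (towerHom K F)
      (Matrix.of fun _ _ => y : Matrix (Fin 1) (Fin 1) _)
    have h2 := h1.symm.trans hy0
    rw [Finset.sum_eq_zero_iff_of_nonneg fun W _ =>
      mul_nonneg (Nat.cast_nonneg _) (elt_nonneg h _)] at h2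
    funext W
    have h3 := h2 W (Finset.mem_univ _)
    rw [towerHom_unitAt, e, measureReal_level hT] at h3
    have h4 : (flat W (Matrix.of fun _ _ => y : Matrix (Fin 1) (Fin 1) _)).rank = 0 := by
      rcases mul_eq_zero.1 h3 with h3 | h3
      · exact_mod_cast h3
      · exact absurd h3 (measureReal_pos_of_isClopen μ W.1.isClopen W.1.set_nonempty).ne'
    have h5 := eq_zero_of_rank_eq_zero h4
    ext i j
    exact congrFun (congrFun h5 (0, i)) (0, j)
  rw [hyz, map_zero] at hy
  have hc : cf m a * shift T m (levelFn K P) = 0 := by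
    rw [← cf_mul_mono_zero, hy, map_zero]
  have hVz : chi K T hV * mono T (levelFn K P) 0 = 0 := by
    rw [chi_eq_mono, mono_zero_mul, ← mono_zero (T := T) (K := K) 0]
    congr 1
    refine LocallyConstant.ext fun z => ?_
    rw [LocallyConstant.mul_apply]
    by_cases hz : z ∈ V
    · have h1 := congrArg (fun f : LocallyConstant X K => f ((T ^ m) z)) hc
      have h2 : (T ^ (-m)) ((T ^ m) z) = z := by
        rw [← Homeomorph.mul_apply, ← zpow_add, neg_add_cancel, zpow_zero]
        rfl
      have h3 : cf m a ((T ^ m) z) ≠ 0 := by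
        have : shift T (-m) (cf m a) z ≠ 0 := hz
        rwa [shift_apply, neg_neg] at this
      simp only [LocallyConstant.mul_apply, shift_apply, h2] at h1
      rcases mul_eq_zero.1 h1 with h1 | h1
      · exact absurd h1 h3
      · rw [h1, mul_zero]; rfl
    · rw [charFn_of_notMem _ hz, zero_mul]; rfl
  have h1 : elt N (chi K T hV) ≤ elt N (1 - mono T (levelFn K P) 0) := by
    have : chi K T hV = chi K T hV * (1 - mono T (levelFn K P) 0) := by
      rw [mul_sub, hVz, mul_one, sub_zero]
    rw [this]
    exact elt_mul_le_right h _ _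
  rw [e, elt_one_sub_levelFn hT h e] at h1
  linarith

/-- Finitely many elements of `ℜ_∞` come from one `ℜ_n`, so no levels need to be cut from the
towers. Truncation to `F` changes `x` by `(1 - p) x`, where `p` is the image of the unit of the
factors in `F` and `1 - p` has rank at most `ε`. -/
theorem eq_of_elt_piInf_chi (hT : Ergodic T μ) [CompactSpace X] {N₁ N₂ : MatFun (RInf K T S)}
    (h₁ : IsSylvesterRank N₁) (h₂ : IsSylvesterRank N₂)
    (e₁ : ∀ (U : Set X) (hU : IsClopen U), elt N₁ (piInf K T S (chi K T hU)) = μ.real U)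
    (e₂ : ∀ (U : Set X) (hU : IsClopen U), elt N₂ (piInf K T S (chi K T hU)) = μ.real U) :
    N₁ = N₂ := by
  classical
  refine eq_of_approx (K := K) h₁ h₂ fun s ε hε => ?_
  obtain ⟨n, hn⟩ := exists_common_level fun x : s => x.1
  obtain ⟨x', hx'⟩ := hn n le_rfl
  obtain ⟨F, hF⟩ := exists_finset_measure (S := S) hT n hε
  let u : (Σ W : S.V T n, Fin W.len) → Rn K T S n := fun p =>
    Pi.single p.1 (Matrix.single p.2 p.2 1)
  let P : Finset (Σ W : S.V T n, Fin W.len) := F.sigma fun _ => Finset.univ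
  have hu : ∀ p q, p ≠ q → u p * u q = 0 := by
    rintro ⟨W, i⟩ ⟨W', j⟩ h
    by_cases hW : W = W'
    · subst hW
      have : i ≠ j := fun e => h (by rw [e])
      change (Pi.single W _ : Rn K T S n) * Pi.single W _ = _
      rw [← Pi.single_mul, Matrix.single_mul_single_of_ne _ _ _ _ this, Pi.single_zero]
    · funext V
      change (Pi.single W _ : Rn K T S n) V * (Pi.single W' _ : Rn K T S n) V = 0
      by_cases hV : V = W
      · have : V ≠ W' := fun e => hW (hV.symm.trans e)
        rw [Pi.single_eq_of_ne this, mul_zero]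
      · rw [Pi.single_eq_of_ne hV, zero_mul]
  have hu' : ∀ p, u p * u p = u p := fun p => by
    change (Pi.single p.1 _ : Rn K T S n) * Pi.single p.1 _ = _
    rw [← Pi.single_mul, Matrix.single_mul_single_same, one_mul]
  have hsum : ∑ p ∈ P, u p = extendZero K F 1 := by
    rw [Finset.sum_sigma]
    have : ∀ W : S.V T n, ∑ i : Fin W.len, u ⟨W, i⟩ = Pi.single W 1 := fun W => by
      rw [← Matrix.sum_single_one, pi_single_sum]
    rw [Finset.sum_congr rfl fun W _ => this W]
    funext V
    rw [Finset.sum_apply]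
    by_cases hV : V ∈ F
    · rw [Finset.sum_eq_single V, Pi.single_eq_same]
      · rw [extendZero_of_mem _ hV, Pi.one_apply]
      · exact fun W _ hne => Pi.single_eq_of_ne hne.symm _
      · exact fun h => absurd hV h
    · rw [extendZero_of_notMem _ hV]
      refine Finset.sum_eq_zero fun W hW => Pi.single_eq_of_ne ?_ _
      rintro rfl
      exact hV hW
  have key : ∀ {N : MatFun (RInf K T S)}, IsSylvesterRank N →
      (∀ (U : Set X) (hU : IsClopen U), elt N (piInf K T S (chi K T hU)) = μ.real U) →
      elt N (1 - toRInf K T S n (extendZero K F 1)) ≤ ε := by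
    intro N h e
    rw [← hsum, map_sum, elt_one_sub_sum h _ _ (fun p _ => by rw [← map_mul, hu'])
      fun p _ q _ hpq => by rw [← map_mul, hu p q hpq, map_zero]]
    have : ∀ p ∈ P, elt N (toRInf K T S n (u p)) = μ.real p.1.set := fun p _ => by
      rw [← piInf_chi_level, e, measureReal_level hT]
    rw [Finset.sum_congr rfl this, Finset.sum_sigma]
    simp only [Finset.sum_const, Finset.card_univ, Fintype.card_fin, nsmul_eq_mul]
    rw [Finset.sum_congr rfl fun W _ => mul_comm _ _]
    linarith
  refine ⟨F, inferInstance, inferInstance, fun W => W.1.len, fun W => baseLevel W.1,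
    ((toRInf K T S n : Rn K T S n →ₙ+* RInf K T S)).comp (extendZero K F), fun W => ?_,
    fun x hx => ?_⟩
  · change elt N₁ (toRInf K T S n (extendZero K F _)) = elt N₂ (toRInf K T S n (extendZero K F _))
    rw [extendZero_unitAt, ← piInf_chi_level, e₁, e₂]
  · have hsub : x - toRInf K T S n (extendZero K F fun W => x' ⟨x, hx⟩ W.1) =
        (1 - toRInf K T S n (extendZero K F 1)) * x := by
      have : extendZero K F (fun W => x' ⟨x, hx⟩ W.1) = extendZero K F 1 * x' ⟨x, hx⟩ := by
        funext V
        rw [Pi.mul_apply]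
        by_cases hV : V ∈ F
        · rw [extendZero_of_mem _ hV, extendZero_of_mem _ hV, Pi.one_apply, one_mul]
        · rw [extendZero_of_notMem _ hV, extendZero_of_notMem _ hV, zero_mul]
      rw [this, map_mul, hx' ⟨x, hx⟩, sub_mul, one_mul]
    refine ⟨fun W => x' ⟨x, hx⟩ W.1, ?_, ?_⟩
    · change elt N₁ (x - toRInf K T S n (extendZero K F _)) ≤ ε
      rw [hsub]
      exact (elt_mul_le_left h₁ _ _).trans (key h₁ e₁)
    · change elt N₂ (x - toRInf K T S n (extendZero K F _)) ≤ ε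
      rw [hsub]
      exact (elt_mul_le_left h₂ _ _).trans (key h₂ e₂)

end Uniqueness

/-! ### Contents on clopen sets, and extremality -/

section Extension

variable {X : Type*} [TopologicalSpace X]

theorem isSetRing_isClopen : IsSetRing {U : Set X | IsClopen U} where
  empty_mem := isClopen_empty
  union_mem _ _ := IsClopen.union
  sdiff_mem _ _ := IsClopen.diff

theorem isPiSystem_isClopen : IsPiSystem {U : Set X | IsClopen U} :=
  fun _ hs _ ht _ => IsClopen.inter hs ht

variable [MeasurableSpace X] [BorelSpace X]

theorem generateFrom_isClopen [CompactSpace X] [TotallyDisconnectedSpace X] [T2Space X]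
    [SecondCountableTopology X] :
    ‹MeasurableSpace X› = MeasurableSpace.generateFrom {U : Set X | IsClopen U} := by
  rw [BorelSpace.measurable_eq (α := X)]
  exact (isTopologicalBasis_isClopen (X := X)).borel_eq_generateFrom

/-- A content on the clopen sets that is dominated by a measure extends to a measure. -/
theorem exists_measure_of_content [CompactSpace X] [TotallyDisconnectedSpace X] [T2Space X]
    [SecondCountableTopology X] (μ : Measure X) [IsProbabilityMeasure μ] (ν : Set X → ℝ)
    (h0 : ∀ U, 0 ≤ ν U)
    (hadd : ∀ U V, IsClopen U → IsClopen V → Disjoint U V → ν (U ∪ V) = ν U + ν V) {c : ℝ}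
    (hc : ∀ U, IsClopen U → ν U ≤ c * μ.real U) :
    ∃ m : Measure X, ∀ U, IsClopen U → m U = ENNReal.ofReal (ν U) := by
  have hempty : ν ∅ = 0 := by
    have := hadd ∅ ∅ isClopen_empty isClopen_empty disjoint_bot_left
    rw [Set.empty_union] at this
    linarith
  let m : AddContent ENNReal {U : Set X | IsClopen U} :=
    isSetRing_isClopen.addContent_of_union (fun U => ENNReal.ofReal (ν U))
      (by simp [hempty]) fun {s t} hs ht hst => by
        rw [hadd s t hs ht hst, ENNReal.ofReal_add (h0 _) (h0 _)]
  have hm : ∀ U, m U = ENNReal.ofReal (ν U) := fun _ => rfl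
  -- Continuity at the empty set is inherited from `μ` by domination; with finite additivity it
  -- yields the σ-additivity that Carathéodory extension requires.
  have hlim : ∀ ⦃s : ℕ → Set X⦄, (∀ n, s n ∈ {U : Set X | IsClopen U}) → Antitone s →
      (⋂ n, s n) = ∅ → Tendsto (fun n => m (s n)) atTop (𝓝 0) := by
    intro s hs hanti hinter
    have h1 := tendsto_measure_iInter_atTop (μ := μ) (s := s)
      (fun n => (hs n).isOpen.measurableSet.nullMeasurableSet) hanti ⟨0, measure_ne_top _ _⟩
    rw [hinter, measure_empty] at h1
    have h2 : Tendsto (fun n => c * μ.real (s n)) atTop (𝓝 0) := by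
      have := (ENNReal.tendsto_toReal ENNReal.zero_ne_top).comp h1
      rw [← mul_zero c]
      exact this.const_mul c
    have h3 : Tendsto (fun n => ν (s n)) atTop (𝓝 0) :=
      squeeze_zero (fun _ => h0 _) (fun n => hc _ (hs n)) h2
    simpa [hm] using ENNReal.tendsto_ofReal h3
  have hsub := isSigmaSubadditive_of_addContent_iUnion_eq_tsum isSetRing_isClopen
    fun f hf hU hd => addContent_iUnion_eq_sum_of_tendsto_zero isSetRing_isClopen m
      (fun s _ => by simp [hm]) hlim hf hU hd
  exact ⟨m.measure isSetRing_isClopen.isSetSemiring generateFrom_isClopen.le hsub, fun U hU =>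
    m.measure_eq isSetRing_isClopen.isSetSemiring generateFrom_isClopen hsub hU⟩

/-- If an ergodic measure is a proper convex combination of two contents on the clopen sets, the
first of which is invariant, then it is equal to the first. -/
theorem content_eq_of_ergodic [CompactSpace X] [TotallyDisconnectedSpace X] [T2Space X]
    [SecondCountableTopology X] {T : X ≃ₜ X} {μ : Measure X} [IsProbabilityMeasure μ]
    (hT : Ergodic T μ) {ν₁ ν₂ : Set X → ℝ} (h₁ : ∀ U, 0 ≤ ν₁ U) (h₂ : ∀ U, 0 ≤ ν₂ U)
    (hadd₁ : ∀ U V, IsClopen U → IsClopen V → Disjoint U V → ν₁ (U ∪ V) = ν₁ U + ν₁ V)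
    (hadd₂ : ∀ U V, IsClopen U → IsClopen V → Disjoint U V → ν₂ (U ∪ V) = ν₂ U + ν₂ V)
    (huniv : ν₁ Set.univ = 1) {a b : ℝ} (ha : 0 < a) (hb : 0 < b)
    (hab : ∀ U, IsClopen U → a * ν₁ U + b * ν₂ U = μ.real U)
    (hinv : ∀ U, IsClopen U → ν₁ (T ⁻¹' U) = ν₁ U) {U : Set X} (hU : IsClopen U) :
    ν₁ U = μ.real U := by
  obtain ⟨m₁, hm₁⟩ := exists_measure_of_content μ ν₁ h₁ hadd₁ (c := a⁻¹) fun U hU => by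
    rw [← hab U hU, le_inv_mul_iff₀ ha]
    have := mul_nonneg hb.le (h₂ U)
    linarith
  obtain ⟨m₂, hm₂⟩ := exists_measure_of_content μ ν₂ h₂ hadd₂ (c := b⁻¹) fun U hU => by
    rw [← hab U hU, le_inv_mul_iff₀ hb]
    have := mul_nonneg ha.le (h₁ U)
    linarith
  have : IsProbabilityMeasure m₁ := ⟨by rw [hm₁ _ isClopen_univ, huniv, ENNReal.ofReal_one]⟩
  -- Both contents are extended so that the convex combination holds on all Borel sets and not only
  -- on clopen ones; this yields `m₁ ≪ μ`.
  have hμ : μ = ENNReal.ofReal a • m₁ + ENNReal.ofReal b • m₂ := by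
    have key : ∀ U, IsClopen U → μ U = (ENNReal.ofReal a • m₁ + ENNReal.ofReal b • m₂) U := by
      intro U hU
      rw [Measure.add_apply, Measure.smul_apply, Measure.smul_apply, hm₁ U hU, hm₂ U hU,
        smul_eq_mul, smul_eq_mul, ← ENNReal.ofReal_mul ha.le, ← ENNReal.ofReal_mul hb.le,
        ← ENNReal.ofReal_add (mul_nonneg ha.le (h₁ U)) (mul_nonneg hb.le (h₂ U)), hab U hU,
        ofReal_measureReal]
    exact ext_of_generate_finite _ generateFrom_isClopen isPiSystem_isClopen key
      (key _ isClopen_univ)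
  have hac : m₁ ≪ μ := by
    refine Measure.AbsolutelyContinuous.mk fun s _ hs => ?_
    rw [hμ, Measure.add_apply, add_eq_zero, Measure.smul_apply, smul_eq_mul, mul_eq_zero] at hs
    exact hs.1.resolve_left (by simpa using ha)
  have hpres : MeasurePreserving T m₁ m₁ := by
    refine ⟨T.measurable, ?_⟩
    have : IsProbabilityMeasure (m₁.map T) :=
      Measure.isProbabilityMeasure_map T.measurable.aemeasurable
    refine ext_of_generate_finite _ generateFrom_isClopen isPiSystem_isClopen (fun U hU => ?_)
      (by simp)
    rw [Measure.map_apply T.measurable (IsClopen.isOpen hU).measurableSet,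
      hm₁ _ (IsClopen.preimage hU T.continuous), hm₁ _ hU, hinv U hU]
  have he := hT.eq_of_absolutelyContinuous hpres hac
  rw [← he, measureReal_def, hm₁ U hU, ENNReal.toReal_ofReal (h₁ U)]

end Extension

/-! ### Ranks of characteristic functions as contents -/

section Extreme

variable {K : Type*} [Field K] {X : Type*} [TopologicalSpace X] {R : Type*} [Ring R]

open Classical in
/-- The function on clopen sets that is given by the ranks of characteristic functions. -/
def clopenContent (ψ : LocallyConstant X K →+* R) (N : MatFun R) (U : Set X) : ℝ :=
  if h : IsClopen U then elt N (ψ (LocallyConstant.charFn K h)) else 0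

theorem clopenContent_eq (ψ : LocallyConstant X K →+* R) (N : MatFun R) {U : Set X}
    (h : IsClopen U) : clopenContent ψ N U = elt N (ψ (LocallyConstant.charFn K h)) := dif_pos h

theorem clopenContent_nonneg (ψ : LocallyConstant X K →+* R) {N : MatFun R}
    (hN : IsSylvesterRank N) (U : Set X) : 0 ≤ clopenContent ψ N U := by
  unfold clopenContent
  split_ifs
  · exact elt_nonneg hN _
  · exact le_rfl

theorem charFn_univ : LocallyConstant.charFn K (isClopen_univ (X := X)) = 1 :=
  LocallyConstant.ext fun x => charFn_of_mem _ (Set.mem_univ x)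

theorem charFn_mul {U V W : Set X} (hU : IsClopen U) (hV : IsClopen V) (hW : IsClopen W)
    (h : U ∩ V = W) : LocallyConstant.charFn K hU * LocallyConstant.charFn K hV =
      LocallyConstant.charFn K hW := by
  refine LocallyConstant.ext fun x => ?_
  rw [LocallyConstant.mul_apply]
  by_cases h1 : x ∈ U
  · by_cases h2 : x ∈ V
    · rw [charFn_of_mem _ h1, charFn_of_mem _ h2, charFn_of_mem _ (h ▸ ⟨h1, h2⟩), mul_one]
    · rw [charFn_of_notMem _ h2, mul_zero, charFn_of_notMem _ (h ▸ fun h3 => h2 h3.2)]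
  · rw [charFn_of_notMem _ h1, zero_mul, charFn_of_notMem _ (h ▸ fun h3 => h1 h3.1)]

theorem charFn_empty : LocallyConstant.charFn K (isClopen_empty (X := X)) = 0 :=
  LocallyConstant.ext fun x => charFn_of_notMem _ (Set.notMem_empty x)

theorem charFn_union {U V : Set X} (hU : IsClopen U) (hV : IsClopen V) (h : Disjoint U V) :
    LocallyConstant.charFn K (hU.union hV) =
      LocallyConstant.charFn K hU + LocallyConstant.charFn K hV := by
  refine LocallyConstant.ext fun x => ?_
  rw [LocallyConstant.add_apply]
  by_cases h1 : x ∈ U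
  · rw [charFn_of_mem (hU.union hV) (Or.inl h1), charFn_of_mem _ h1,
      charFn_of_notMem _ (Set.disjoint_left.1 h h1), add_zero]
  · by_cases h2 : x ∈ V
    · rw [charFn_of_mem (hU.union hV) (Or.inr h2), charFn_of_mem _ h2, charFn_of_notMem _ h1,
        zero_add]
    · rw [charFn_of_notMem _ h1, charFn_of_notMem _ h2,
        charFn_of_notMem (hU.union hV) fun h3 => h3.elim h1 h2, add_zero]

theorem clopenContent_univ (ψ : LocallyConstant X K →+* R) {N : MatFun R}
    (hN : IsSylvesterRank N) : clopenContent ψ N Set.univ = 1 := by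
  rw [clopenContent_eq ψ N isClopen_univ, charFn_univ, map_one, elt_one hN]

theorem clopenContent_union (ψ : LocallyConstant X K →+* R) {N : MatFun R}
    (hN : IsSylvesterRank N) {U V : Set X} (hU : IsClopen U) (hV : IsClopen V)
    (h : Disjoint U V) :
    clopenContent ψ N (U ∪ V) = clopenContent ψ N U + clopenContent ψ N V := by
  rw [clopenContent_eq ψ N hU, clopenContent_eq ψ N hV, clopenContent_eq ψ N (hU.union hV),
    charFn_union hU hV h, map_add]
  refine elt_add_of_orthogonal hN ?_ ?_ ?_ ?_
  · rw [← map_mul, charFn_mul hU hU hU (Set.inter_self U)]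
  · rw [← map_mul, charFn_mul hV hV hV (Set.inter_self V)]
  · rw [← map_mul, charFn_mul hU hV isClopen_empty h.inter_eq, charFn_empty, map_zero]
  · rw [← map_mul, charFn_mul hV hU isClopen_empty h.symm.inter_eq, charFn_empty, map_zero]

/-- If `μ` is given by a proper convex combination of two rank functions, the first of which is
invariant on the clopen sets that do not meet all `E n`, then it is given by the first one. -/
theorem elt_eq_of_ergodic [CompactSpace X] [TotallyDisconnectedSpace X] [T2Space X]
    [SecondCountableTopology X] [Infinite X] [MeasurableSpace X] [BorelSpace X] {T : X ≃ₜ X}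
    {μ : Measure X} [IsProbabilityMeasure μ] [μ.IsOpenPosMeasure] (hT : Ergodic T μ)
    (S : ApproxSystem X) (ψ : LocallyConstant X K →+* R) {N₁ N₂ : MatFun R}
    (h₁ : IsSylvesterRank N₁) (h₂ : IsSylvesterRank N₂) {a b : ℝ} (ha : 0 < a) (hb : 0 < b)
    (hab : ∀ (U : Set X) (hU : IsClopen U), a * elt N₁ (ψ (LocallyConstant.charFn K hU)) +
      b * elt N₂ (ψ (LocallyConstant.charFn K hU)) = μ.real U)
    (hinv : ∀ (n : ℕ) (U : Set X) (hU : IsClopen U), Disjoint U (S.E n) →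
      elt N₁ (ψ (shift T (-1) (LocallyConstant.charFn K hU))) =
        elt N₁ (ψ (LocallyConstant.charFn K hU)))
    {U : Set X} (hU : IsClopen U) : elt N₁ (ψ (LocallyConstant.charFn K hU)) = μ.real U := by
  rw [← clopenContent_eq ψ N₁ hU]
  have hab' : ∀ U, IsClopen U → a * clopenContent ψ N₁ U + b * clopenContent ψ N₂ U = μ.real U :=
    fun U hU => by rw [clopenContent_eq ψ N₁ hU, clopenContent_eq ψ N₂ hU, hab]
  have hbound : ∀ U, IsClopen U → clopenContent ψ N₁ U ≤ a⁻¹ * μ.real U := fun U hU => by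
    rw [← hab' U hU, le_inv_mul_iff₀ ha]
    have := mul_nonneg hb.le (clopenContent_nonneg ψ h₂ U)
    linarith
  refine content_eq_of_ergodic hT (clopenContent_nonneg ψ h₁) (clopenContent_nonneg ψ h₂)
    (fun _ _ => clopenContent_union ψ h₁) (fun _ _ => clopenContent_union ψ h₂)
    (clopenContent_univ ψ h₁) ha hb hab' (fun U hU => ?_) hU
  have hmono : ∀ {U V : Set X}, U ⊆ V → IsClopen U → IsClopen V →
      clopenContent ψ N₁ U ≤ clopenContent ψ N₁ V := fun {U V} h hU hV => by
    rw [← Set.union_sdiff_cancel h, clopenContent_union ψ h₁ hU (hV.diff hU) Set.disjoint_sdiff_right]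
    linarith [clopenContent_nonneg ψ h₁ (V \ U)]
  -- Invariance holds for `U \ E_n`. The remaining pieces `U ∩ E_n` and `T⁻¹(U ∩ E_n)` have content
  -- at most `a⁻¹ * μ(E_n)`, which tends to zero.
  have key : ∀ n, |clopenContent ψ N₁ (T ⁻¹' U) - clopenContent ψ N₁ U| ≤
      a⁻¹ * μ.real (S.E n) := by
    intro n
    have hE := S.isClopen_E n
    have hd := hU.diff hE
    have hi := hU.inter hE
    have e1 : clopenContent ψ N₁ U =
        clopenContent ψ N₁ (U \ S.E n) + clopenContent ψ N₁ (U ∩ S.E n) := by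
      rw [← clopenContent_union ψ h₁ hd hi Set.disjoint_sdiff_inter, Set.sdiff_union_inter]
    have e2 : clopenContent ψ N₁ (T ⁻¹' U) =
        clopenContent ψ N₁ (T ⁻¹' (U \ S.E n)) + clopenContent ψ N₁ (T ⁻¹' (U ∩ S.E n)) := by
      rw [← clopenContent_union ψ h₁ (hd.preimage T.continuous) (hi.preimage T.continuous)
        (Set.disjoint_sdiff_inter.preimage T), ← Set.preimage_union, Set.sdiff_union_inter]
    have e3 : clopenContent ψ N₁ (T ⁻¹' (U \ S.E n)) = clopenContent ψ N₁ (U \ S.E n) := by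
      rw [clopenContent_eq ψ N₁ hd, clopenContent_eq ψ N₁ (hd.preimage T.continuous),
        ← hinv n _ hd Set.disjoint_sdiff_left]
      rfl
    have b1 : clopenContent ψ N₁ (U ∩ S.E n) ≤ a⁻¹ * μ.real (S.E n) :=
      (hmono Set.inter_subset_right hi hE).trans (hbound _ hE)
    have b2 : clopenContent ψ N₁ (T ⁻¹' (U ∩ S.E n)) ≤ a⁻¹ * μ.real (S.E n) := by
      refine (hmono (Set.preimage_mono Set.inter_subset_right) (hi.preimage T.continuous)
        (hE.preimage T.continuous)).trans ((hbound _ (hE.preimage T.continuous)).trans_eq ?_)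
      rw [hT.toMeasurePreserving.measureReal_preimage hE.isOpen.measurableSet.nullMeasurableSet]
    have c1 := clopenContent_nonneg ψ h₁ (U ∩ S.E n)
    have c2 := clopenContent_nonneg ψ h₁ (T ⁻¹' (U ∩ S.E n))
    rw [abs_le]
    constructor <;> linarith
  have hlim : Tendsto (fun n => a⁻¹ * μ.real (S.E n)) atTop (𝓝 0) := by
    simpa using (tendsto_measure_E (S := S) hT).const_mul a⁻¹
  have := ge_of_tendsto' hlim key
  exact sub_eq_zero.1 (abs_nonpos_iff.1 this)

end Extreme

/-! ### Extremality of the rank functions on `𝒜` and `ℜ_∞` -/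

section Applications

variable {K : Type*} [Field K] {X : Type*} [TopologicalSpace X] {T : X ≃ₜ X} {S : ApproxSystem X}

/-- The inclusion `C_K(X) ⊆ 𝒜` as a ring homomorphism. -/
def inclHom (K : Type*) [Field K] (T : X ≃ₜ X) : LocallyConstant X K →+* CrossedProduct K T where
  toFun f := mono T f 0
  map_one' := mono_one_zero
  map_mul' f g := (mono_zero_mul f g 0).symm
  map_zero' := mono_zero 0
  map_add' f g := mono_add f g 0

/-- The composite of `π_∞` and the inclusion `C_K(X) ⊆ 𝒜_∞`. -/
def inclInfHom (K : Type*) [Field K] (T : X ≃ₜ X) [CompactSpace X] (S : ApproxSystem X) :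
    LocallyConstant X K →+* RInf K T S where
  toFun f := piInf K T S (mono T f 0)
  map_one' := by rw [mono_one_zero, piInf_one]
  map_mul' f g := by
    rw [← mono_zero_mul]
    exact piInf_mul (incl_mem_AInf f) (incl_mem_AInf g)
  map_zero' := by rw [mono_zero, piInf_zero]
  map_add' f g := by
    rw [mono_add]
    exact piInf_add (incl_mem_AInf f) (incl_mem_AInf g)

theorem shift_shift {X Y : Type*} [TopologicalSpace X] {T : X ≃ₜ X} (i j : ℤ)
    (f : LocallyConstant X Y) :
    shift T i (shift T j f) = shift T (i + j) f := by
  refine LocallyConstant.ext fun x => ?_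
  rw [shift_apply, shift_apply, shift_apply, ← Homeomorph.mul_apply, ← zpow_add, neg_add_rev]

theorem shift_mul (i : ℤ) (f g : LocallyConstant X K) :
    shift T i (f * g) = shift T i f * shift T i g := rfl

/-- Conjugation by a partial isometry `g t` moves a function that is supported where `g` is `1`. -/
theorem conj_mono {f g : LocallyConstant X K} (h : g * f * g = f) :
    mono T (shift T (-1) g) (-1) * mono T f 0 * mono T g 1 = mono T (shift T (-1) f) 0 := by
  rw [mono_mul_mono, mono_mul_mono, add_zero, neg_add_cancel, ← shift_mul, ← shift_mul, h]

theorem conj_mono' {f g : LocallyConstant X K} (h : g * f * g = f) :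
    mono T g 1 * mono T (shift T (-1) f) 0 * mono T (shift T (-1) g) (-1) = mono T f 0 := by
  rw [mono_mul_mono, mono_mul_mono, add_zero, add_neg_cancel, shift_shift, shift_shift,
    add_neg_cancel, shift_zero, shift_zero, h]

/-- Each of `e` and `f` is a two-sided multiple of the other. With `u` and `v` the partial
isometries above, this is the source of `T`-invariance. -/
theorem elt_conj {R : Type*} [Ring R] {N : MatFun R} (h : IsSylvesterRank N) {u v e f : R}
    (h1 : u * e * v = f) (h2 : v * f * u = e) : elt N e = elt N f := by
  have key : ∀ {u v e f : R}, u * e * v = f → elt N f ≤ elt N e := fun h1 => by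
    rw [← h1]
    exact (elt_mul_le_left h _ _).trans (elt_mul_le_right h _ _)
  exact le_antisymm (key h2) (key h1)

theorem compl_E_mul {n : ℕ} {U : Set X} (hU : IsClopen U) (h : Disjoint U (S.E n)) :
    LocallyConstant.charFn K (S.isClopen_E n).compl * LocallyConstant.charFn K hU *
      LocallyConstant.charFn K (S.isClopen_E n).compl = LocallyConstant.charFn K hU := by
  have hs := Set.subset_compl_iff_disjoint_right.2 h
  rw [charFn_mul _ hU hU (Set.inter_eq_right.2 hs), charFn_mul hU _ hU (Set.inter_eq_left.2 hs)]

variable [CompactSpace X] [TotallyDisconnectedSpace X] [T2Space X]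
  [SecondCountableTopology X] [Infinite X] [MeasurableSpace X] [BorelSpace X] {μ : Measure X}
  [IsProbabilityMeasure μ] [μ.IsOpenPosMeasure]

theorem mem_extremePoints_of_elt_chi (hT : Ergodic T μ) (S : ApproxSystem X)
    {N : MatFun (CrossedProduct K T)} (hN : IsSylvesterRank N)
    (h : ∀ (U : Set X) (hU : IsClopen U), elt N (chi K T hU) = μ.real U) :
    N ∈ (SylvesterSpace (CrossedProduct K T)).extremePoints ℝ := by
  refine ⟨hN, ?_⟩
  rintro N₁ h₁ N₂ h₂ ⟨a, b, ha, hb, -, rfl⟩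
  refine eq_of_elt_chi hT S h₁ hN (fun U hU => ?_) h
  refine elt_eq_of_ergodic hT S (inclHom K T) h₁ h₂ ha hb h (fun n V hV hd => ?_) hU
  exact elt_conj h₁ (conj_mono' (compl_E_mul hV hd)) (conj_mono (compl_E_mul hV hd))

/-- The conjugation is done by images of `χ_{X∖E_n} t ∈ 𝒜_n`, which lie in `ℜ_∞`. Hence invariance
is first obtained only for clopen sets disjoint from some `E_n`. -/
theorem mem_extremePoints_of_elt_piInf_chi (hT : Ergodic T μ) {N : MatFun (RInf K T S)}
    (hN : IsSylvesterRank N)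
    (h : ∀ (U : Set X) (hU : IsClopen U), elt N (piInf K T S (chi K T hU)) = μ.real U) :
    N ∈ (SylvesterSpace (RInf K T S)).extremePoints ℝ := by
  refine ⟨hN, ?_⟩
  rintro N₁ h₁ N₂ h₂ ⟨a, b, ha, hb, -, rfl⟩
  refine eq_of_elt_piInf_chi hT h₁ hN (fun U hU => ?_) h
  refine elt_eq_of_ergodic hT S (inclInfHom K T S) h₁ h₂ ha hb h (fun n V hV hd => ?_) hU
  have hu : mono T (LocallyConstant.charFn K (S.isClopen_E n).compl) 1 ∈ AInf K T S :=
    Set.mem_iUnion.2 ⟨n, compl_mono_mem_An n⟩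
  have hv : mono T (shift T (-1) (LocallyConstant.charFn K (S.isClopen_E n).compl)) (-1) ∈
      AInf K T S := Set.mem_iUnion.2 ⟨n, compl_mono_neg_mem_An n⟩
  have hf : ∀ f, mono T f 0 ∈ AInf K T S := fun f => incl_mem_AInf f
  have key : ∀ {u v f e}, u ∈ AInf K T S → v ∈ AInf K T S → u * mono T f 0 * v = mono T e 0 →
      piInf K T S u * inclInfHom K T S f * piInf K T S v = inclInfHom K T S e := by
    intro u v f e hu hv h
    change piInf K T S u * piInf K T S (mono T f 0) * piInf K T S v = piInf K T S (mono T e 0)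
    rw [← h, piInf_mul (mul_mem_AInf hu (hf f)) hv, piInf_mul hu (hf f)]
  exact elt_conj h₁ (key hu hv (conj_mono' (compl_E_mul hV hd)))
    (key hv hu (conj_mono (compl_E_mul hV hd)))

end Applications

/-! ### The embedding of `𝒜` into the completion -/

section Embedding

variable {R : Type*} [Ring R] {rk : MatFun R}

/-- Constant sequences. -/
def constCauchy (h : IsSylvesterRank rk) : R →+* cauchySeqs h :=
  (Pi.constRingHom ℕ R).codRestrict (cauchySeqs h)
    fun x ε hε => ⟨0, fun p _ q _ => by simpa [elt_zero h] using hε⟩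

theorem toCompletion_eq (h : IsSylvesterRank rk) (x : R) :
    toCompletion h x = ofCauchy h (constCauchy h x) := rfl

theorem ofCauchy_eq_of_eventually (h : IsSylvesterRank rk) {s t : cauchySeqs h}
    (he : ∀ᶠ k in atTop, s.1 k = t.1 k) : ofCauchy h s = ofCauchy h t := by
  rw [ofCauchy_eq_iff]
  refine tendsto_const_nhds.congr' ?_
  filter_upwards [he] with k hk
  rw [hk, sub_self, elt_zero h]

variable {K : Type*} [Field K] {X : Type*} [TopologicalSpace X] {T : X ≃ₜ X} {S : ApproxSystem X}

/-- The element `χ_{X∖E_n} t` of `𝒜_n`. -/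
def shiftSeq (K : Type*) [Field K] (T : X ≃ₜ X) (S : ApproxSystem X) (n : ℕ) :
    CrossedProduct K T := mono T (LocallyConstant.charFn K (S.isClopen_E n).compl) 1

/-- The element `t⁻¹ χ_{X∖E_n}` of `𝒜_n`. -/
def shiftInvSeq (K : Type*) [Field K] (T : X ≃ₜ X) (S : ApproxSystem X) (n : ℕ) :
    CrossedProduct K T :=
  mono T (shift T (-1) (LocallyConstant.charFn K (S.isClopen_E n).compl)) (-1)

theorem shiftSeq_mem (n : ℕ) : shiftSeq K T S n ∈ AInf K T S :=
  Set.mem_iUnion.2 ⟨n, compl_mono_mem_An n⟩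

theorem shiftInvSeq_mem (n : ℕ) : shiftInvSeq K T S n ∈ AInf K T S :=
  Set.mem_iUnion.2 ⟨n, compl_mono_neg_mem_An n⟩

theorem charFn_mul_compl_E {n k : ℕ} (h : n ≤ k) {U : Set X} (hU : IsClopen U)
    (hd : U ⊆ (S.E n)ᶜ) : LocallyConstant.charFn K hU *
      LocallyConstant.charFn K (S.isClopen_E k).compl = LocallyConstant.charFn K hU :=
  charFn_mul _ _ _ (Set.inter_eq_left.2 (hd.trans (Set.compl_subset_compl.2 (S.antitone_E h))))

/-- The difference has `χ_{E_n}` as a factor, so its rank is at most `μ(E_n)`, uniformly in `k`.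
This is the Cauchy estimate; for the inverse sequence the factor stands on the right. -/
theorem shiftSeq_sub {n k : ℕ} (h : n ≤ k) :
    shiftSeq K T S k - shiftSeq K T S n = chi K T (S.isClopen_E n) * shiftSeq K T S k := by
  have e' : LocallyConstant.charFn K (S.isClopen_E n) =
      1 - LocallyConstant.charFn K (S.isClopen_E n).compl := by
    rw [charFn_compl, sub_sub_cancel]
  rw [chi_eq_mono, shiftSeq, shiftSeq, mono_zero_mul, ← mono_sub, e', sub_mul, one_mul,
    charFn_mul_compl_E h _ subset_rfl]

theorem shiftInvSeq_sub {n k : ℕ} (h : n ≤ k) : shiftInvSeq K T S k - shiftInvSeq K T S n =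
    shiftInvSeq K T S k * chi K T (S.isClopen_E n) := by
  have e' : LocallyConstant.charFn K (S.isClopen_E n) =
      1 - LocallyConstant.charFn K (S.isClopen_E n).compl := by
    rw [charFn_compl, sub_sub_cancel]
  rw [chi_eq_mono, shiftInvSeq, shiftInvSeq, mono_mul_mono, add_zero, ← mono_sub, e', ← shift_mul,
    mul_sub, mul_one, mul_comm, charFn_mul_compl_E h _ subset_rfl]
  rfl

theorem shiftSeq_mul_shiftInvSeq (n : ℕ) :
    1 - shiftSeq K T S n * shiftInvSeq K T S n = chi K T (S.isClopen_E n) := by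
  rw [shiftSeq, shiftInvSeq, mono_mul_mono, shift_shift, add_neg_cancel, shift_zero,
    charFn_mul_compl_E le_rfl _ subset_rfl, ← chi_eq_mono, chi_compl, sub_sub_cancel]

theorem shiftInvSeq_mul_shiftSeq (n : ℕ) : 1 - shiftInvSeq K T S n * shiftSeq K T S n =
    chi K T ((S.isClopen_E n).preimage T.continuous) := by
  rw [shiftSeq, shiftInvSeq, mono_mul_mono, ← shift_mul, neg_add_cancel,
    charFn_mul_compl_E le_rfl _ subset_rfl]
  have : mono T (shift T (-1) (LocallyConstant.charFn K (S.isClopen_E n).compl)) 0 =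
      chi K T ((S.isClopen_E n).preimage T.continuous).compl := rfl
  rw [this, chi_compl, sub_sub_cancel]

theorem cauchy_of_elt_sub_le (h : IsSylvesterRank rk) {s : ℕ → R} {c : ℕ → ℝ}
    (hc : Tendsto c atTop (𝓝 0)) (hs : ∀ n k, n ≤ k → elt rk (s k - s n) ≤ c n) :
    s ∈ cauchySeqs h := by
  intro ε hε
  obtain ⟨n, hn⟩ := (hc.eventually (gt_mem_nhds (half_pos hε))).exists
  refine ⟨n, fun p hp q hq => ?_⟩
  have e : s p - s q = (s p - s n) - (s q - s n) := by abel
  rw [e]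
  have := elt_sub_le h (s p - s n) (s q - s n)
  linarith [hs n p hp, hs n q hq]

variable [CompactSpace X] [T2Space X] [Infinite X] [MeasurableSpace X] [BorelSpace X]
  {μ : Measure X} [IsProbabilityMeasure μ] [μ.IsOpenPosMeasure] {rkR : MatFun (RInf K T S)}

theorem shiftSeq_cauchy (hT : Ergodic T μ) (hR : IsSylvesterRank rkR)
    (hμ : ∀ (U : Set X) (hU : IsClopen U), elt rkR (piInf K T S (chi K T hU)) = μ.real U) :
    (fun n => piInf K T S (shiftSeq K T S n)) ∈ cauchySeqs hR := by
  refine cauchy_of_elt_sub_le hR (tendsto_measure_E (S := S) hT) fun n k h => ?_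
  rw [← piInf_sub (shiftSeq_mem k) (shiftSeq_mem n), shiftSeq_sub h,
    piInf_mul (chi_mem_AInf _) (shiftSeq_mem k), ← hμ _ (S.isClopen_E n)]
  exact elt_mul_le_left hR _ _

theorem shiftInvSeq_cauchy (hT : Ergodic T μ) (hR : IsSylvesterRank rkR)
    (hμ : ∀ (U : Set X) (hU : IsClopen U), elt rkR (piInf K T S (chi K T hU)) = μ.real U) :
    (fun n => piInf K T S (shiftInvSeq K T S n)) ∈ cauchySeqs hR := by
  refine cauchy_of_elt_sub_le hR (tendsto_measure_E (S := S) hT) fun n k h => ?_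
  rw [← piInf_sub (shiftInvSeq_mem k) (shiftInvSeq_mem n), shiftInvSeq_sub h,
    piInf_mul (shiftInvSeq_mem k) (chi_mem_AInf _), ← hμ _ (S.isClopen_E n)]
  exact elt_mul_le_right hR _ _

/-- The invertible element of the completion that represents `t`. -/
def shiftUnit (hT : Ergodic T μ) (hR : IsSylvesterRank rkR)
    (hμ : ∀ (U : Set X) (hU : IsClopen U), elt rkR (piInf K T S (chi K T hU)) = μ.real U) :
    (RankCompletion hR)ˣ where
  val := ofCauchy hR ⟨_, shiftSeq_cauchy hT hR hμ⟩
  inv := ofCauchy hR ⟨_, shiftInvSeq_cauchy hT hR hμ⟩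
  -- The defects of the two products are `χ_{E_n}` and `χ_{T⁻¹ E_n}`; both have rank `μ(E_n)`, the
  -- second by invariance of `μ`.
  val_inv := by
    rw [← map_mul, ← map_one (ofCauchy hR), eq_comm, ofCauchy_eq_iff]
    refine (tendsto_measure_E (S := S) hT).congr fun n => ?_
    rw [← hμ _ (S.isClopen_E n), ← shiftSeq_mul_shiftInvSeq, piInf_sub one_mem_AInf
      (mul_mem_AInf (shiftSeq_mem n) (shiftInvSeq_mem n)),
      piInf_mul (shiftSeq_mem n) (shiftInvSeq_mem n), piInf_one]
    rfl
  inv_val := by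
    rw [← map_mul, ← map_one (ofCauchy hR), eq_comm, ofCauchy_eq_iff]
    refine (tendsto_measure_E (S := S) hT).congr fun n => ?_
    rw [← hT.toMeasurePreserving.measureReal_preimage
        (S.isClopen_E n).isOpen.measurableSet.nullMeasurableSet,
      ← hμ _ ((S.isClopen_E n).preimage T.continuous), ← shiftInvSeq_mul_shiftSeq,
      piInf_sub one_mem_AInf (mul_mem_AInf (shiftInvSeq_mem n) (shiftSeq_mem n)),
      piInf_mul (shiftInvSeq_mem n) (shiftSeq_mem n), piInf_one]
    rfl

theorem shiftUnit_commute (hT : Ergodic T μ) (hR : IsSylvesterRank rkR)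
    (hμ : ∀ (U : Set X) (hU : IsClopen U), elt rkR (piInf K T S (chi K T hU)) = μ.real U)
    (f : LocallyConstant X K) :
    toCompletion hR (inclInfHom K T S (shift T 1 f)) * (shiftUnit hT hR hμ : RankCompletion hR) =
      shiftUnit hT hR hμ * toCompletion hR (inclInfHom K T S f) := by
  have key : ∀ n, inclInfHom K T S (shift T 1 f) * piInf K T S (shiftSeq K T S n) =
      piInf K T S (shiftSeq K T S n) * inclInfHom K T S f := by
    intro n
    refine (piInf_mul (incl_mem_AInf _) (shiftSeq_mem n)).symm.trans
      (Eq.trans ?_ (piInf_mul (shiftSeq_mem n) (incl_mem_AInf _)))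
    rw [shiftSeq, incl_eq_mono, mono_zero_mul, mono_mul_mono, add_zero, mul_comm]
  rw [toCompletion_eq, toCompletion_eq]
  change _ * ofCauchy hR ⟨_, shiftSeq_cauchy hT hR hμ⟩ =
    ofCauchy hR ⟨_, shiftSeq_cauchy hT hR hμ⟩ * _
  rw [← map_mul, ← map_mul]
  exact congrArg (ofCauchy hR) (Subtype.ext (funext key))

theorem shiftUnit_zpow_commute (hT : Ergodic T μ) (hR : IsSylvesterRank rkR)
    (hμ : ∀ (U : Set X) (hU : IsClopen U), elt rkR (piInf K T S (chi K T hU)) = μ.real U) (i : ℤ)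
    (f : LocallyConstant X K) :
    toCompletion hR (inclInfHom K T S (shift T i f)) *
        ((shiftUnit hT hR hμ ^ i : (RankCompletion hR)ˣ) : RankCompletion hR) =
      ((shiftUnit hT hR hμ ^ i : (RankCompletion hR)ˣ) : RankCompletion hR) *
        toCompletion hR (inclInfHom K T S f) := by
  induction i using Int.induction_on generalizing f with
  | zero => rw [shift_zero, zpow_zero, Units.val_one, one_mul, mul_one]
  | succ i ih =>
    rw [add_comm, ← shift_shift, zpow_add, zpow_one, Units.val_mul, ← mul_assoc,
      shiftUnit_commute, mul_assoc, ih, mul_assoc]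
  | pred i ih =>
    have h : ∀ g, toCompletion hR (inclInfHom K T S (shift T (-1) g)) *
        ((shiftUnit hT hR hμ)⁻¹ : (RankCompletion hR)ˣ) =
        ((shiftUnit hT hR hμ)⁻¹ : (RankCompletion hR)ˣ) *
          toCompletion hR (inclInfHom K T S g) := fun g => by
      have := shiftUnit_commute hT hR hμ (shift T (-1) g)
      rw [shift_shift, add_neg_cancel, shift_zero] at this
      rw [Units.eq_inv_mul_iff_mul_eq, ← mul_assoc, ← this, Units.mul_inv_cancel_right]
    rw [sub_eq_neg_add, ← shift_shift, zpow_add, zpow_neg_one, Units.val_mul, ← mul_assoc, h,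
      mul_assoc, ih, mul_assoc]

/-- The homomorphism `Φ` from `𝒜` to the rank completion of `ℜ_∞`. -/
def embed (hT : Ergodic T μ) (hR : IsSylvesterRank rkR)
    (hμ : ∀ (U : Set X) (hU : IsClopen U), elt rkR (piInf K T S (chi K T hU)) = μ.real U) :
    CrossedProduct K T →+* RankCompletion hR :=
  SkewMonoidAlgebra.liftNCRingHom
    (((toCompletion hR).comp (inclInfHom K T S)).comp
      ((toCK K T).symm : CK K T →+* LocallyConstant X K))
    ((Units.coeHom _).comp (zpowersHom _ (shiftUnit hT hR hμ)))
    fun {x y} => shiftUnit_zpow_commute hT hR hμ y.toAdd ((toCK K T).symm x)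

theorem embed_mono (hT : Ergodic T μ) (hR : IsSylvesterRank rkR)
    (hμ : ∀ (U : Set X) (hU : IsClopen U), elt rkR (piInf K T S (chi K T hU)) = μ.real U)
    (f : LocallyConstant X K) (i : ℤ) :
    embed hT hR hμ (mono T f i) = toCompletion hR (inclInfHom K T S f) *
      ((shiftUnit hT hR hμ ^ i : (RankCompletion hR)ˣ) : RankCompletion hR) :=
  SkewMonoidAlgebra.liftNC_single _ _ _ _

theorem embed_mono_zero (hT : Ergodic T μ) (hR : IsSylvesterRank rkR)
    (hμ : ∀ (U : Set X) (hU : IsClopen U), elt rkR (piInf K T S (chi K T hU)) = μ.real U)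
    (f : LocallyConstant X K) :
    embed hT hR hμ (mono T f 0) = toCompletion hR (piInf K T S (mono T f 0)) := by
  rw [embed_mono, zpow_zero, Units.val_one, mul_one]
  rfl

/-- For `k ≥ n` the cut-off `χ_{X∖E_k}` does nothing to `χ_U`, so the sequence representing the left
side is eventually constant. -/
theorem embed_mono_one (hT : Ergodic T μ) (hR : IsSylvesterRank rkR)
    (hμ : ∀ (U : Set X) (hU : IsClopen U), elt rkR (piInf K T S (chi K T hU)) = μ.real U)
    {n : ℕ} {U : Set X} (hU : IsClopen U) (hd : U ⊆ (S.E n)ᶜ) :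
    embed hT hR hμ (mono T (LocallyConstant.charFn K hU) 1) =
      toCompletion hR (piInf K T S (mono T (LocallyConstant.charFn K hU) 1)) := by
  rw [embed_mono, zpow_one, toCompletion_eq, toCompletion_eq]
  change _ * ofCauchy hR ⟨_, shiftSeq_cauchy hT hR hμ⟩ = _
  rw [← map_mul]
  refine ofCauchy_eq_of_eventually hR ?_
  filter_upwards [eventually_ge_atTop n] with k hk
  refine (piInf_mul (incl_mem_AInf _) (shiftSeq_mem k)).symm.trans ?_
  rw [shiftSeq, incl_eq_mono, mono_zero_mul, charFn_mul_compl_E hk _ hd]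
  rfl

theorem embed_mono_neg_one (hT : Ergodic T μ) (hR : IsSylvesterRank rkR)
    (hμ : ∀ (U : Set X) (hU : IsClopen U), elt rkR (piInf K T S (chi K T hU)) = μ.real U)
    {n : ℕ} {U : Set X} (hU : IsClopen U) (hd : U ⊆ (S.E n)ᶜ) :
    embed hT hR hμ (mono T (shift T (-1) (LocallyConstant.charFn K hU)) (-1)) =
      toCompletion hR
        (piInf K T S (mono T (shift T (-1) (LocallyConstant.charFn K hU)) (-1))) := by
  rw [embed_mono, zpow_neg_one, toCompletion_eq, toCompletion_eq]
  change _ * ofCauchy hR ⟨_, shiftInvSeq_cauchy hT hR hμ⟩ = _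
  rw [← map_mul]
  refine ofCauchy_eq_of_eventually hR ?_
  filter_upwards [eventually_ge_atTop n] with k hk
  refine (piInf_mul (incl_mem_AInf _) (shiftInvSeq_mem k)).symm.trans ?_
  rw [shiftInvSeq, incl_eq_mono, mono_zero_mul, ← shift_mul, charFn_mul_compl_E hk _ hd]
  rfl

/-- Both sides respect sums and products on `𝒜_n`, so only scalars and the two kinds of generators
need checking; a generator involves `Z ∈ P_n`, which is disjoint from `E_n`. -/
theorem embed_eq (hT : Ergodic T μ) (hR : IsSylvesterRank rkR)
    (hμ : ∀ (U : Set X) (hU : IsClopen U), elt rkR (piInf K T S (chi K T hU)) = μ.real U)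
    {a : CrossedProduct K T} (ha : a ∈ AInf K T S) :
    embed hT hR hμ a = toCompletion hR (piInf K T S a) := by
  obtain ⟨n, hn⟩ := Set.mem_iUnion.1 ha
  have hA : ∀ {x}, x ∈ An K T S n → x ∈ AInf K T S := fun hx => Set.mem_iUnion.2 ⟨n, hx⟩
  have hZ : ∀ Z : S.P n, Z.1 ⊆ (S.E n)ᶜ := fun Z x hx => ApproxSystem.notMem_E Z.2 hx
  induction hn using Algebra.adjoin_induction with
  | mem x hx =>
    rcases hx with ⟨Z, rfl⟩ | ⟨Z, rfl⟩
    · change embed hT hR hμ (chi K T (S.isClopen_P n Z.1 Z.2) * tpow K T 1) =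
        toCompletion hR (piInf K T S (chi K T (S.isClopen_P n Z.1 Z.2) * tpow K T 1))
      rw [chi_mul_tpow]
      exact embed_mono_one hT hR hμ _ (hZ Z)
    · change embed hT hR hμ (tpow K T (-1) * chi K T (S.isClopen_P n Z.1 Z.2)) =
        toCompletion hR (piInf K T S (tpow K T (-1) * chi K T (S.isClopen_P n Z.1 Z.2)))
      rw [tpow_mul_chi]
      exact embed_mono_neg_one hT hR hμ _ (hZ Z)
  | algebraMap c =>
    have : algebraMap K (CrossedProduct K T) c = mono T (c • 1) 0 := by
      rw [Algebra.algebraMap_eq_smul_one, mono_smul, mono_one_zero]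
    rw [this]
    exact embed_mono_zero hT hR hμ _
  | add x y hx hy ihx ihy =>
    rw [map_add, ihx (hA hx), ihy (hA hy), piInf_add (hA hx) (hA hy), map_add]
  | mul x y hx hy ihx ihy =>
    rw [map_mul, ihx (hA hx), ihy (hA hy), piInf_mul (hA hx) (hA hy), map_mul]

theorem injective_of_isFaithful_pullback {A B : Type*} [Ring A] [Ring B] (Φ : A →+* B)
    {rk : MatFun B} (h : IsSylvesterRank rk) (hf : IsFaithful (pullback Φ rk)) :
    Function.Injective Φ := by
  rw [injective_iff_map_eq_zero]
  intro a ha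
  have : a ∈ {x : A | elt (pullback Φ rk) x = 0} := by
    change elt rk (Φ a) = 0
    rw [ha, elt_zero h]
  rw [hf] at this
  exact this

end Embedding

theorem secondCountableTopology_of_compact_metrizable {X : Type*} [TopologicalSpace X]
    [CompactSpace X] [MetrizableSpace X] : SecondCountableTopology X := by
  let _ := metrizableSpaceMetric X
  exact UniformSpace.secondCountable_of_separable X

end

end RankCP

/-! ### The main theorem -/

theorem proposition4p7 {K : Type*} [Field K] {X : Type*} [TopologicalSpace X] [CompactSpace X]
    [TotallyDisconnectedSpace X] [MetrizableSpace X] [Infinite X] [MeasurableSpace X]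
    [BorelSpace X] (T : X ≃ₜ X) (μ : Measure X) [IsProbabilityMeasure μ] [μ.IsOpenPosMeasure]
    (hT : Ergodic T μ) (S : ApproxSystem X) :
    ∃ (rkR : MatFun (RInf K T S)) (hR : IsSylvesterRank rkR),
      (∀ (n : ℕ) (x : Rn K T S n), elt rkR (toRInf K T S n x) = rkRn μ n x) ∧
      IsFaithful rkR ∧
      (∀ (U : Set X) (hU : IsClopen U), elt rkR (piInf K T S (chi K T hU)) = μ.real U) ∧
      (∀ N ∈ SylvesterSpace (RInf K T S),
        (∀ (U : Set X) (hU : IsClopen U), elt N (piInf K T S (chi K T hU)) = μ.real U) →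
          N = rkR) ∧
      rkR ∈ (SylvesterSpace (RInf K T S)).extremePoints ℝ ∧
      ∃ Φ : CrossedProduct K T →+* RankCompletion hR,
        Function.Injective Φ ∧
        (∀ a ∈ AInf K T S, Φ a = toCompletion hR (piInf K T S a)) ∧
        IsSylvesterRank (pullback Φ (completionRank hR)) ∧
        IsFaithful (pullback Φ (completionRank hR)) ∧
        (∀ (U : Set X) (hU : IsClopen U),
          elt (pullback Φ (completionRank hR)) (chi K T hU) = μ.real U) ∧
        (∀ N ∈ SylvesterSpace (CrossedProduct K T),
          (∀ (U : Set X) (hU : IsClopen U), elt N (chi K T hU) = μ.real U) →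
            N = pullback Φ (completionRank hR)) ∧
        pullback Φ (completionRank hR) ∈
          (SylvesterSpace (CrossedProduct K T)).extremePoints ℝ := by
  have := secondCountableTopology_of_compact_metrizable (X := X)
  have hR := isSylvesterRank_limitRank (K := K) (S := S) hT
  have hμ := fun (U : Set X) (hU : IsClopen U) => elt_limitRank_chi (K := K) (S := S) hT hU
  let Φ := embed hT hR hμ
  have hC := isSylvesterRank_completionRank hR
  have hA : IsSylvesterRank (pullback Φ (completionRank hR)) := hC.pullback Φ
  have hAμ : ∀ (U : Set X) (hU : IsClopen U),
      elt (pullback Φ (completionRank hR)) (chi K T hU) = μ.real U := fun U hU => by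
    rw [elt_pullback, embed_eq hT hR hμ (chi_mem_AInf hU), elt_completionRank_toCompletion, hμ]
  -- Faithfulness uses only the values on clopen sets, without injectivity of `Φ`; injectivity is
  -- then deduced from it.
  have hAf := isFaithful_of_elt_chi hT S hA hAμ
  exact ⟨limitRank K T S μ, hR, fun n x => elt_limitRank hT x, isFaithful_limitRank hT, hμ,
    fun N hN hNμ => eq_of_elt_piInf_chi hT hN hR hNμ hμ,
    mem_extremePoints_of_elt_piInf_chi hT hR hμ, Φ,
    injective_of_isFaithful_pullback Φ hC hAf, fun a ha => embed_eq hT hR hμ ha, hA, hAf, hAμ,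
    fun N hN hNμ => eq_of_elt_chi hT S hN hA hNμ hAμ, mem_extremePoints_of_elt_chi hT S hA hAμ⟩
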